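/- Let $n\ge 1$ and let $\mathcal M$ be an additive category; if $n\ge 2$, assume moreover that $\mathcal M$ is idempotent complete. Compositions are written in diagrammatic order. **$n$-exact structures.** A morphism $g\colon B\to C$ is a weak cokernel of $f\colon A\to B$ if $fg=0$ and every $h\colon B\to W$ with $fh=0$ factors (not necessarily uniquely) through $g$; weak kernels are dual. For a sequence $X\colon X^0\xrightarrow{d^0}X^1\to\cdots\xrightarrow{d^n}X^{n+1}$, the morphisms $(d^1,\dots,d^n)$ form an $n$-cokernel of $d^0$ if $d^k$ is a weak cokernel of $d^{k-1}$ for $1\le k\le n$ and $d^n$ is an epimorphism; $n$-kernels are dual. $X$ is $n$-exact if $(d^1,\dots,d^n)$ is an $n$-cokernel of $d^0$ and $(d^0,\dots,d^{n-1})$ is an $n$-kernel of $d^n$. A morphism $f$ of $n$-exact sequences is a weak isomorphism if $f^k,f^{k+1}$ are isomorphisms for some $k\in\{0,\dots,n+1\}$, where $f^{n+2}:=f^0$. A morphism of complexes $f$ from $X^0\to\cdots\to X^n$ to $Y^0\to\cdots\to Y^n$ is an $n$-pushout diagram along $f^0$ if in its mapping cone $X^0\to X^1\oplus Y^0\to\cdots\to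 X^n\oplus Y^{n-1}\to Y^n$ the morphisms other than the first form an $n$-cokernel of the first; it is an $n$-pullback diagram along $f^n$ if the morphisms other than the last form an $n$-kernel of the last. An $n$-exact structure on $\mathcal M$ is a class $\mathcal X$ of ("admissible") $n$-exact sequences, closed under weak isomorphisms of $n$-exact sequences, such that, calling $d^0$ an admissible monomorphism and $d^n$ an admissible epimorphism for $X\in\mathcal X$: - the zero sequence is in $\mathcal X$; - admissible monomorphisms are closed under composition, and so are admissible epimorphisms; - for $X\in\mathcal X$ and $f\colon X^0\to Y^0$ there is an $n$-pushout diagram of $X^0\to\cdots\to X^n$ along $f$ whose lower row starts with an admissible monomorphism $Y^0\to Y^1$; - for $X\in\mathcal X$ and $g\colon Y^{n+1}\to X^{n+1}$ there is an $n$-pullback diagram of $X^1\to\cdots\to X^{n+1}$ along $g$ whose upper row ends with an admissible epimorphism $Y^n\to Y^{n+1}$. **Frobenius structures and the stable category.** An object $I$ is $\mathcal X$-injective if every morphism $A\to I$ extends along every admissible monomorphism $A\to B$; $\mathcal X$-projective objects are dual. $(\mathcal M,\mathcal X)$ is Frobenius if every object $A$ starts an admissible sequence $A\to I^1\to\cdots\to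 I^n\to B$ with all $I^k$ $\mathcal X$-injective, every object $A$ ends an admissible sequence $B\to P^1\to\cdots\to P^n\to A$ with all $P^k$ $\mathcal X$-projective, and the $\mathcal X$-injective and the $\mathcal X$-projective objects coincide. The stable category $\underline{\mathcal M}$ has the objects of $\mathcal M$, and as morphisms those of $\mathcal M$ modulo the morphisms that factor through an $\mathcal X$-injective object; $\overline f$ denotes the class of $f$. Let $(\mathcal M,\mathcal X)$ be a Frobenius $n$-exact category. For each $A\in\mathcal M$ choose an admissible sequence $I(A)\colon A\to I^1(A)\to\cdots\to I^n(A)\to SA$ with all $I^k(A)$ $\mathcal X$-injective. Every $f\colon A\to B$ extends to a morphism of complexes $I(A)\to I(B)$; let $Sf\colon SA\to SB$ be its last component. Then $\overline{Sf}$ depends only on $\overline f$, and $\Sigma A:=SA$, $\Sigma\overline f:=\overline{Sf}$ defines a functor $\Sigma\colon\underline{\mathcal M}\to\underline{\mathcal M}$. **Angles.** An $n$-$\Sigma$-sequence is a sequence $X^0\xrightarrow{\alpha^0}X^1\to\cdots\xrightarrow{\alpha^n}X^{n+1}\xrightarrow{\alpha^{n+1}}\Sigma X^0$. A morphism $\phi$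 of such sequences is a commutative ladder with components $\phi^0,\dots,\phi^{n+1},\Sigma\phi^0$. Let $\mathcal S(\mathcal X)$ be the class of all $n$-$\Sigma$-sequences in $\underline{\mathcal M}$ isomorphic to a standard one, that is, to $X^0\xrightarrow{\overline{\alpha^0}}X^1\xrightarrow{\overline{\alpha^1}}\cdots\xrightarrow{\overline{\alpha^n}}X^{n+1}\xrightarrow{\overline{\alpha^{n+1}}}\Sigma X^0$ for a morphism of complexes from $I(X^0)$ to an admissible sequence $X^1\xrightarrow{\alpha^1}X^2\to\cdots\to X^{n+1}\xrightarrow{\alpha^{n+1}}SX^0$ with first component $\alpha^0$ and last component $1_{SX^0}$. **Theorem.** For every such choice of the sequences $I(A)$, $\Sigma$ is an autoequivalence of the additive category $\underline{\mathcal M}$, and $(\underline{\mathcal M},\Sigma,\mathcal S(\mathcal X))$ is an $(n+2)$-angulated category in the sense of Geiss–Keller–Oppermann. That is, with $\mathcal S=\mathcal S(\mathcal X)$: - (F1) $\mathcal S$ is closed under direct sums and direct summands; the sequence $A\xrightarrow{1}A\to0\to\cdots\to0\to\Sigma A$ is in $\mathcal S$ for all $A$; every morphism of $\underline{\mathcal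 M}$ is the first morphism of a member of $\mathcal S$. - (F2) A sequence $(\alpha^0,\dots,\alpha^{n+1})$ is in $\mathcal S$ if and only if its left rotation $X^1\xrightarrow{\alpha^1}X^2\to\cdots\to X^{n+1}\xrightarrow{\alpha^{n+1}}\Sigma X^0\xrightarrow{(-1)^n\Sigma\alpha^0}\Sigma X^1$ is. - (F3) For members $(X,\alpha),(Y,\beta)$ of $\mathcal S$ and $\phi^0,\phi^1$ with $\alpha^0\phi^1=\phi^0\beta^0$, there are $\phi^2,\dots,\phi^{n+1}$ completing them to a morphism $\phi\colon X\to Y$. - (F4) In (F3), $\phi^2,\dots,\phi^{n+1}$ can be chosen such that the mapping cone of $\phi$, $$X^1\oplus Y^0\xrightarrow{\gamma^0}X^2\oplus Y^1\to\cdots\xrightarrow{\gamma^n}\Sigma X^0\oplus Y^{n+1}\xrightarrow{\gamma^{n+1}}\Sigma X^1\oplus\Sigma Y^0,\qquad \gamma^k=\begin{pmatrix}-\alpha^{k+1}&0\\ \phi^{k+1}&\beta^k\end{pmatrix},$$ is in $\mathcal S$, where $\alpha^{n+2}:=\Sigma\alpha^0$ and $\phi^{n+2}:=\Sigma\phi^0$.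 -/

import Mathlib

open CategoryTheory CategoryTheory.Limits

open scoped ZeroObject

universe v u

noncomputable section

namespace NExact

/-! ## Sequences of morphisms -/

/-- A sequence of composable morphisms `X⁰ ⟶ X¹ ⟶ X² ⟶ ⋯`. A sequence with finitely many terms is
encoded by such a sequence of which only the first terms are looked at: everything below that
carries a length parameter ignores all the terms and morphisms that lie beyond this length. -/
structure Seq (C : Type u) [Category.{v} C] where
  /-- the objects -/
  obj : ℕ → C
  /-- the morphisms -/
  d : ∀ k, obj k ⟶ obj (k + 1)

section Sequences

variable {C : Type u} [Category.{v} C]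

/-- Put a morphism in front of a sequence: `A ⟶ X⁰ ⟶ X¹ ⟶ ⋯`. -/
def Seq.cons (X : Seq C) {A : C} (f : A ⟶ X.obj 0) : Seq C where
  obj
    | 0 => A
    | k + 1 => X.obj k
  d
    | 0 => f
    | k + 1 => X.d k

/-- A morphism between the initial pieces `X⁰ ⟶ ⋯ ⟶ X^N` and `Y⁰ ⟶ ⋯ ⟶ Y^N` of two sequences:
a commutative ladder with `N` squares. -/
structure SeqHom (N : ℕ) (X Y : Seq C) where
  /-- the components (those of index `> N` are irrelevant) -/
  app : ∀ k, X.obj k ⟶ Y.obj k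
  comm : ∀ k, k < N → X.d k ≫ app (k + 1) = app k ≫ Y.d k

variable [Preadditive C]

/-- `g` is a weak cokernel of `f`. -/
def IsWeakCokernel {A B D : C} (f : A ⟶ B) (g : B ⟶ D) : Prop :=
  f ≫ g = 0 ∧ ∀ (W : C) (h : B ⟶ W), f ≫ h = 0 → ∃ p : D ⟶ W, g ≫ p = h

/-- `f` is a weak kernel of `g`. -/
def IsWeakKernel {A B D : C} (f : A ⟶ B) (g : B ⟶ D) : Prop :=
  f ≫ g = 0 ∧ ∀ (W : C) (h : W ⟶ B), h ≫ g = 0 → ∃ p : W ⟶ A, p ≫ f = h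

/-- In `X⁰ ⟶ X¹ ⟶ ⋯ ⟶ Xⁿ⁺¹`, the morphisms `(d¹, …, dⁿ)` form an `n`-cokernel of `d⁰`: the sequence
`0 ⟶ C(Xⁿ⁺¹, W) ⟶ C(Xⁿ, W) ⟶ ⋯ ⟶ C(X¹, W) ⟶ C(X⁰, W)` is exact for all `W`. -/
def IsNCokernel (n : ℕ) (X : Seq C) : Prop :=
  (∀ k, k < n → IsWeakCokernel (X.d k) (X.d (k + 1))) ∧ Epi (X.d n)

/-- In `X⁰ ⟶ X¹ ⟶ ⋯ ⟶ Xⁿ⁺¹`, the morphisms `(d⁰, …, dⁿ⁻¹)` form an `n`-kernel of `dⁿ`. -/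
def IsNKernel (n : ℕ) (X : Seq C) : Prop :=
  (∀ k, k < n → IsWeakKernel (X.d k) (X.d (k + 1))) ∧ Mono (X.d 0)

/-- `X⁰ ⟶ X¹ ⟶ ⋯ ⟶ Xⁿ⁺¹` is an `n`-exact sequence. -/
def IsNExactSeq (n : ℕ) (X : Seq C) : Prop :=
  IsNKernel n X ∧ IsNCokernel n X

lemma IsNExactSeq.comp_zero {n : ℕ} {X : Seq C} (hX : IsNExactSeq n X) (k : ℕ) (hk : k < n) :
    X.d k ≫ X.d (k + 1) = 0 := (hX.2.1 k hk).1

/-- A ladder with rows `X⁰ ⟶ ⋯ ⟶ Xⁿ⁺¹` and `Y⁰ ⟶ ⋯ ⟶ Yⁿ⁺¹` is a weak isomorphism if two of its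
consecutive components are isomorphisms, where `0` is considered to come after `n + 1`. -/
def SeqHom.IsWeakIso {n : ℕ} {X Y : Seq C} (f : SeqHom (n + 1) X Y) : Prop :=
  (∃ k, k ≤ n ∧ IsIso (f.app k) ∧ IsIso (f.app (k + 1))) ∨
    (IsIso (f.app (n + 1)) ∧ IsIso (f.app 0))

/-- Every initial commutative square between an `n`-exact sequence and a complex extends to a
ladder. -/
lemma exists_seqHom {n : ℕ} {X Y : Seq C} (hX : IsNExactSeq n X) (hY : IsNExactSeq n Y)
    (a : X.obj 0 ⟶ Y.obj 0) (b : X.obj 1 ⟶ Y.obj 1) (hab : X.d 0 ≫ b = a ≫ Y.d 0) :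
    ∃ φ : SeqHom (n + 1) X Y, φ.app 0 = a ∧ φ.app 1 = b := by
  let T : ℕ → Type v := fun k =>
    {p : (X.obj k ⟶ Y.obj k) × (X.obj (k + 1) ⟶ Y.obj (k + 1)) //
      k < n + 1 → X.d k ≫ p.2 = p.1 ≫ Y.d k}
  have step : ∀ (k : ℕ) (p : T k), ∃ q : T (k + 1), q.1.1 = p.1.2 := by
    rintro k ⟨⟨p, q⟩, h⟩
    by_cases hk : k < n
    · obtain ⟨r, hr⟩ := (hX.2.1 k hk).2 _ (q ≫ Y.d (k + 1)) (by
        have := h (by omega)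
        dsimp at this
        rw [← Category.assoc, this, Category.assoc, hY.comp_zero k hk, comp_zero])
      exact ⟨⟨(q, r), fun _ => hr⟩, rfl⟩
    · exact ⟨⟨(q, 0), fun hk' => absurd hk' (by omega)⟩, rfl⟩
  choose next hnext using step
  let t : ∀ k, T k := fun k => Nat.rec ⟨(a, b), fun _ => hab⟩ (fun k p => next k p) k
  refine ⟨⟨fun k => (t k).1.1, fun k hk => ?_⟩, rfl, hnext 0 (t 0)⟩
  have h1 : (t (k + 1)).1.1 = (t k).1.2 := hnext k (t k)
  rw [h1]
  exact (t k).2 hk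

/-- If the first component of a ladder between `n`-exact sequences factors through the first
morphism of the upper row, then its last component factors through the last morphism of the
lower row. -/
lemma exists_last_factor {n : ℕ} {X Y : Seq C} (hX : IsNExactSeq n X) (hY : IsNExactSeq n Y)
    (φ : SeqHom (n + 1) X Y) (w : X.obj 1 ⟶ Y.obj 0) (hw : X.d 0 ≫ w = φ.app 0) :
    ∃ h : X.obj (n + 1) ⟶ Y.obj n, h ≫ Y.d n = φ.app (n + 1) := by
  have key : ∀ k, k ≤ n → ∃ h : X.obj (k + 1) ⟶ Y.obj k,
      X.d k ≫ (φ.app (k + 1) - h ≫ Y.d k) = 0 := by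
    intro k
    induction k with
    | zero =>
      intro _
      refine ⟨w, ?_⟩
      rw [Preadditive.comp_sub, φ.comm 0 (by omega), ← hw, Category.assoc, sub_self]
    | succ k ih =>
      intro hk
      obtain ⟨h, hh⟩ := ih (by omega)
      obtain ⟨p, hp⟩ := (hX.2.1 k (by omega)).2 _ _ hh
      refine ⟨p, ?_⟩
      rw [Preadditive.comp_sub, φ.comm (k + 1) (by omega), ← Category.assoc, hp,
        Preadditive.sub_comp, sub_sub_self, Category.assoc, hY.comp_zero k (by omega), comp_zero]
  obtain ⟨h, hh⟩ := key n le_rfl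
  have := hX.2.2
  refine ⟨h, ?_⟩
  rw [← cancel_epi (X.d n), eq_comm, ← sub_eq_zero, ← Preadditive.comp_sub, hh]

variable [HasBinaryBiproducts C]

/-- The sequence `X⁰ ⟶ X¹ ⊕ Y⁰ ⟶ X² ⊕ Y¹ ⟶ ⋯` with first morphism `(-d, f⁰)` and further
morphisms given by the matrices `[[-d, 0], [f, d]]`. -/
def coneSeq {N : ℕ} {X Y : Seq C} (f : SeqHom N X Y) : Seq C where
  obj
    | 0 => X.obj 0
    | k + 1 => X.obj (k + 1) ⊞ Y.obj k
  d
    | 0 => biprod.lift (-(X.d 0)) (f.app 0)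
    | k + 1 => Biprod.ofComponents (-(X.d (k + 1))) (f.app (k + 1)) 0 (Y.d k)

/-- The ladder `f` from `X⁰ ⟶ ⋯ ⟶ Xⁿ` to `Y⁰ ⟶ ⋯ ⟶ Yⁿ` is an `n`-pushout diagram: in its mapping
cone `X⁰ ⟶ X¹ ⊕ Y⁰ ⟶ ⋯ ⟶ Xⁿ ⊕ Yⁿ⁻¹ ⟶ Yⁿ` all the morphisms but the first form an `n`-cokernel of the
first. The last morphism of the mapping cone is `[fⁿ, d] : Xⁿ ⊕ Yⁿ⁻¹ ⟶ Yⁿ`. -/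
def IsNPushout (n : ℕ) {X Y : Seq C} (f : SeqHom n X Y) : Prop :=
  (∀ k, k + 1 < n → IsWeakCokernel ((coneSeq f).d k) ((coneSeq f).d (k + 1))) ∧
    ∀ m, n = m + 1 →
      IsWeakCokernel ((coneSeq f).d m) (biprod.desc (f.app (m + 1)) (Y.d m)) ∧
        Epi (biprod.desc (f.app (m + 1)) (Y.d m))

/-- The ladder `f` from `X⁰ ⟶ ⋯ ⟶ Xⁿ` to `Y⁰ ⟶ ⋯ ⟶ Yⁿ` is an `n`-pullback diagram: in its mapping
cone `X⁰ ⟶ X¹ ⊕ Y⁰ ⟶ ⋯ ⟶ Xⁿ ⊕ Yⁿ⁻¹ ⟶ Yⁿ` all the morphisms but the last form an `n`-kernel of the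
last. -/
def IsNPullback (n : ℕ) {X Y : Seq C} (f : SeqHom n X Y) : Prop :=
  Mono ((coneSeq f).d 0) ∧
    (∀ k, k + 1 < n → IsWeakKernel ((coneSeq f).d k) ((coneSeq f).d (k + 1))) ∧
      ∀ m, n = m + 1 → IsWeakKernel ((coneSeq f).d m) (biprod.desc (f.app (m + 1)) (Y.d m))

end Sequences

/-- Forget the first object of a sequence. -/
def Seq.tail {C : Type u} [Category.{v} C] (X : Seq C) : Seq C where
  obj k := X.obj (k + 1)
  d k := X.d (k + 1)

/-! ## `n`-exact categories -/

/-- The morphism `f` is the first morphism of a member of the class `adm` of sequences. -/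
def IsFirst {M : Type u} [Category.{v} M] (adm : Seq M → Prop) {A B : M} (f : A ⟶ B) : Prop :=
  ∃ X : Seq M, adm X ∧ Arrow.mk (X.d 0) = Arrow.mk f

/-- The morphism `f` is the last morphism `dⁿ` of a member `X⁰ ⟶ ⋯ ⟶ Xⁿ⁺¹` of the class `adm`. -/
def IsLast (n : ℕ) {M : Type u} [Category.{v} M] (adm : Seq M → Prop) {A B : M} (f : A ⟶ B) :
    Prop :=
  ∃ X : Seq M, adm X ∧ Arrow.mk (X.d n) = Arrow.mk f

/-- An `n`-exact structure on an additive category `M`. -/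
structure NExactStructure (n : ℕ) (M : Type u) [Category.{v} M] [Preadditive M]
    [HasZeroObject M] [HasBinaryBiproducts M] where
  /-- the class of admissible `n`-exact sequences `X⁰ ⟶ ⋯ ⟶ Xⁿ⁺¹` -/
  adm : Seq M → Prop
  isNExactSeq : ∀ X, adm X → IsNExactSeq n X
  /-- closed under weak isomorphisms of `n`-exact sequences -/
  weakIso : ∀ X Y : Seq M, IsNExactSeq n X → IsNExactSeq n Y →
    ∀ f : SeqHom (n + 1) X Y, f.IsWeakIso → (adm X ↔ adm Y)
  /-- (E0) -/
  zero : adm ⟨fun _ => 0, fun _ => 0⟩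
  /-- (E1) -/
  comp_mono : ∀ {A B D : M} (f : A ⟶ B) (g : B ⟶ D),
    IsFirst adm f → IsFirst adm g → IsFirst adm (f ≫ g)
  /-- (E1ᵒᵖ) -/
  comp_epi : ∀ {A B D : M} (f : A ⟶ B) (g : B ⟶ D),
    IsLast n adm f → IsLast n adm g → IsLast n adm (f ≫ g)
  /-- (E2): an `n`-pushout diagram of `X⁰ ⟶ ⋯ ⟶ Xⁿ` along `f` whose lower row starts with an
  admissible monomorphism -/
  pushout : ∀ X : Seq M, adm X → ∀ {B : M} (f : X.obj 0 ⟶ B),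
    ∃ (Y : Seq M) (p : SeqHom n X Y),
      Arrow.mk (p.app 0) = Arrow.mk f ∧ IsNPushout n p ∧ IsFirst adm (Y.d 0)
  /-- (E2ᵒᵖ): an `n`-pullback diagram of `X¹ ⟶ ⋯ ⟶ Xⁿ⁺¹` along `g` whose upper row
  `Y¹ ⟶ ⋯ ⟶ Yⁿ⁺¹` ends with an admissible epimorphism; here `Y` starts in degree `1` -/
  pullback : ∀ X : Seq M, adm X → ∀ {B : M} (g : B ⟶ X.obj (n + 1)),
    ∃ (Y : Seq M) (p : SeqHom n Y.tail X.tail),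
      Arrow.mk (p.app n) = Arrow.mk g ∧ IsNPullback n p ∧ IsLast n adm (Y.d n)

namespace NExactStructure

variable {n : ℕ} {M : Type u} [Category.{v} M] [Preadditive M] [HasZeroObject M]
  [HasBinaryBiproducts M] (𝒳 : NExactStructure n M)

/-- Admissible monomorphisms. -/
def AdmMono {A B : M} (f : A ⟶ B) : Prop := IsFirst 𝒳.adm f

/-- Admissible epimorphisms. -/
def AdmEpi {A B : M} (f : A ⟶ B) : Prop := IsLast n 𝒳.adm f

/-- `𝒳`-injective objects. -/
def Inj (I : M) : Prop :=
  ∀ {A B : M} (f : A ⟶ B), 𝒳.AdmMono f → ∀ g : A ⟶ I, ∃ h : B ⟶ I, f ≫ h = g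

/-- `𝒳`-projective objects. -/
def Proj (P : M) : Prop :=
  ∀ {A B : M} (f : A ⟶ B), 𝒳.AdmEpi f → ∀ g : P ⟶ B, ∃ h : P ⟶ A, h ≫ f = g

/-- Every object `A` starts an admissible `n`-exact sequence `A ⟶ I¹ ⟶ ⋯ ⟶ Iⁿ ⟶ B` with all
`Iᵏ` injective. -/
def EnoughInj : Prop :=
  ∀ A : M, ∃ X : Seq M, 𝒳.adm X ∧ X.obj 0 = A ∧ ∀ k, 1 ≤ k → k ≤ n → 𝒳.Inj (X.obj k)

/-- Every object `A` ends an admissible `n`-exact sequence `B ⟶ P¹ ⟶ ⋯ ⟶ Pⁿ ⟶ A` with all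
`Pᵏ` projective. -/
def EnoughProj : Prop :=
  ∀ A : M, ∃ X : Seq M, 𝒳.adm X ∧ X.obj (n + 1) = A ∧ ∀ k, 1 ≤ k → k ≤ n → 𝒳.Proj (X.obj k)

/-- Frobenius `n`-exact categories. -/
structure IsFrobenius : Prop where
  enoughInj : 𝒳.EnoughInj
  enoughProj : 𝒳.EnoughProj
  inj_iff_proj : ∀ A : M, 𝒳.Inj A ↔ 𝒳.Proj A

/-! ### The stable category -/

/-- `f` factors through an injective object. -/
def FactorsInj {A B : M} (f : A ⟶ B) : Prop :=
  ∃ (I : M) (_ : 𝒳.Inj I) (a : A ⟶ I) (b : I ⟶ B), a ≫ b = f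

/-- Two parallel morphisms are identified if their difference factors through an injective. -/
def stableRel : HomRel M := fun _ _ f g => 𝒳.FactorsInj (f - g)

variable {𝒳}

lemma inj_zero : 𝒳.Inj (0 : M) := fun _ _ _ => ⟨0, (isZero_zero M).eq_of_tgt _ _⟩

lemma Inj.biprod {I J : M} (hI : 𝒳.Inj I) (hJ : 𝒳.Inj J) : 𝒳.Inj (I ⊞ J) := by
  intro A B f hf g
  obtain ⟨a, ha⟩ := hI f hf (g ≫ biprod.fst)
  obtain ⟨b, hb⟩ := hJ f hf (g ≫ biprod.snd)
  exact ⟨biprod.lift a b, by ext <;> simp [ha, hb]⟩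

lemma FactorsInj.zero {A B : M} : 𝒳.FactorsInj (0 : A ⟶ B) := ⟨0, inj_zero, 0, 0, by simp⟩

lemma FactorsInj.neg {A B : M} {f : A ⟶ B} (hf : 𝒳.FactorsInj f) : 𝒳.FactorsInj (-f) := by
  obtain ⟨I, hI, a, b, rfl⟩ := hf
  exact ⟨I, hI, -a, b, by simp⟩

lemma FactorsInj.add {A B : M} {f g : A ⟶ B} (hf : 𝒳.FactorsInj f) (hg : 𝒳.FactorsInj g) :
    𝒳.FactorsInj (f + g) := by
  obtain ⟨I, hI, a, b, rfl⟩ := hf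
  obtain ⟨J, hJ, a', b', rfl⟩ := hg
  exact ⟨I ⊞ J, hI.biprod hJ, biprod.lift a a', biprod.desc b b', by simp⟩

lemma FactorsInj.comp_left {A B D : M} {f : A ⟶ B} (hf : 𝒳.FactorsInj f) (g : D ⟶ A) :
    𝒳.FactorsInj (g ≫ f) := by
  obtain ⟨I, hI, a, b, rfl⟩ := hf
  exact ⟨I, hI, g ≫ a, b, by simp⟩

lemma FactorsInj.comp_right {A B D : M} {f : A ⟶ B} (hf : 𝒳.FactorsInj f) (g : B ⟶ D) :
    𝒳.FactorsInj (f ≫ g) := by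
  obtain ⟨I, hI, a, b, rfl⟩ := hf
  exact ⟨I, hI, a, b ≫ g, by simp⟩

variable (𝒳)

instance : Congruence 𝒳.stableRel where
  equivalence := by
    refine ⟨fun f => ?_, fun {f g} h => ?_, fun {f g k} h h' => ?_⟩
    · simpa [stableRel] using FactorsInj.zero
    · simpa [stableRel] using FactorsInj.neg h
    · simpa [stableRel] using FactorsInj.add h h'
  comp_left f g g' h := by
    simpa [stableRel] using FactorsInj.comp_left h f
  comp_right g h := by
    simpa [stableRel] using FactorsInj.comp_right h g

/-- The stable category: the objects of `M`, and morphisms modulo those that factor through an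
injective object. -/
abbrev Stable : Type u := Quotient 𝒳.stableRel

/-- The projection from `M` to its stable category. -/
abbrev Q : M ⥤ 𝒳.Stable := Quotient.functor 𝒳.stableRel

lemma stableRel_add ⦃A B : M⦄ (f₁ f₂ g₁ g₂ : A ⟶ B) (hf : 𝒳.stableRel f₁ f₂)
    (hg : 𝒳.stableRel g₁ g₂) : 𝒳.stableRel (f₁ + g₁) (f₂ + g₂) := by
  have := FactorsInj.add hf hg
  rwa [show f₁ - f₂ + (g₁ - g₂) = f₁ + g₁ - (f₂ + g₂) by abel] at this

instance : Preadditive 𝒳.Stable := Quotient.preadditive _ 𝒳.stableRel_add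

instance : 𝒳.Q.Additive := Quotient.functor_additive _ 𝒳.stableRel_add

instance : HasZeroObject 𝒳.Stable :=
  ⟨⟨𝒳.Q.obj 0, 𝒳.Q.map_isZero (isZero_zero M)⟩⟩

instance : HasBinaryBiproducts 𝒳.Stable where
  has_binary_biproduct A B :=
    have : PreservesBinaryBiproducts 𝒳.Q := preservesBinaryBiproducts_of_preservesBiproducts _
    inferInstanceAs (HasBinaryBiproduct (𝒳.Q.obj A.as) (𝒳.Q.obj B.as))

lemma Q_map_eq_iff {A B : M} (f g : A ⟶ B) : 𝒳.Q.map f = 𝒳.Q.map g ↔ 𝒳.FactorsInj (f - g) :=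
  Quotient.functor_map_eq_iff _ _ _

/-! ### The suspension functor -/

/-- A choice of an admissible `n`-exact sequence `A ⟶ I¹ ⟶ ⋯ ⟶ Iⁿ ⟶ SA` with all `Iᵏ` injective.
The object `tail.obj k` is `Iᵏ⁺¹` for `k < n`, and `tail.obj n` is `SA`. -/
structure InjRes (A : M) where
  /-- the sequence `I¹ ⟶ ⋯ ⟶ Iⁿ ⟶ SA` -/
  tail : Seq M
  /-- the morphism `A ⟶ I¹` -/
  ι : A ⟶ tail.obj 0
  adm : 𝒳.adm (tail.cons ι)
  inj : ∀ k, k < n → 𝒳.Inj (tail.obj k)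

variable {𝒳}

/-- The sequence `A ⟶ I¹ ⟶ ⋯ ⟶ Iⁿ ⟶ SA`. -/
def InjRes.seq {A : M} (I : 𝒳.InjRes A) : Seq M := I.tail.cons I.ι

/-- The `n`-th cosyzygy `SA`. -/
def InjRes.cosyzygy {A : M} (I : 𝒳.InjRes A) : M := I.seq.obj (n + 1)

/-- `s : SA ⟶ SB` is the last component of a ladder `I(A) ⟶ I(B)` with first component `f`. -/
def InjRes.IsLift {A B : M} (I : 𝒳.InjRes A) (J : 𝒳.InjRes B) (f : A ⟶ B)
    (s : I.cosyzygy ⟶ J.cosyzygy) : Prop :=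
  ∃ φ : SeqHom (n + 1) I.seq J.seq, φ.app 0 = f ∧ φ.app (n + 1) = s

lemma InjRes.isNExactSeq {A : M} (I : 𝒳.InjRes A) : IsNExactSeq n I.seq :=
  𝒳.isNExactSeq _ I.adm

lemma InjRes.admMono {A : M} (I : 𝒳.InjRes A) : 𝒳.AdmMono I.ι := ⟨I.seq, I.adm, rfl⟩

lemma InjRes.exists_isLift (hn : 0 < n) {A B : M} (I : 𝒳.InjRes A) (J : 𝒳.InjRes B) (f : A ⟶ B) :
    ∃ s, I.IsLift J f s := by
  obtain ⟨b, hb⟩ := J.inj 0 hn I.ι I.admMono (f ≫ J.ι)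
  obtain ⟨φ, h0, _⟩ := exists_seqHom I.isNExactSeq J.isNExactSeq f b hb
  exact ⟨_, φ, h0, rfl⟩

lemma InjRes.IsLift.factorsInj (hn : 0 < n) {A B : M} {I : 𝒳.InjRes A} {J : 𝒳.InjRes B}
    {f g : A ⟶ B} {s t : I.cosyzygy ⟶ J.cosyzygy} (hs : I.IsLift J f s) (ht : I.IsLift J g t)
    (hfg : 𝒳.FactorsInj (f - g)) : 𝒳.FactorsInj (s - t) := by
  obtain ⟨φ, rfl, rfl⟩ := hs
  obtain ⟨ψ, rfl, rfl⟩ := ht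
  obtain ⟨K, hK, a, b, hab⟩ := hfg
  obtain ⟨a', ha'⟩ := hK I.ι I.admMono a
  let χ : SeqHom (n + 1) I.seq J.seq :=
    ⟨fun k => φ.app k - ψ.app k, fun k hk => by
      rw [Preadditive.comp_sub, Preadditive.sub_comp, φ.comm k hk, ψ.comm k hk]⟩
  obtain ⟨h, hh⟩ := exists_last_factor I.isNExactSeq J.isNExactSeq χ (a' ≫ b) (by
    change I.ι ≫ a' ≫ b = _
    rw [← Category.assoc, ha', hab]
    rfl)
  obtain ⟨m, rfl⟩ : ∃ m, n = m + 1 := ⟨n - 1, by omega⟩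
  exact ⟨J.seq.obj (m + 1), J.inj m (by omega), h, J.seq.d (m + 1), hh⟩

lemma InjRes.IsLift.id {A : M} (I : 𝒳.InjRes A) : I.IsLift I (𝟙 A) (𝟙 _) :=
  ⟨⟨fun _ => 𝟙 _, fun _ _ => by simp⟩, rfl, rfl⟩

lemma InjRes.IsLift.comp {A B D : M} {I : 𝒳.InjRes A} {J : 𝒳.InjRes B} {K : 𝒳.InjRes D}
    {f : A ⟶ B} {g : B ⟶ D} {s : I.cosyzygy ⟶ J.cosyzygy} {t : J.cosyzygy ⟶ K.cosyzygy}
    (hs : I.IsLift J f s) (ht : J.IsLift K g t) : I.IsLift K (f ≫ g) (s ≫ t) := by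
  obtain ⟨φ, rfl, rfl⟩ := hs
  obtain ⟨ψ, rfl, rfl⟩ := ht
  exact ⟨⟨fun k => φ.app k ≫ ψ.app k, fun k hk => by
    rw [← Category.assoc, φ.comm k hk, Category.assoc, ψ.comm k hk, Category.assoc]⟩, rfl, rfl⟩

/-- A morphism `Sf : SA ⟶ SB` that lifts `f : A ⟶ B`. -/
def liftMap (hn : 0 < n) {A B : M} (I : 𝒳.InjRes A) (J : 𝒳.InjRes B) (f : A ⟶ B) :
    I.cosyzygy ⟶ J.cosyzygy :=
  (I.exists_isLift hn J f).choose

lemma isLift_liftMap (hn : 0 < n) {A B : M} (I : 𝒳.InjRes A) (J : 𝒳.InjRes B) (f : A ⟶ B) :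
    I.IsLift J f (liftMap hn I J f) :=
  (I.exists_isLift hn J f).choose_spec

/-- The functor `A ↦ SA`, `f ↦ [Sf]` from `M` to its stable category. -/
def preSuspension (hn : 0 < n) (I : ∀ A : M, 𝒳.InjRes A) : M ⥤ 𝒳.Stable where
  obj A := 𝒳.Q.obj (I A).cosyzygy
  map {A B} f := 𝒳.Q.map (liftMap hn (I A) (I B) f)
  map_id A := by
    rw [← 𝒳.Q.map_id, Q_map_eq_iff]
    exact (isLift_liftMap hn _ _ _).factorsInj hn (.id _) (by simpa using FactorsInj.zero)
  map_comp f g := by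
    rw [← 𝒳.Q.map_comp, Q_map_eq_iff]
    exact (isLift_liftMap hn _ _ _).factorsInj hn
      ((isLift_liftMap hn _ _ _).comp (isLift_liftMap hn _ _ _)) (by simpa using FactorsInj.zero)

/-- The suspension functor of the stable category, `A ↦ SA`, `[f] ↦ [Sf]`. -/
def suspension (hn : 0 < n) (I : ∀ A : M, 𝒳.InjRes A) : 𝒳.Stable ⥤ 𝒳.Stable :=
  CategoryTheory.Quotient.lift 𝒳.stableRel (preSuspension hn I) fun A B f g hfg => by
    dsimp only [preSuspension]
    rw [Q_map_eq_iff]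
    exact (isLift_liftMap hn _ _ _).factorsInj hn (isLift_liftMap hn _ _ _) hfg

lemma suspension_map (hn : 0 < n) (I : ∀ A : M, 𝒳.InjRes A) {A B : M} (f : A ⟶ B)
    {s : (I A).cosyzygy ⟶ (I B).cosyzygy} (hs : (I A).IsLift (I B) f s) :
    (suspension hn I).map (𝒳.Q.map f) = 𝒳.Q.map s := by
  change 𝒳.Q.map (liftMap hn (I A) (I B) f) = _
  rw [Q_map_eq_iff]
  exact (isLift_liftMap hn _ _ _).factorsInj hn hs (by simpa using FactorsInj.zero)

end NExactStructure

/-! ## `(n+2)`-angulated categories -/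

/-- An `n`-`T`-sequence `X⁰ ⟶ X¹ ⟶ ⋯ ⟶ Xⁿ⁺¹ ⟶ T X⁰`. Only the objects `X⁰, …, Xⁿ⁺¹` and the
morphisms `α⁰, …, αⁿ` of the underlying sequence are relevant. -/
structure SuspSeq (n : ℕ) {F : Type u} [Category.{v} F] (T : F ⥤ F) extends Seq F where
  /-- the morphism `αⁿ⁺¹` -/
  last : obj (n + 1) ⟶ T.obj (obj 0)

namespace SuspSeq

section

variable {n : ℕ} {F : Type u} [Category.{v} F] {T : F ⥤ F}

/-- Morphisms of `n`-`T`-sequences. -/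
structure Hom (X Y : SuspSeq n T) extends SeqHom (n + 1) X.toSeq Y.toSeq where
  comm_last : X.last ≫ T.map (app 0) = app (n + 1) ≫ Y.last

/-- Isomorphic `n`-`T`-sequences. -/
def IsIsomorphic (X Y : SuspSeq n T) : Prop :=
  ∃ φ : Hom X Y, ∀ k, k ≤ n + 1 → IsIso (φ.app k)

/-- The objects of `X⁰ ⟶ X¹ ⟶ ⋯ ⟶ Xⁿ⁺¹ ⟶ Xⁿ⁺²`, where `Xⁿ⁺² = T X⁰`. -/
def extObj (X : SuspSeq n T) (k : ℕ) : F := if k ≤ n + 1 then X.obj k else T.obj (X.obj 0)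

/-- The `k`-th extended object is `Xᵏ` for `k ≤ n + 1`. -/
def extIso (X : SuspSeq n T) (k : ℕ) (hk : k ≤ n + 1) : X.extObj k ≅ X.obj k :=
  eqToIso (if_pos hk)

/-- The extended object of index `n + 2` is `T X⁰`. -/
def extTop (X : SuspSeq n T) (k : ℕ) (hk : ¬ k ≤ n + 1) : X.extObj k ≅ T.obj (X.obj 0) :=
  eqToIso (if_neg hk)

variable [Preadditive F]

/-- The morphisms `α⁰, …, αⁿ⁺¹` of `X⁰ ⟶ X¹ ⟶ ⋯ ⟶ Xⁿ⁺¹ ⟶ Xⁿ⁺²`. -/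
def extMap (X : SuspSeq n T) (k : ℕ) : X.extObj k ⟶ X.extObj (k + 1) :=
  if h : k ≤ n then
    (X.extIso k (by omega)).hom ≫ X.d k ≫ (X.extIso (k + 1) (by omega)).inv
  else if h' : k = n + 1 then
    (X.extIso k (by omega)).hom ≫ eqToHom (congrArg X.obj h') ≫ X.last ≫
      (X.extTop (k + 1) (by omega)).inv
  else 0

/-- The components `φ⁰, …, φⁿ⁺¹` of a morphism together with `φⁿ⁺² = T φ⁰`. -/
def Hom.extApp {X Y : SuspSeq n T} (φ : Hom X Y) (k : ℕ) : X.extObj k ⟶ Y.extObj k :=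
  if h : k ≤ n + 1 then (X.extIso k h).hom ≫ φ.app k ≫ (Y.extIso k h).inv
  else (X.extTop k h).hom ≫ T.map (φ.app 0) ≫ (Y.extTop k h).inv

/-- The left rotation `X¹ ⟶ X² ⟶ ⋯ ⟶ Xⁿ⁺¹ ⟶ T X⁰ ⟶ T X¹`, with last morphism `(-1)ⁿ T α⁰`. -/
def rotate (X : SuspSeq n T) : SuspSeq n T where
  obj k := X.extObj (k + 1)
  d k := X.extMap (k + 1)
  last := (X.extTop (n + 2) (by omega)).hom ≫
    ((-1 : ℤ) ^ n • T.map (X.d 0)) ≫ T.map (X.extIso 1 (by omega)).inv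

variable [HasBinaryBiproducts F]

/-- The direct sum of two `n`-`T`-sequences. -/
def sum (X Y : SuspSeq n T) : SuspSeq n T where
  obj k := X.obj k ⊞ Y.obj k
  d k := biprod.map (X.d k) (Y.d k)
  last := biprod.desc (X.last ≫ T.map biprod.inl) (Y.last ≫ T.map biprod.inr)

/-- The mapping cone `X¹ ⊕ Y⁰ ⟶ X² ⊕ Y¹ ⟶ ⋯ ⟶ T X⁰ ⊕ Yⁿ⁺¹ ⟶ T (X¹ ⊕ Y⁰)`, with morphisms given by
the matrices `[[-α, 0], [φ, β]]`. -/
def cone {X Y : SuspSeq n T} (φ : Hom X Y) : SuspSeq n T where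
  obj k := X.extObj (k + 1) ⊞ Y.extObj k
  d k := Biprod.ofComponents (-(X.extMap (k + 1))) (φ.extApp (k + 1)) 0 (Y.extMap k)
  last := biprod.desc
    ((X.extTop (n + 2) (by omega)).hom ≫
      (-(T.map (X.d 0 ≫ (X.extIso 1 (by omega)).inv ≫ biprod.inl)) +
        T.map (φ.app 0 ≫ (Y.extIso 0 (by omega)).inv ≫ biprod.inr)))
    ((Y.extIso (n + 1) (by omega)).hom ≫ Y.last ≫
      T.map ((Y.extIso 0 (by omega)).inv ≫ biprod.inr))

variable [HasZeroObject F]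

/-- The trivial sequence `A ⟶ A ⟶ 0 ⟶ ⋯ ⟶ 0 ⟶ T A`, whose first morphism is the identity. -/
def trivial (n : ℕ) (T : F ⥤ F) (A : F) : SuspSeq n T where
  obj
    | 0 => A
    | 1 => A
    | _ + 2 => 0
  d
    | 0 => 𝟙 A
    | _ + 1 => 0
  last := 0

end

end SuspSeq

/-- `(F, T, S)` is an `(n+2)`-angulated category, where `T` is an autoequivalence of the additive
category `F` and `S` is a class of `n`-`T`-sequences. -/
structure IsAngulated (n : ℕ) {F : Type u} [Category.{v} F] [Preadditive F] [HasZeroObject F]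
    [HasBinaryBiproducts F] (T : F ⥤ F) (S : SuspSeq n T → Prop) : Prop where
  isEquivalence : T.IsEquivalence
  /-- (F1) closed under direct sums -/
  sum : ∀ X Y, S X → S Y → S (X.sum Y)
  /-- (F1) closed under direct summands -/
  summand : ∀ X Y Z, S Z → SuspSeq.IsIsomorphic Z (X.sum Y) → S X
  /-- (F1) trivial sequences -/
  trivial : ∀ A : F, S (SuspSeq.trivial n T A)
  /-- (F1) every morphism is the first morphism of some angle -/
  exists_angle : ∀ {A B : F} (α : A ⟶ B), ∃ X, S X ∧ Arrow.mk (X.d 0) = Arrow.mk α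
  /-- (F2) -/
  rotate : ∀ X, S X ↔ S X.rotate
  /-- (F3) -/
  extend : ∀ X Y, S X → S Y → ∀ (a : X.obj 0 ⟶ Y.obj 0) (b : X.obj 1 ⟶ Y.obj 1),
    X.d 0 ≫ b = a ≫ Y.d 0 → ∃ φ : SuspSeq.Hom X Y, φ.app 0 = a ∧ φ.app 1 = b
  /-- (F4) -/
  extend_cone : ∀ X Y, S X → S Y → ∀ (a : X.obj 0 ⟶ Y.obj 0) (b : X.obj 1 ⟶ Y.obj 1),
    X.d 0 ≫ b = a ≫ Y.d 0 →
      ∃ φ : SuspSeq.Hom X Y, φ.app 0 = a ∧ φ.app 1 = b ∧ S (SuspSeq.cone φ)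

/-! ## The standard angles of the stable category -/

namespace NExactStructure

variable {n : ℕ} {M : Type u} [Category.{v} M] [Preadditive M] [HasZeroObject M]
  [HasBinaryBiproducts M] {𝒳 : NExactStructure n M}

/-- The data that give rise to a standard angle: a ladder of admissible `n`-exact sequences
```
A ⟶ I¹(A) ⟶ ⋯ ⟶ Iⁿ(A) ⟶ SA
|     |            |     ‖
X¹ ⟶  X²  ⟶ ⋯ ⟶  Xⁿ⁺¹ ⟶ SA
```
where the end of the lower row is identified with `SA` through the isomorphism `e`. -/
structure StandardData (I : ∀ A : M, 𝒳.InjRes A) where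
  /-- the first object `X⁰ = A` -/
  A : M
  /-- the lower row; `E.obj k` is `Xᵏ⁺¹` for `k ≤ n` -/
  E : Seq M
  adm : 𝒳.adm E
  /-- the identification of the end of the lower row -/
  e : E.obj (n + 1) ≅ (I A).cosyzygy
  /-- the ladder -/
  φ : SeqHom (n + 1) (I A).seq E
  φ_last : φ.app (n + 1) ≫ e.hom = 𝟙 _

/-- The standard angle `A ⟶ X¹ ⟶ ⋯ ⟶ Xⁿ⁺¹ ⟶ SA` in the stable category. -/
def StandardData.angle (hn : 0 < n) {I : ∀ A : M, 𝒳.InjRes A} (D : StandardData I) :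
    SuspSeq n (suspension hn I) where
  obj k := 𝒳.Q.obj ((D.E.cons (A := D.A) (D.φ.app 0)).obj k)
  d k := 𝒳.Q.map ((D.E.cons (A := D.A) (D.φ.app 0)).d k)
  last := 𝒳.Q.map (D.E.d n ≫ D.e.hom)

/-- The class of all sequences that are isomorphic to a standard angle. -/
def angles (hn : 0 < n) (I : ∀ A : M, 𝒳.InjRes A) (X : SuspSeq n (suspension hn I)) : Prop :=
  ∃ D : StandardData I, SuspSeq.IsIsomorphic (D.angle hn) X

end NExactStructure

end NExact

end

/-!
Write `Σ` for the suspension of the stable category. A standard angle consists of an object `A`, an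
admissible sequence `E⁰ ⟶ ⋯ ⟶ Eⁿ ⟶ SA` and a ladder `φ` from the resolution `I(A)` to it. The
difficulty is that the definition refers to admissible sequences of `M`, while the axioms speak
about sequences of the stable category up to isomorphism. Three ideas bridge this gap.

*A larger class of sequences.* Let `F⁰ ⟶ ⋯ ⟶ Fⁿ⁺¹` be a sequence in which every morphism is a weak
cokernel of the previous one and the last one is an epimorphism. Suppose that the identity of `F⁰`
extends to a ladder `θ : F ⟶ I(F⁰)`. No weak kernels are required, so that such sequences are easy
to construct. Together with `(-1)ⁿ θⁿ⁺¹` as last morphism, `F` gives a sequence in the stable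
category (`angleOf`). It is exact in the sense that each morphism, up to `Σ F⁰ ⟶ Σ F¹`, is a weak
cokernel of the previous one (`exact_angleOf`). This is seen by comparing `F` with a projective
resolution of the object to which one maps. Since the rotation of a standard angle is given by its
lower row (`isIsomorphic_angleOf_rotate`), and `Σ` is an equivalence (`isEquivalence_suspension`),
standard angles are exact, too (`exact_angle`).

*Truncated mapping cones.* The last component of `φ` is an isomorphism, hence the last two terms of
the mapping cone of `φ` can be cut off. The remaining sequence
`A ⟶ I¹ ⊕ E⁰ ⟶ ⋯ ⟶ Iⁿ ⊕ Eⁿ⁻¹ ⟶ Eⁿ` has the cokernel property (`StandardData.exists_truncCone`), and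
the standard angle is given by it (`StandardData.exists_isIsomorphic_angleOf`). A square that
commutes only in the stable category is a commutative square of `M` on this sequence, because its
failure to commute is absorbed by the summand `I¹`. The cokernel property then extends the square
to a ladder. This shows that commutative squares between angles extend to morphisms
(`exists_hom_of_angles`).

*Recognition.* An exact sequence `X` is an angle as soon as some standard angle maps to it with
isomorphisms as first two components (`angles_of_hom`). The lower row `E` of this standard angle has
to be replaced by an admissible sequence whose image is isomorphic to the rotation of `X`, and this
is done one term after the other (`Surgery`, `exists_replacement`). Exactness of both rows shows
that, in the stable category, the component on `Eᵏ` is split by a retraction, up to a morphism that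
factors through `Eᵏ ⟶ Eᵏ⁺¹`. Choose an object `Y` of `M` that represents the target of this
component, enlarged by an injective object if necessary. Then `Eᵏ` is a direct summand of
`Eᵏ⁺¹ ⊕ Y`; it is replaced by `Y`, and `Eᵏ⁺¹` by a complement of `Eᵏ` in `Eᵏ⁺¹ ⊕ Y`. The sequence
stays admissible because its two ends do not change. The complement is the only use of split
idempotents, and for `n = 1` no term has to be replaced. The last component is an isomorphism by the
five lemma.

Together, an exact sequence to which commutative squares on standard angles extend is an angle
(`angles_of_exact`). Exactness and this extension property pass to sums and to summands, and they
pass from the rotation of a sequence to the sequence itself, since morphisms of angles can also be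
extended from their last square (`exists_hom_of_last`). All sequences `angleOf` are angles
(`angles_angleOf`). For the mapping cone of a morphism it suffices to treat a standard angle with
lower row `E` mapping to a sequence `angleOf` of `G` by a ladder on the truncated mapping cone. The
components `ψᵏ : Eᵏ ⟶ Gᵏ⁺¹` of this ladder define a sequence on `E ⊕ G` with the matrices
`[[-d, ψ], [0, d]]` as morphisms. It inherits the cokernel property from `E` and `G`, and it gives
the mapping cone (`StandardData.exists_hom_cone`).
-/

noncomputable section

namespace NExact

/-! ### Ladders and homotopies -/

/-- Families with prescribed members up to the index `N`, the last one being given separately: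
only the first `N + 1` terms of a sequence matter, and the term of index `N` often has a different
shape. -/
lemma exists_family {O : ℕ → Type v} [∀ k, Inhabited (O k)] (N : ℕ) (a : ∀ k, k < N → O k)
    (b : O N) : ∃ f : ∀ k, O k, (∀ k (hk : k < N), f k = a k hk) ∧ f N = b :=
  ⟨fun k => if h : k < N then a k h else if h' : k = N then h' ▸ b else default,
    fun _ hk => dif_pos hk, (dif_neg (lt_irrefl N)).trans (dif_pos rfl)⟩

instance {C : Type u} [Category.{v} C] [Preadditive C] (A B : C) : Inhabited (A ⟶ B) := ⟨0⟩

section Ladders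

variable {C : Type u} [Category.{v} C] [Preadditive C]

/-- The first `n` consecutive compositions in a sequence vanish. -/
def Seq.IsComplex (n : ℕ) (X : Seq C) : Prop := ∀ k, k < n → X.d k ≫ X.d (k + 1) = 0

/-- Consecutive morphisms of `X⁰ ⟶ ⋯ ⟶ Xⁿ⁺¹` are weak cokernels of each other. -/
def Seq.WeakCokernels (n : ℕ) (X : Seq C) : Prop :=
  ∀ k, k < n → IsWeakCokernel (X.d k) (X.d (k + 1))

/-- Consecutive morphisms of `X⁰ ⟶ ⋯ ⟶ Xⁿ⁺¹` are weak kernels of each other. -/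
def Seq.WeakKernels (n : ℕ) (X : Seq C) : Prop :=
  ∀ k, k < n → IsWeakKernel (X.d k) (X.d (k + 1))

lemma Seq.WeakCokernels.isComplex {n : ℕ} {X : Seq C} (h : X.WeakCokernels n) : X.IsComplex n :=
  fun k hk => (h k hk).1

lemma Seq.WeakKernels.isComplex {n : ℕ} {X : Seq C} (h : X.WeakKernels n) : X.IsComplex n :=
  fun k hk => (h k hk).1

lemma IsNExactSeq.isComplex {n : ℕ} {X : Seq C} (h : IsNExactSeq n X) : X.IsComplex n :=
  fun k hk => h.comp_zero k hk

/-- A commutative first square extends to a ladder. -/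
lemma exists_ladder_of_first {n : ℕ} {X Y : Seq C} (hX : X.WeakCokernels n) (hY : Y.IsComplex n)
    (a : X.obj 0 ⟶ Y.obj 0) (b : X.obj 1 ⟶ Y.obj 1) (hab : X.d 0 ≫ b = a ≫ Y.d 0) :
    ∃ φ : SeqHom (n + 1) X Y, φ.app 0 = a ∧ φ.app 1 = b := by
  let T : ℕ → Type v := fun k =>
    {p : (X.obj k ⟶ Y.obj k) × (X.obj (k + 1) ⟶ Y.obj (k + 1)) //
      k < n + 1 → X.d k ≫ p.2 = p.1 ≫ Y.d k}
  have step : ∀ (k : ℕ) (p : T k), ∃ q : T (k + 1), q.1.1 = p.1.2 := by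
    rintro k ⟨⟨p, q⟩, h⟩
    by_cases hk : k < n
    · obtain ⟨r, hr⟩ := (hX k hk).2 _ (q ≫ Y.d (k + 1)) (by
        have := h (by omega)
        dsimp at this
        rw [← Category.assoc, this, Category.assoc, hY k hk, comp_zero])
      exact ⟨⟨(q, r), fun _ => hr⟩, rfl⟩
    · exact ⟨⟨(q, 0), fun hk' => absurd hk' (by omega)⟩, rfl⟩
  choose next hnext using step
  let t : ∀ k, T k := fun k => Nat.rec ⟨(a, b), fun _ => hab⟩ (fun k p => next k p) k
  refine ⟨⟨fun k => (t k).1.1, fun k hk => ?_⟩, rfl, hnext 0 (t 0)⟩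
  have h1 : (t (k + 1)).1.1 = (t k).1.2 := hnext k (t k)
  rw [h1]
  exact (t k).2 hk

/-- A commutative last square extends to a ladder. -/
lemma exists_ladder_of_last {n : ℕ} {X Y : Seq C} (hX : X.IsComplex n) (hY : Y.WeakKernels n)
    (a : X.obj n ⟶ Y.obj n) (b : X.obj (n + 1) ⟶ Y.obj (n + 1))
    (hab : X.d n ≫ b = a ≫ Y.d n) :
    ∃ φ : SeqHom (n + 1) X Y, φ.app n = a ∧ φ.app (n + 1) = b := by
  have key : ∀ j k, k + j = n → ∃ f : ∀ i, X.obj i ⟶ Y.obj i,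
      (∀ i, k ≤ i → i < n + 1 → X.d i ≫ f (i + 1) = f i ≫ Y.d i) ∧ f n = a ∧ f (n + 1) = b := by
    intro j
    induction j with
    | zero =>
      intro k hk
      obtain rfl : k = n := by omega
      refine ⟨Function.update (Function.update (fun _ => 0) k a) (k + 1) b, ?_, ?_, ?_⟩
      · intro i hi hi'
        obtain rfl : i = k := by omega
        rw [Function.update_self, Function.update_of_ne (by omega), Function.update_self]
        exact hab
      · rw [Function.update_of_ne (by omega), Function.update_self]
      · rw [Function.update_self]
    | succ j ih =>
      intro k hk
      obtain ⟨f, hf, h1, h2⟩ := ih (k + 1) (by omega)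
      obtain ⟨p, hp⟩ := (hY k (by omega)).2 _ (X.d k ≫ f (k + 1)) (by
        rw [Category.assoc, ← hf (k + 1) le_rfl (by omega), ← Category.assoc, hX k (by omega),
          zero_comp])
      refine ⟨Function.update f k p, ?_, ?_, ?_⟩
      · intro i hi hi'
        rcases hi.eq_or_lt with rfl | hlt
        · rw [Function.update_self, Function.update_of_ne (by omega), hp]
        · rw [Function.update_of_ne (by omega), Function.update_of_ne (by omega)]
          exact hf i hlt hi'
      · rw [Function.update_of_ne (by omega), h1]
      · rw [Function.update_of_ne (by omega), h2]
  obtain ⟨f, hf, h1, h2⟩ := key n 0 (by omega)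
  exact ⟨⟨f, fun k hk => hf k (by omega) hk⟩, h1, h2⟩

/-- A ladder whose first component factors through the first morphism of the upper row is
null-homotopic. -/
lemma exists_homotopy {n : ℕ} {X Y : Seq C} (hX : IsNCokernel n X) (hY : Y.IsComplex n)
    (φ : SeqHom (n + 1) X Y) (w : X.obj 1 ⟶ Y.obj 0) (hw : X.d 0 ≫ w = φ.app 0) :
    ∃ h : ∀ k, X.obj (k + 1) ⟶ Y.obj k, h 0 = w ∧
      (∀ k, k < n → φ.app (k + 1) = h k ≫ Y.d k + X.d (k + 1) ≫ h (k + 1)) ∧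
      φ.app (n + 1) = h n ≫ Y.d n := by
  let T : ℕ → Type v := fun k =>
    {h : X.obj (k + 1) ⟶ Y.obj k // k ≤ n → X.d k ≫ φ.app (k + 1) = X.d k ≫ h ≫ Y.d k}
  have step : ∀ (k : ℕ) (p : T k), ∃ q : T (k + 1), k < n →
      φ.app (k + 1) = p.1 ≫ Y.d k + X.d (k + 1) ≫ q.1 := by
    rintro k ⟨h, hh⟩
    by_cases hk : k < n
    · obtain ⟨r, hr⟩ := (hX.1 k hk).2 _ (φ.app (k + 1) - h ≫ Y.d k) (by
        rw [Preadditive.comp_sub, hh hk.le, sub_self])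
      refine ⟨⟨r, fun hk' => ?_⟩, fun _ => ?_⟩
      · rw [φ.comm (k + 1) (by omega), ← Category.assoc, hr, Preadditive.sub_comp, Category.assoc,
          hY k hk, comp_zero, sub_zero]
      · rw [hr]
        abel
    · exact ⟨⟨0, fun hk' => absurd hk' (by omega)⟩, fun h => absurd h hk⟩
  choose next hnext using step
  let t : ∀ k, T k := fun k => Nat.rec ⟨w, fun _ => by
    rw [φ.comm 0 (by omega), ← hw, Category.assoc]⟩ (fun k p => next k p) k
  refine ⟨fun k => (t k).1, rfl, fun k hk => hnext k (t k) hk, ?_⟩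
  have := hX.2
  rw [← cancel_epi (X.d n)]
  exact (t n).2 le_rfl

/-- If the last component of a ladder factors through the last morphism of the lower row, then
its first component factors through the first morphism of the upper row. -/
lemma exists_first_factor {n : ℕ} {X Y : Seq C} (hX : X.IsComplex n) (hY : IsNKernel n Y)
    (φ : SeqHom (n + 1) X Y) (h : X.obj (n + 1) ⟶ Y.obj n) (hh : h ≫ Y.d n = φ.app (n + 1)) :
    ∃ w : X.obj 1 ⟶ Y.obj 0, X.d 0 ≫ w = φ.app 0 := by
  have key : ∀ j k, k + j = n → ∃ h : X.obj (k + 1) ⟶ Y.obj k,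
      φ.app k ≫ Y.d k = (X.d k ≫ h) ≫ Y.d k := by
    intro j
    induction j with
    | zero =>
      rintro k rfl
      exact ⟨h, by rw [Category.assoc, ← φ.comm k (by omega)]; exact congrArg _ hh.symm⟩
    | succ j ih =>
      intro k hk
      obtain ⟨g, hg⟩ := ih (k + 1) (by omega)
      obtain ⟨p, hp⟩ := (hY.1 k (by omega)).2 _ (φ.app (k + 1) - X.d (k + 1) ≫ g) (by
        rw [Preadditive.sub_comp, hg, sub_self])
      refine ⟨p, ?_⟩
      rw [Category.assoc, hp, Preadditive.comp_sub, ← φ.comm k (by omega), ← Category.assoc,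
        hX k (by omega), zero_comp, sub_zero]
  obtain ⟨w, hw⟩ := key n 0 (by omega)
  have := hY.2
  exact ⟨w, ((cancel_mono (Y.d 0)).1 hw).symm⟩

/-- The composition of two ladders. -/
def SeqHom.comp {N : ℕ} {X Y Z : Seq C} (f : SeqHom N X Y) (g : SeqHom N Y Z) :
    SeqHom N X Z where
  app k := f.app k ≫ g.app k
  comm k hk := by
    rw [← Category.assoc, f.comm k hk, Category.assoc, g.comm k hk, Category.assoc]

/-- The difference of two ladders. -/
def SeqHom.sub {N : ℕ} {X Y : Seq C} (f g : SeqHom N X Y) : SeqHom N X Y where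
  app k := f.app k - g.app k
  comm k hk := by rw [Preadditive.comp_sub, Preadditive.sub_comp, f.comm k hk, g.comm k hk]

/-- Two ladders with the same first component have last components that differ by a morphism
which factors through the last morphism of the lower row. -/
lemma exists_last_sub {n : ℕ} {X Y : Seq C} (hX : IsNCokernel n X) (hY : Y.IsComplex n)
    (φ ψ : SeqHom (n + 1) X Y) (h0 : φ.app 0 = ψ.app 0) :
    ∃ h : X.obj (n + 1) ⟶ Y.obj n, h ≫ Y.d n = φ.app (n + 1) - ψ.app (n + 1) := by
  obtain ⟨h, -, -, hh⟩ := exists_homotopy hX hY (φ.sub ψ) 0 (by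
    change _ = φ.app 0 - ψ.app 0
    rw [h0, sub_self, comp_zero])
  exact ⟨h n, hh.symm⟩

/-- A sequence with the `n`-cokernel property that starts like an `n`-exact sequence is itself
`n`-exact: the two are homotopy equivalent. -/
lemma IsNCokernel.isNExactSeq {n : ℕ} {Z X : Seq C} (hX : IsNCokernel n X) (hZ : IsNExactSeq n Z)
    (u : SeqHom (n + 1) Z X) (v : SeqHom (n + 1) X Z) (h : v.app 0 ≫ u.app 0 = 𝟙 _) :
    IsNExactSeq n X := by
  have hXc : X.IsComplex n := Seq.WeakCokernels.isComplex hX.1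
  obtain ⟨s, hs0, hs, -⟩ := exists_homotopy hX hXc
    ((v.comp u).sub ⟨fun _ => 𝟙 _, fun _ _ => by simp⟩) 0 (by
      change _ = v.app 0 ≫ u.app 0 - 𝟙 _
      rw [h, sub_self, comp_zero])
  refine ⟨⟨fun k hk => ⟨hXc k hk, fun W w hw => ?_⟩, ⟨fun {W} a b hab => ?_⟩⟩, hX⟩
  · obtain ⟨z, hz⟩ := (hZ.1.1 k hk).2 _ (w ≫ v.app (k + 1)) (by
      rw [Category.assoc, ← v.comm (k + 1) (by omega), ← Category.assoc, hw, zero_comp])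
    have e : v.app (k + 1) ≫ u.app (k + 1) - 𝟙 _ = s k ≫ X.d k + X.d (k + 1) ≫ s (k + 1) := hs k hk
    refine ⟨z ≫ u.app k - w ≫ s k, ?_⟩
    have e2 : w ≫ (v.app (k + 1) ≫ u.app (k + 1) - 𝟙 _) = w ≫ s k ≫ X.d k := by
      rw [e, Preadditive.comp_add, ← Category.assoc w (X.d (k + 1)), hw, zero_comp, add_zero]
    rw [Preadditive.comp_sub, Category.comp_id, ← Category.assoc, ← hz, Category.assoc,
      u.comm k (by omega)] at e2
    rw [Preadditive.sub_comp, Category.assoc, Category.assoc, ← e2]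
    abel
  · have := hZ.1.2
    have e : a ≫ v.app 0 = b ≫ v.app 0 := by
      rw [← cancel_mono (Z.d 0), Category.assoc, Category.assoc, ← v.comm 0 (by omega),
        ← Category.assoc, hab, Category.assoc]
    rw [← Category.comp_id a, ← Category.comp_id b, ← h, ← Category.assoc, e, Category.assoc]

lemma IsWeakCokernel.of_iso {A B D A' B' D' : C} {f : A ⟶ B} {g : B ⟶ D} {f' : A' ⟶ B'}
    {g' : B' ⟶ D'} (h : IsWeakCokernel f g) (a : A ≅ A') (b : B ≅ B') (d : D ≅ D')
    (h1 : f ≫ b.hom = a.hom ≫ f') (h2 : g ≫ d.hom = b.hom ≫ g') : IsWeakCokernel f' g' := by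
  refine ⟨?_, fun W x hx => ?_⟩
  · rw [← cancel_epi a.hom, ← Category.assoc, ← h1, Category.assoc, ← h2, ← Category.assoc, h.1,
      zero_comp, comp_zero]
  · obtain ⟨p, hp⟩ := h.2 W (b.hom ≫ x) (by
      rw [← Category.assoc, h1, Category.assoc, hx, comp_zero])
    refine ⟨d.inv ≫ p, ?_⟩
    rw [← cancel_epi b.hom, ← hp, ← Category.assoc, ← h2, Category.assoc, d.hom_inv_id_assoc]

end Ladders

/-! ### Weak cokernels up to sign -/

section Signs

variable {C : Type u} [Category.{v} C] [Preadditive C] {A B D : C} {f : A ⟶ B} {g : B ⟶ D}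

lemma IsWeakCokernel.zsmul_right (h : IsWeakCokernel f g) {ε : ℤ} (hε : ε * ε = 1) :
    IsWeakCokernel f (ε • g) := by
  refine ⟨by rw [Preadditive.comp_zsmul, h.1, smul_zero], fun W x hx => ?_⟩
  obtain ⟨p, rfl⟩ := h.2 W x hx
  exact ⟨ε • p, by rw [Preadditive.comp_zsmul, Preadditive.zsmul_comp, smul_smul, hε, one_smul]⟩

lemma IsWeakCokernel.zsmul_left (h : IsWeakCokernel f g) {ε : ℤ} (hε : ε * ε = 1) :
    IsWeakCokernel (ε • f) g := by
  refine ⟨by rw [Preadditive.zsmul_comp, h.1, smul_zero], fun W x hx => h.2 W x ?_⟩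
  rw [← one_smul ℤ (f ≫ x), ← hε, mul_smul, ← Preadditive.zsmul_comp, hx, smul_zero]

lemma neg_one_pow_mul_self (n : ℕ) : (-1 : ℤ) ^ n * (-1) ^ n = 1 := by
  rw [← mul_pow]
  simp

end Signs

/-! ### Exactness in the stable category and the suspension functor -/

/-- All consecutive morphisms of `X⁰ ⟶ ⋯ ⟶ Xⁿ⁺¹ ⟶ T X⁰ ⟶ T X¹` are weak cokernels of each other:
the functors `Hom(-, W)` turn this sequence into exact ones. -/
def SuspSeq.Exact {n : ℕ} {F : Type u} [Category.{v} F] [Preadditive F] {T : F ⥤ F}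
    (X : SuspSeq n T) : Prop :=
  X.toSeq.WeakCokernels n ∧ IsWeakCokernel (X.d n) X.last ∧ IsWeakCokernel X.last (T.map (X.d 0))

/-- A morphism `Fᵏ⁺¹ ⟶ R` which after composition with `Fᵏ ⟶ Fᵏ⁺¹` lifts along the sequence `R`
is the sum of a morphism that lifts along `R` and a morphism that extends to `Fᵏ⁺²`. The induction
descends to `k = 0`, where every morphism into `Rʲ` extends along `F⁰ ⟶ F¹`. -/
lemma exists_lift_add_extension {C : Type u} [Category.{v} C] [Preadditive C] {n : ℕ}
    {F R : Seq C} (hF : F.WeakCokernels n) (hR : R.WeakKernels n)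
    (j : ℕ) (hj : ∀ a : F.obj 0 ⟶ R.obj j, ∃ u : F.obj 1 ⟶ R.obj j, F.d 0 ≫ u = a) :
    ∀ k, k < n → j + k ≤ n → ∀ (h : F.obj (k + 1) ⟶ R.obj (j + k + 1))
      (a : F.obj k ⟶ R.obj (j + k)), F.d k ≫ h = a ≫ R.d (j + k) →
      ∃ (x : F.obj (k + 1) ⟶ R.obj (j + k)) (y : F.obj (k + 2) ⟶ R.obj (j + k + 1)),
        h = x ≫ R.d (j + k) + F.d (k + 1) ≫ y := by
  intro k
  induction k with
  | zero =>
    intro hk hjk h a ha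
    obtain ⟨x, hx⟩ := hj a
    obtain ⟨y, hy⟩ := (hF 0 hk).2 _ (h - x ≫ R.d j) (by
      rw [Preadditive.comp_sub, ha, ← hx, Category.assoc]
      exact sub_self _)
    refine ⟨x, y, ?_⟩
    rw [hy]
    exact (add_sub_cancel _ _).symm
  | succ k ih =>
    intro hk hjk h a ha
    obtain ⟨a', ha'⟩ := (hR (j + k) (by omega)).2 _ (F.d k ≫ a) (by
      rw [Category.assoc]
      erw [← ha]
      rw [← Category.assoc, (hF k (by omega)).1, zero_comp])
    obtain ⟨x, y, hxy⟩ := ih (by omega) (by omega) a a' ha'.symm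
    obtain ⟨z, hz⟩ := (hF (k + 1) hk).2 _ (h - y ≫ R.d (j + k + 1)) (by
      rw [Preadditive.comp_sub, ha, hxy, Preadditive.add_comp, Category.assoc,
        Category.assoc, sub_eq_zero]
      erw [(hR (j + k) (by omega)).1]
      rw [comp_zero, zero_add]
      rfl)
    refine ⟨y, z, ?_⟩
    rw [hz]
    exact (add_sub_cancel _ _).symm

namespace NExactStructure

section

variable {n : ℕ} {M : Type u} [Category.{v} M] [Preadditive M] [HasZeroObject M]
  [HasBinaryBiproducts M] {𝒳 : NExactStructure n M}

lemma FactorsInj.comp_of_inj {A B J : M} (hJ : 𝒳.Inj J) (a : A ⟶ J) (b : J ⟶ B) :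
    𝒳.FactorsInj (a ≫ b) := ⟨J, hJ, a, b, rfl⟩

lemma Q_map_eq_zero_iff {A B : M} (f : A ⟶ B) : 𝒳.Q.map f = 0 ↔ 𝒳.FactorsInj f := by
  rw [← 𝒳.Q.map_zero, Q_map_eq_iff, sub_zero]

lemma exists_Q_map {A B : M} (f : 𝒳.Q.obj A ⟶ 𝒳.Q.obj B) : ∃ g : A ⟶ B, 𝒳.Q.map g = f :=
  𝒳.Q.map_surjective f

lemma FactorsInj.exists_lift (h𝒳 : 𝒳.IsFrobenius) {R : Seq M} (hR : 𝒳.adm R) {V : M}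
    {x : V ⟶ R.obj (n + 1)} (hx : 𝒳.FactorsInj x) : ∃ y : V ⟶ R.obj n, y ≫ R.d n = x := by
  obtain ⟨J, hJ, a, b, rfl⟩ := hx
  obtain ⟨c, hc⟩ := (h𝒳.inj_iff_proj J).1 hJ (R.d n) ⟨R, hR, rfl⟩ b
  exact ⟨a ≫ c, by rw [Category.assoc, hc]⟩

lemma InjRes.inj_seq {A : M} (I : 𝒳.InjRes A) (k : ℕ) (hk : 1 ≤ k) (hk' : k ≤ n) :
    𝒳.Inj (I.seq.obj k) := by
  obtain ⟨m, rfl⟩ : ∃ m, k = m + 1 := ⟨k - 1, by omega⟩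
  exact I.inj m (by omega)

lemma exists_proj_resolution (h𝒳 : 𝒳.IsFrobenius) (W : M) :
    ∃ R : Seq M, 𝒳.adm R ∧ R.obj (n + 1) = W ∧ ∀ k, 1 ≤ k → k ≤ n → 𝒳.Inj (R.obj k) := by
  obtain ⟨R, hR, hW, h⟩ := h𝒳.enoughProj W
  exact ⟨R, hR, hW, fun k h1 h2 => (h𝒳.inj_iff_proj _).2 (h k h1 h2)⟩

/-- Every morphism out of `A` extends to a ladder from a resolution of `A` to an admissible
sequence whose second term is injective. -/
lemma InjRes.exists_ladder_of_first {A : M} (I : 𝒳.InjRes A) {R : Seq M}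
    (hR : 𝒳.adm R) (hR1 : 𝒳.Inj (R.obj 1)) (a : A ⟶ R.obj 0) :
    ∃ τ : SeqHom (n + 1) I.seq R, τ.app 0 = a := by
  obtain ⟨b, hb⟩ := hR1 I.ι I.admMono (a ≫ R.d 0)
  obtain ⟨τ, h, -⟩ := exists_seqHom I.isNExactSeq (𝒳.isNExactSeq _ hR) a b hb
  exact ⟨τ, h⟩

/-- Every morphism out of `SA` extends backwards to a ladder from the resolution of `A` to an
admissible sequence. -/
lemma InjRes.exists_ladder_of_last (hn : 0 < n) (h𝒳 : 𝒳.IsFrobenius) {A : M} (I : 𝒳.InjRes A)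
    {R : Seq M} (hR : 𝒳.adm R) (s : I.cosyzygy ⟶ R.obj (n + 1)) :
    ∃ τ : SeqHom (n + 1) I.seq R, τ.app (n + 1) = s := by
  obtain ⟨y, hy⟩ := FactorsInj.exists_lift h𝒳 hR
    (FactorsInj.comp_of_inj (I.inj_seq n hn le_rfl) (𝟙 _) (I.seq.d n ≫ s))
  obtain ⟨τ, -, h⟩ := NExact.exists_ladder_of_last (X := I.seq) (Y := R) (n := n)
    (fun k hk => I.isNExactSeq.comp_zero k hk)
    (𝒳.isNExactSeq _ hR).1.1 y s (by rw [hy, Category.id_comp])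
  exact ⟨τ, h⟩

/-- The sequence in the stable category given by `F⁰ ⟶ ⋯ ⟶ Fⁿ⁺¹` and a morphism
`δ : Fⁿ⁺¹ ⟶ SF⁰`, with last morphism `(-1)ⁿ δ`. -/
def angleOf (hn : 0 < n) (I : ∀ A : M, 𝒳.InjRes A) (F : Seq M)
    (δ : F.obj (n + 1) ⟶ (I (F.obj 0)).cosyzygy) : SuspSeq n (suspension hn I) where
  obj k := 𝒳.Q.obj (F.obj k)
  d k := 𝒳.Q.map (F.d k)
  last := (-1 : ℤ) ^ n • 𝒳.Q.map δ

/-- Morphisms into injective objects extend along the first morphism of a sequence that maps to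
an injective resolution of its first term. -/
lemma exists_extension_of_ladder {I : ∀ A : M, 𝒳.InjRes A} {F : Seq M}
    (θ : SeqHom (n + 1) F (I (F.obj 0)).seq) (hθ : θ.app 0 = 𝟙 (F.obj 0)) {J : M} (hJ : 𝒳.Inj J)
    (a : F.obj 0 ⟶ J) : ∃ x : F.obj 1 ⟶ J, F.d 0 ≫ x = a := by
  obtain ⟨x, hx⟩ : ∃ x : (I (F.obj 0)).seq.obj 1 ⟶ J, (I (F.obj 0)).seq.d 0 ≫ x = a :=
    hJ _ (I (F.obj 0)).admMono a
  refine ⟨θ.app 1 ≫ x, ?_⟩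
  rw [← Category.assoc, θ.comm 0 (by omega), Category.assoc, hx, hθ]
  exact Category.id_comp a

/-- The functors `Hom(-, W)` of the stable category turn the sequence
`F⁰ ⟶ ⋯ ⟶ Fⁿ⁺¹ ⟶ SF⁰ ⟶ SF¹` into exact ones. The proof compares `F` with a projective resolution
of `W`. -/
theorem exact_angleOf (hn : 0 < n) (h𝒳 : 𝒳.IsFrobenius) (I : ∀ A : M, 𝒳.InjRes A) {F : Seq M}
    (hF : IsNCokernel n F) (θ : SeqHom (n + 1) F (I (F.obj 0)).seq)
    (hθ : θ.app 0 = 𝟙 (F.obj 0)) : (angleOf hn I F (θ.app (n + 1))).Exact := by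
  have hIc : ∀ A : M, (I A).seq.IsComplex n := fun A k hk => (I A).isNExactSeq.comp_zero k hk
  have hFc : F.IsComplex n := Seq.WeakCokernels.isComplex hF.1
  obtain ⟨s, hs⟩ : ∃ s : SeqHom (n + 1) (I (F.obj 0)).seq (I (F.obj 1)).seq, s.app 0 = F.d 0 :=
    (I (F.obj 0)).exists_ladder_of_first (I (F.obj 1)).adm ((I (F.obj 1)).inj_seq 1 le_rfl hn)
      (F.d 0)
  have hsusp : (suspension hn I).map (𝒳.Q.map (F.d 0)) = 𝒳.Q.map (s.app (n + 1)) :=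
    suspension_map hn I _ ⟨s, hs, rfl⟩
  refine ⟨fun k hk => ⟨?_, fun W h hh => ?_⟩, IsWeakCokernel.zsmul_right ⟨?_, fun W h hh => ?_⟩
    (neg_one_pow_mul_self n),
    IsWeakCokernel.zsmul_left (f := 𝒳.Q.map (θ.app (n + 1))) ⟨?_, fun W h hh => ?_⟩
    (neg_one_pow_mul_self n)⟩
  · change 𝒳.Q.map (F.d k) ≫ 𝒳.Q.map (F.d (k + 1)) = 0
    rw [← 𝒳.Q.map_comp, hFc k hk, 𝒳.Q.map_zero]
  · obtain ⟨W⟩ := W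
    obtain ⟨R, hR, rfl, hRi⟩ := exists_proj_resolution h𝒳 W
    obtain ⟨h, rfl⟩ := exists_Q_map (A := F.obj (k + 1)) (B := R.obj (n + 1)) h
    obtain ⟨j, rfl⟩ : ∃ j, n = j + k := ⟨n - k, by omega⟩
    change 𝒳.Q.map (F.d k) ≫ 𝒳.Q.map h = 0 at hh
    rw [← 𝒳.Q.map_comp, Q_map_eq_zero_iff] at hh
    obtain ⟨a, ha⟩ := hh.exists_lift h𝒳 hR
    obtain ⟨x, y, hxy⟩ := exists_lift_add_extension hF.1 (𝒳.isNExactSeq _ hR).1.1 j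
      (exists_extension_of_ladder θ hθ (hRi j (by omega) (by omega))) k hk le_rfl h a ha.symm
    refine ⟨𝒳.Q.map y, ?_⟩
    change 𝒳.Q.map (F.d (k + 1)) ≫ 𝒳.Q.map y = 𝒳.Q.map h
    rw [← 𝒳.Q.map_comp, Q_map_eq_iff, hxy, ← neg_sub, add_sub_cancel_right]
    exact (FactorsInj.comp_of_inj (hRi _ (by omega) le_rfl) _ _).neg
  · change 𝒳.Q.map (F.d n) ≫ 𝒳.Q.map (θ.app (n + 1)) = 0
    rw [← 𝒳.Q.map_comp, Q_map_eq_zero_iff, θ.comm n (by omega)]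
    exact FactorsInj.comp_of_inj ((I _).inj_seq n hn le_rfl) _ _
  · obtain ⟨W⟩ := W
    obtain ⟨R, hR, rfl, hRi⟩ := exists_proj_resolution h𝒳 W
    obtain ⟨h, rfl⟩ := exists_Q_map (A := F.obj (n + 1)) (B := R.obj (n + 1)) h
    change 𝒳.Q.map (F.d n) ≫ 𝒳.Q.map h = 0 at hh
    rw [← 𝒳.Q.map_comp, Q_map_eq_zero_iff] at hh
    obtain ⟨a, ha⟩ := hh.exists_lift h𝒳 hR
    obtain ⟨ρ, -, rfl⟩ := exists_ladder_of_last hFc (𝒳.isNExactSeq _ hR).1.1 a h ha.symm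
    obtain ⟨σ, hσ⟩ := (I (F.obj 0)).exists_ladder_of_first hR (hRi 1 le_rfl hn) (ρ.app 0)
    obtain ⟨g, hg⟩ := exists_last_sub hF (𝒳.isNExactSeq _ hR).isComplex (θ.comp σ) ρ (by
      change θ.app 0 ≫ σ.app 0 = _
      rw [hθ, hσ]
      exact Category.id_comp _)
    refine ⟨𝒳.Q.map (σ.app (n + 1)), ?_⟩
    change 𝒳.Q.map (θ.app (n + 1)) ≫ 𝒳.Q.map (σ.app (n + 1)) = 𝒳.Q.map (ρ.app (n + 1))
    rw [← 𝒳.Q.map_comp, Q_map_eq_iff]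
    exact hg ▸ FactorsInj.comp_of_inj (hRi n hn le_rfl) g (R.d n)
  · change 𝒳.Q.map (θ.app (n + 1)) ≫ (suspension hn I).map (𝒳.Q.map (F.d 0)) = 0
    rw [hsusp]
    obtain ⟨h, -, -, hh⟩ := exists_homotopy hF (hIc (F.obj 1)) (θ.comp s) (𝟙 (F.obj 1)) (by
      change _ = θ.app 0 ≫ s.app 0
      rw [hθ, hs]
      exact (Category.comp_id _).trans (Category.id_comp _).symm)
    refine (𝒳.Q.map_comp _ _).symm.trans ((Q_map_eq_zero_iff _).2 ?_)
    exact (show θ.app (n + 1) ≫ s.app (n + 1) = _ from hh) ▸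
      FactorsInj.comp_of_inj ((I _).inj_seq n hn le_rfl) (h n) _
  · obtain ⟨W⟩ := W
    obtain ⟨R, hR, rfl, hRi⟩ := exists_proj_resolution h𝒳 W
    obtain ⟨h, rfl⟩ := exists_Q_map (A := (I (F.obj 0)).cosyzygy) (B := R.obj (n + 1)) h
    change 𝒳.Q.map (θ.app (n + 1)) ≫ 𝒳.Q.map h = 0 at hh
    obtain ⟨τ, rfl⟩ := (I (F.obj 0)).exists_ladder_of_last hn h𝒳 hR h
    replace hh : 𝒳.Q.map (θ.app (n + 1) ≫ τ.app (n + 1)) = 0 := (𝒳.Q.map_comp _ _).trans hh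
    rw [Q_map_eq_zero_iff] at hh
    obtain ⟨g, hg⟩ := hh.exists_lift h𝒳 hR
    obtain ⟨w, hw⟩ := exists_first_factor hFc (𝒳.isNExactSeq _ hR).1 (θ.comp τ) g hg
    obtain ⟨ω, hω⟩ := (I (F.obj 1)).exists_ladder_of_first hR (hRi 1 le_rfl hn) w
    obtain ⟨g', hg'⟩ := exists_last_sub (I (F.obj 0)).isNExactSeq.2
      (𝒳.isNExactSeq _ hR).isComplex (s.comp ω) τ (by
        change s.app 0 ≫ ω.app 0 = _
        rw [hs, hω]
        refine hw.trans ?_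
        change θ.app 0 ≫ τ.app 0 = _
        rw [hθ]
        exact Category.id_comp _)
    refine ⟨𝒳.Q.map (ω.app (n + 1)), ?_⟩
    change (suspension hn I).map (𝒳.Q.map (F.d 0)) ≫ 𝒳.Q.map (ω.app (n + 1)) =
      𝒳.Q.map (τ.app (n + 1))
    rw [hsusp]
    refine (𝒳.Q.map_comp _ _).symm.trans ((Q_map_eq_iff _ _ _).2 ?_)
    exact hg' ▸ FactorsInj.comp_of_inj (hRi n hn le_rfl) g' (R.d n)

instance (hn : 0 < n) (I : ∀ A : M, 𝒳.InjRes A) : (suspension hn I).Additive where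
  map_add {X Y} f g := by
    obtain ⟨f, rfl⟩ := exists_Q_map (A := X.as) (B := Y.as) f
    obtain ⟨g, rfl⟩ := exists_Q_map (A := X.as) (B := Y.as) g
    obtain ⟨s, φ, h0, rfl⟩ := (I X.as).exists_isLift hn (I Y.as) f
    obtain ⟨t, ψ, h1, rfl⟩ := (I X.as).exists_isLift hn (I Y.as) g
    rw [← 𝒳.Q.map_add, suspension_map hn I f ⟨φ, h0, rfl⟩, suspension_map hn I g ⟨ψ, h1, rfl⟩,
      suspension_map hn I (f + g) (s := φ.app (n + 1) + ψ.app (n + 1))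
        ⟨⟨fun k => φ.app k + ψ.app k, fun k hk => by
          rw [Preadditive.comp_add, Preadditive.add_comp, φ.comm k hk, ψ.comm k hk]⟩,
          congrArg₂ (· + ·) h0 h1, rfl⟩]
    exact 𝒳.Q.map_add

/-- The suspension of a Frobenius `n`-exact category is an autoequivalence: projective resolutions
provide inverse images of objects and of morphisms. -/
theorem isEquivalence_suspension (hn : 0 < n) (h𝒳 : 𝒳.IsFrobenius) (I : ∀ A : M, 𝒳.InjRes A) :
    (suspension hn I).IsEquivalence where
  faithful := ⟨by
    intro X Y f g hfg
    obtain ⟨f, rfl⟩ := exists_Q_map (A := X.as) (B := Y.as) f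
    obtain ⟨g, rfl⟩ := exists_Q_map (A := X.as) (B := Y.as) g
    obtain ⟨s, φ, h0, rfl⟩ := (I X.as).exists_isLift hn (I Y.as) f
    obtain ⟨t, ψ, h1, rfl⟩ := (I X.as).exists_isLift hn (I Y.as) g
    rw [suspension_map hn I f ⟨φ, h0, rfl⟩, suspension_map hn I g ⟨ψ, h1, rfl⟩] at hfg
    obtain ⟨y, hy⟩ := ((Q_map_eq_iff _ _ _).1 hfg).exists_lift h𝒳 (I Y.as).adm
    obtain ⟨w, hw⟩ := exists_first_factor (I X.as).isNExactSeq.isComplex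
      (I Y.as).isNExactSeq.1 (φ.sub ψ) y hy
    rw [Q_map_eq_iff]
    have : f - g = (I X.as).seq.d 0 ≫ w := by
      rw [hw, ← h0, ← h1]
      rfl
    rw [this]
    exact FactorsInj.comp_of_inj ((I X.as).inj_seq 1 le_rfl hn) _ _⟩
  full := ⟨by
    intro X Y s
    obtain ⟨s, rfl⟩ := exists_Q_map (A := (I X.as).cosyzygy) (B := (I Y.as).cosyzygy) s
    obtain ⟨τ, hτ⟩ := (I X.as).exists_ladder_of_last hn h𝒳 (I Y.as).adm s
    exact ⟨𝒳.Q.map (τ.app 0), suspension_map hn I (τ.app 0) ⟨τ, rfl, hτ⟩⟩⟩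
  essSurj := ⟨by
    rintro ⟨B⟩
    obtain ⟨R, hR, rfl, hRi⟩ := exists_proj_resolution h𝒳 B
    have hRe := 𝒳.isNExactSeq _ hR
    have hIe := (I (R.obj 0)).isNExactSeq
    obtain ⟨σ, hσ⟩ := (I (R.obj 0)).exists_ladder_of_first hR (hRi 1 le_rfl hn) (𝟙 _)
    obtain ⟨b, hb⟩ := (I (R.obj 0)).inj 0 hn (R.d 0) ⟨R, hR, rfl⟩ (I (R.obj 0)).ι
    obtain ⟨τ, hτ, -⟩ := exists_seqHom hRe hIe (𝟙 _) b (hb.trans (Category.id_comp _).symm)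
    obtain ⟨g, hg⟩ := exists_last_sub hIe.2 hIe.isComplex (σ.comp τ)
      ⟨fun _ => 𝟙 _, fun _ _ => by simp⟩ (by
        change σ.app 0 ≫ τ.app 0 = 𝟙 _
        rw [hσ, hτ]
        exact Category.id_comp _)
    obtain ⟨g', hg'⟩ := exists_last_sub hRe.2 hRe.isComplex (τ.comp σ)
      ⟨fun _ => 𝟙 _, fun _ _ => by simp⟩ (by
        change τ.app 0 ≫ σ.app 0 = 𝟙 _
        rw [hσ, hτ]
        exact Category.id_comp _)
    refine ⟨𝒳.Q.obj (R.obj 0), ⟨⟨𝒳.Q.map (σ.app (n + 1)), 𝒳.Q.map (τ.app (n + 1)), ?_, ?_⟩⟩⟩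
    · refine (𝒳.Q.map_comp _ _).symm.trans (((Q_map_eq_iff _ _ _).2 ?_).trans (𝒳.Q.map_id _))
      exact hg ▸ FactorsInj.comp_of_inj ((I _).inj_seq n hn le_rfl) g _
    · refine (𝒳.Q.map_comp _ _).symm.trans (((Q_map_eq_iff _ _ _).2 ?_).trans (𝒳.Q.map_id _))
      exact hg' ▸ FactorsInj.comp_of_inj (hRi n hn le_rfl) g' _⟩

end

end NExactStructure

/-! ### Sequences over a suspension: morphisms, rotation and exactness -/

section

variable {C : Type u} [Category.{v} C] [Preadditive C]

/-- A retract of a morphism and a weak cokernel of it is again of this kind; the components at the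
first term need not form a retract. -/
lemma IsWeakCokernel.of_retract {A B D A' B' D' : C} {f : A ⟶ B} {g : B ⟶ D} {f' : A' ⟶ B'}
    {g' : B' ⟶ D'} (h : IsWeakCokernel f' g') {iA : A ⟶ A'} {iB : B ⟶ B'} {iD : D ⟶ D'}
    {pA : A' ⟶ A} {pB : B' ⟶ B} {pD : D' ⟶ D} (h1 : f ≫ iB = iA ≫ f') (h2 : g ≫ iD = iB ≫ g')
    (h3 : f' ≫ pB = pA ≫ f) (h4 : iB ≫ pB = 𝟙 _) (h5 : iD ≫ pD = 𝟙 _) :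
    IsWeakCokernel f g := by
  refine ⟨?_, fun W x hx => ?_⟩
  · rw [← Category.comp_id (f ≫ g), ← h5, Category.assoc, ← Category.assoc g, h2,
      ← Category.assoc, ← Category.assoc, h1, Category.assoc iA, h.1, comp_zero, zero_comp]
  · obtain ⟨p, hp⟩ := h.2 W (pB ≫ x) (by rw [← Category.assoc, h3, Category.assoc, hx, comp_zero])
    refine ⟨iD ≫ p, ?_⟩
    rw [← Category.assoc, h2, Category.assoc, hp, ← Category.assoc, h4, Category.id_comp]

end

namespace SuspSeq

section

variable {n : ℕ} {F : Type u} [Category.{v} F] {T : F ⥤ F} {X Y Z : SuspSeq n T}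

/-- The composition of morphisms of `n`-`T`-sequences. -/
def Hom.comp (f : Hom X Y) (g : Hom Y Z) : Hom X Z where
  app k := f.app k ≫ g.app k
  comm k hk := by
    rw [← Category.assoc, f.comm k hk, Category.assoc, g.comm k hk, Category.assoc]
  comm_last := by
    rw [T.map_comp, ← Category.assoc, f.comm_last, Category.assoc, g.comm_last, Category.assoc]

lemma IsIsomorphic.trans (h : IsIsomorphic X Y) (h' : IsIsomorphic Y Z) : IsIsomorphic X Z := by
  obtain ⟨f, hf⟩ := h
  obtain ⟨g, hg⟩ := h'
  exact ⟨f.comp g, fun k hk => by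
    have := hf k hk
    have := hg k hk
    change IsIso (f.app k ≫ g.app k)
    infer_instance⟩

lemma Hom.extApp_of_le (f : Hom X Y) (k : ℕ) (hk : k ≤ n + 1) :
    f.extApp k = (X.extIso k hk).hom ≫ f.app k ≫ (Y.extIso k hk).inv :=
  dif_pos hk

lemma Hom.extApp_top (f : Hom X Y) (k : ℕ) (hk : ¬ k ≤ n + 1) :
    f.extApp k = (X.extTop k hk).hom ≫ T.map (f.app 0) ≫ (Y.extTop k hk).inv :=
  dif_neg hk

lemma Hom.isIso_extApp (f : Hom X Y) (hf : ∀ k, k ≤ n + 1 → IsIso (f.app k)) (k : ℕ) :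
    IsIso (f.extApp k) := by
  by_cases hk : k ≤ n + 1
  · have := hf k hk
    rw [f.extApp_of_le k hk]
    infer_instance
  · have := hf 0 (by omega)
    rw [f.extApp_top k hk]
    infer_instance

variable [Preadditive F]

/-- An isomorphism of `n`-`T`-sequences has an inverse. -/
lemma Hom.exists_inverse (f : Hom X Y) (hf : ∀ k, k ≤ n + 1 → IsIso (f.app k)) :
    ∃ g : Hom Y X, ∀ k, k ≤ n + 1 → f.app k ≫ g.app k = 𝟙 _ ∧ g.app k ≫ f.app k = 𝟙 _ := by
  have hg : ∀ k, ∃ g : Y.obj k ⟶ X.obj k, k ≤ n + 1 →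
      f.app k ≫ g = 𝟙 _ ∧ g ≫ f.app k = 𝟙 _ := fun k => by
    by_cases h : k ≤ n + 1
    · have := hf k h
      exact ⟨inv (f.app k), fun _ => by simp⟩
    · exact ⟨0, fun h' => absurd h' h⟩
  choose g hg using hg
  refine ⟨⟨⟨g, fun k hk => ?_⟩, ?_⟩, hg⟩
  · have := hf k (by omega)
    rw [← cancel_epi (f.app k), ← Category.assoc, ← f.comm k hk, Category.assoc,
      (hg (k + 1) (by omega)).1, ← Category.assoc, (hg k (by omega)).1, Category.comp_id,
      Category.id_comp]
  · have := hf (n + 1) le_rfl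
    change Y.last ≫ T.map (g 0) = g (n + 1) ≫ X.last
    rw [← cancel_epi (f.app (n + 1)), ← Category.assoc, ← f.comm_last, Category.assoc,
      ← T.map_comp, (hg 0 (by omega)).1, ← Category.assoc, (hg (n + 1) le_rfl).1, T.map_id,
      Category.comp_id, Category.id_comp]

lemma IsIsomorphic.symm (h : IsIsomorphic X Y) : IsIsomorphic Y X := by
  obtain ⟨f, hf⟩ := h
  obtain ⟨g, hg⟩ := f.exists_inverse hf
  exact ⟨g, fun k hk => ⟨f.app k, (hg k hk).2, (hg k hk).1⟩⟩

/-- Retracts of exact sequences are exact. -/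
lemma Exact.of_retract (hZ : Z.Exact) (i : Hom X Z) (p : Hom Z X)
    (h : ∀ k, k ≤ n + 1 → i.app k ≫ p.app k = 𝟙 _) : X.Exact := by
  have hT : ∀ k, k ≤ n + 1 → T.map (i.app k) ≫ T.map (p.app k) = 𝟙 _ := fun k hk => by
    rw [← T.map_comp, h k hk, T.map_id]
  have hs : ∀ {V W : SuspSeq n T} (f : Hom V W),
      T.map (V.d 0) ≫ T.map (f.app 1) = T.map (f.app 0) ≫ T.map (W.d 0) := fun f => by
    rw [← T.map_comp, f.comm 0 (by omega), T.map_comp]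
  refine ⟨fun k hk => ?_, ?_, ?_⟩
  · exact (hZ.1 k hk).of_retract (i.comm k (by omega)) (i.comm (k + 1) (by omega))
      (p.comm k (by omega)) (h (k + 1) (by omega)) (h (k + 2) (by omega))
  · exact hZ.2.1.of_retract (i.comm n (by omega)) i.comm_last (p.comm n (by omega))
      (h (n + 1) (by omega)) (hT 0 (by omega))
  · exact hZ.2.2.of_retract i.comm_last (hs i) p.comm_last (hT 0 (by omega)) (hT 1 (by omega))

lemma Exact.of_isIsomorphic (hX : X.Exact) (h : IsIsomorphic X Y) : Y.Exact := by
  obtain ⟨f, hf⟩ := h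
  obtain ⟨g, hg⟩ := f.exists_inverse hf
  exact hX.of_retract g f fun k hk => (hg k hk).2

lemma extMap_of_le (X : SuspSeq n T) (k : ℕ) (hk : k ≤ n) :
    X.extMap k = (X.extIso k (by omega)).hom ≫ X.d k ≫ (X.extIso (k + 1) (by omega)).inv :=
  dif_pos hk

lemma extMap_last (X : SuspSeq n T) :
    X.extMap (n + 1) =
      (X.extIso (n + 1) le_rfl).hom ≫ X.last ≫ (X.extTop (n + 2) (by omega)).inv := by
  unfold extMap
  rw [dif_neg (by omega), dif_pos rfl, eqToHom_refl, Category.id_comp]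

lemma Hom.extApp_comm (f : Hom X Y) (k : ℕ) (hk : k ≤ n + 1) :
    X.extMap k ≫ f.extApp (k + 1) = f.extApp k ≫ Y.extMap k := by
  rcases hk.eq_or_lt with rfl | hlt
  · rw [extMap_last, extMap_last, f.extApp_top _ (by omega), f.extApp_of_le _ le_rfl]
    simp only [Category.assoc, Iso.inv_hom_id_assoc]
    rw [← Category.assoc X.last, f.comm_last, Category.assoc]
  · rw [extMap_of_le _ _ (by omega), extMap_of_le _ _ (by omega), f.extApp_of_le _ (by omega),
      f.extApp_of_le _ (by omega)]
    simp only [Category.assoc, Iso.inv_hom_id_assoc]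
    rw [← Category.assoc (X.d k), f.comm k hlt, Category.assoc]

/-- Rotation of morphisms. -/
def Hom.rotate [T.Additive] (f : Hom X Y) : Hom X.rotate Y.rotate where
  app k := f.extApp (k + 1)
  comm k hk := f.extApp_comm (k + 1) (by omega)
  comm_last := by
    change ((X.extTop (n + 2) (by omega)).hom ≫ ((-1 : ℤ) ^ n • T.map (X.d 0)) ≫
        T.map (X.extIso 1 (by omega)).inv) ≫ T.map (f.extApp 1) = f.extApp (n + 2) ≫
      (Y.extTop (n + 2) (by omega)).hom ≫ ((-1 : ℤ) ^ n • T.map (Y.d 0)) ≫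
        T.map (Y.extIso 1 (by omega)).inv
    rw [f.extApp_of_le 1 (by omega), f.extApp_top (n + 2) (by omega)]
    simp only [Category.assoc, Iso.inv_hom_id_assoc, ← T.map_comp, Preadditive.zsmul_comp,
      Preadditive.comp_zsmul]
    rw [← Category.assoc (X.d 0), f.comm 0 (by omega), Category.assoc]

lemma IsIsomorphic.rotate [T.Additive] (h : IsIsomorphic X Y) :
    IsIsomorphic X.rotate Y.rotate := by
  obtain ⟨f, hf⟩ := h
  exact ⟨f.rotate, fun k _ => f.isIso_extApp hf (k + 1)⟩

/-- A ladder into a rotated sequence, given by its components. -/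
lemma exists_seqHom_rotate (Z : Seq F) (X : SuspSeq n T) (r : ∀ k, Z.obj k ⟶ X.obj (k + 1))
    (e : Z.obj (n + 1) ⟶ T.obj (X.obj 0))
    (hr : ∀ k, k < n → Z.d k ≫ r (k + 1) = r k ≫ X.d (k + 1)) (he : Z.d n ≫ e = r n ≫ X.last) :
    ∃ f : SeqHom (n + 1) Z X.rotate.toSeq,
      (∀ k (hk : k ≤ n), f.app k = r k ≫ (X.extIso (k + 1) (by omega)).inv) ∧
      f.app (n + 1) = e ≫ (X.extTop (n + 2) (by omega)).inv := by
  obtain ⟨a, a1, a2⟩ := exists_family (O := fun k => Z.obj k ⟶ X.extObj (k + 1)) (n + 1)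
    (fun k hk => r k ≫ (X.extIso (k + 1) hk).inv) (e ≫ (X.extTop (n + 2) (by omega)).inv)
  refine ⟨⟨a, fun k hk => ?_⟩, fun k hk => a1 k (by omega), a2⟩
  change Z.d k ≫ a (k + 1) = a k ≫ X.extMap (k + 1)
  rw [a1 k (by omega)]
  rcases (Nat.lt_succ_iff.1 hk).eq_or_lt with rfl | hlt
  · rw [a2, SuspSeq.extMap_last, Category.assoc, Iso.inv_hom_id_assoc, ← Category.assoc, he,
      Category.assoc]
  · rw [a1 _ (by omega), SuspSeq.extMap_of_le _ _ (by omega), Category.assoc,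
      Iso.inv_hom_id_assoc, ← Category.assoc, hr k hlt, Category.assoc]

/-- A morphism into a rotated sequence, given by its components. -/
lemma exists_hom_rotate (Z X : SuspSeq n T) (r : ∀ k, Z.obj k ⟶ X.obj (k + 1))
    (e : Z.obj (n + 1) ⟶ T.obj (X.obj 0))
    (hr : ∀ k, k < n → Z.d k ≫ r (k + 1) = r k ≫ X.d (k + 1)) (he : Z.d n ≫ e = r n ≫ X.last)
    (hl : Z.last ≫ T.map (r 0) = e ≫ ((-1 : ℤ) ^ n • T.map (X.d 0))) :
    ∃ f : Hom Z X.rotate, (∀ k (hk : k + 1 ≤ n + 1), f.app k = r k ≫ (X.extIso (k + 1) hk).inv) ∧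
      f.app (n + 1) = e ≫ (X.extTop (n + 2) (by omega)).inv ∧
      ((∀ k, k ≤ n → IsIso (r k)) → IsIso e → ∀ k, k ≤ n + 1 → IsIso (f.app k)) := by
  obtain ⟨g, g1, g2⟩ := exists_seqHom_rotate Z.toSeq X r e hr he
  obtain ⟨a, ha⟩ : ∃ a : ∀ k, Z.obj k ⟶ X.extObj (k + 1), ∀ k, g.app k = a k :=
    ⟨g.app, fun _ => rfl⟩
  have a1 : ∀ k (hk : k + 1 ≤ n + 1), a k = r k ≫ (X.extIso (k + 1) hk).inv := fun k hk =>
    (ha k).symm.trans (g1 k (by omega))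
  have a2 : a (n + 1) = e ≫ (X.extTop (n + 2) (by omega)).inv := (ha (n + 1)).symm.trans g2
  refine ⟨⟨g, ?_⟩, fun k hk => (ha k).trans (a1 k hk), g2, fun h h' k hk => ?_⟩
  · rw [ha 0, ha (n + 1)]
    change Z.last ≫ T.map (a 0) = a (n + 1) ≫ (X.extTop (n + 2) (by omega)).hom ≫
        ((-1 : ℤ) ^ n • T.map (X.d 0)) ≫ T.map (X.extIso 1 (by omega)).inv
    rw [a1 0 (by omega), a2, Category.assoc, Iso.inv_hom_id_assoc, T.map_comp, ← Category.assoc,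
      hl, Category.assoc]
  · rw [ha k]
    change IsIso (a k)
    rcases hk.eq_or_lt with rfl | hlt
    · rw [a2]
      infer_instance
    · have := h k (by omega)
      rw [a1 k hlt]
      infer_instance

/-- A morphism between rotated sequences whose component of index `n + 1` is of the form `T a`
can be rotated back. -/
lemma Hom.exists_of_rotate (f : Hom X.rotate Y.rotate) (a : X.obj 0 ⟶ Y.obj 0)
    (b : X.obj 1 ⟶ Y.obj 1)
    (hb : f.app 0 = (X.extIso 1 (by omega)).hom ≫ b ≫ (Y.extIso 1 (by omega)).inv)
    (hab : X.d 0 ≫ b = a ≫ Y.d 0)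
    (hl : f.app (n + 1) =
      (X.extTop (n + 2) (by omega)).hom ≫ T.map a ≫ (Y.extTop (n + 2) (by omega)).inv) :
    ∃ g : Hom X Y, g.app 0 = a ∧ g.app 1 = b := by
  obtain ⟨p, hp⟩ : ∃ p : ∀ k, X.extObj (k + 1) ⟶ Y.extObj (k + 1), ∀ k, f.app k = p k :=
    ⟨f.app, fun _ => rfl⟩
  replace hb := (hp 0).symm.trans hb
  replace hl := (hp (n + 1)).symm.trans hl
  let q : ∀ k, X.obj k ⟶ Y.obj k
    | 0 => a
    | k + 1 => if h : k + 1 ≤ n + 1 then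
        (X.extIso (k + 1) h).inv ≫ p k ≫
          (Y.extIso (k + 1) h).hom else 0
  have q1 : ∀ k (h : k + 1 ≤ n + 1), q (k + 1) = (X.extIso (k + 1) h).inv ≫
      p k ≫ (Y.extIso (k + 1) h).hom :=
    fun k h => dif_pos h
  have hb' : q 1 = b := by
    rw [q1 0 (by omega), hb]
    simp
  refine ⟨⟨⟨q, fun k hk => ?_⟩, ?_⟩, rfl, hb'⟩
  · rcases k with _ | k
    · rw [hb']
      exact hab
    · rw [q1 k (by omega), q1 (k + 1) (by omega)]
      have := f.comm k (by omega)
      rw [hp, hp] at this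
      change X.extMap (k + 1) ≫ p (k + 1) = p k ≫ Y.extMap (k + 1) at this
      rw [extMap_of_le _ _ (by omega), extMap_of_le _ _ (by omega)] at this
      rw [← cancel_epi (X.extIso (k + 1) (by omega)).hom,
        ← cancel_mono (Y.extIso (k + 2) (by omega)).inv]
      simpa using this
  · change X.last ≫ T.map a = q (n + 1) ≫ Y.last
    rw [q1 n le_rfl]
    have := f.comm n (by omega)
    rw [hp, hp] at this
    change X.extMap (n + 1) ≫ p (n + 1) = p n ≫ Y.extMap (n + 1) at this
    rw [extMap_last, extMap_last, hl] at this
    rw [← cancel_epi (X.extIso (n + 1) (by omega)).hom,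
      ← cancel_mono (Y.extTop (n + 2) (by omega)).inv]
    simpa using this

/-- Fully faithful functors reflect weak cokernels. -/
lemma _root_.NExact.IsWeakCokernel.of_map [T.Full] [T.Faithful] [T.Additive] {A B D : F}
    {f : A ⟶ B} {g : B ⟶ D} (h : IsWeakCokernel (T.map f) (T.map g)) : IsWeakCokernel f g := by
  refine ⟨T.map_injective (by rw [T.map_comp, h.1, T.map_zero]), fun W x hx => ?_⟩
  obtain ⟨p, hp⟩ := h.2 _ (T.map x) (by rw [← T.map_comp, hx, T.map_zero])
  obtain ⟨p, rfl⟩ := T.map_surjective p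
  exact ⟨p, T.map_injective (by rw [T.map_comp, hp])⟩

/-- If the rotation of a sequence is exact, then so is the sequence. -/
lemma Exact.of_rotate [T.Full] [T.Faithful] [T.Additive] (hn : 0 < n) (h : X.rotate.Exact) :
    X.Exact := by
  obtain ⟨h1, h2, h3⟩ := h
  change ∀ k, k < n → IsWeakCokernel (X.extMap (k + 1)) (X.extMap (k + 2)) at h1
  change IsWeakCokernel (X.extMap (n + 1)) ((X.extTop (n + 2) (by omega)).hom ≫
      ((-1 : ℤ) ^ n • T.map (X.d 0)) ≫ T.map (X.extIso 1 (by omega)).inv) at h2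
  change IsWeakCokernel ((X.extTop (n + 2) (by omega)).hom ≫
      ((-1 : ℤ) ^ n • T.map (X.d 0)) ≫ T.map (X.extIso 1 (by omega)).inv)
      (T.map (X.extMap 1)) at h3
  refine ⟨fun k hk => ?_, ?_, ?_⟩
  · rcases k with _ | k
    · rw [extMap_of_le _ _ (by omega)] at h3
      have := h3.of_iso (X.extTop (n + 2) (by omega)) (T.mapIso (X.extIso 1 (by omega)))
        (T.mapIso (X.extIso 2 (by omega))) (f' := (-1 : ℤ) ^ n • T.map (X.d 0))
        (g' := T.map (X.d 1)) (by
          simp only [T.mapIso_hom, Category.assoc, ← T.map_comp, Iso.inv_hom_id, T.map_id,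
            Category.comp_id])
        (by simp only [T.mapIso_hom, Category.assoc, ← T.map_comp, Iso.inv_hom_id,
          Category.comp_id])
      have := this.zsmul_left (neg_one_pow_mul_self n)
      rw [smul_smul, neg_one_pow_mul_self, one_smul] at this
      exact this.of_map
    · have := h1 k (by omega)
      rw [extMap_of_le _ _ (by omega), extMap_of_le _ _ (by omega)] at this
      exact this.of_iso (X.extIso (k + 1) (by omega)) (X.extIso (k + 2) (by omega))
        (X.extIso (k + 3) (by omega)) (by simp) (by simp)
  · obtain ⟨m, rfl⟩ : ∃ m, n = m + 1 := ⟨n - 1, by omega⟩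
    have := h1 m (by omega)
    rw [extMap_of_le _ _ (by omega), extMap_last] at this
    exact this.of_iso (X.extIso (m + 1) (by omega)) (X.extIso (m + 2) (by omega))
      (X.extTop (m + 3) (by omega)) (by simp) (by simp)
  · rw [extMap_last] at h2
    have := h2.of_iso (X.extIso (n + 1) (by omega)) (X.extTop (n + 2) (by omega))
        (T.mapIso (X.extIso 1 (by omega))) (f' := X.last) (g' := (-1 : ℤ) ^ n • T.map (X.d 0))
        (by simp) (by
          simp only [T.mapIso_hom, Category.assoc, ← T.map_comp, Iso.inv_hom_id, T.map_id,
            Category.comp_id])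
    have := this.zsmul_right (neg_one_pow_mul_self n)
    rwa [smul_smul, neg_one_pow_mul_self, one_smul] at this

end

end SuspSeq

namespace NExactStructure

variable {n : ℕ} {M : Type u} [Category.{v} M] [Preadditive M] [HasZeroObject M]
  [HasBinaryBiproducts M] {𝒳 : NExactStructure n M}

/-- For every admissible sequence there is a ladder to the resolution of its first term. -/
lemma exists_ladder_to_injRes (hn : 0 < n) {E : Seq M} (hE : 𝒳.adm E) (J : 𝒳.InjRes (E.obj 0)) :
    ∃ θ : SeqHom (n + 1) E J.seq, θ.app 0 = 𝟙 (E.obj 0) := by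
  obtain ⟨b, hb⟩ := J.inj 0 hn (E.d 0) ⟨E, hE, rfl⟩ J.ι
  obtain ⟨θ, h, -⟩ := exists_seqHom (𝒳.isNExactSeq _ hE) J.isNExactSeq (𝟙 _) b
    (hb.trans (Category.id_comp _).symm)
  exact ⟨θ, h⟩

/-- The rotation of a standard angle is the sequence given by its lower row. -/
lemma isIsomorphic_angleOf_rotate (hn : 0 < n) {I : ∀ A : M, 𝒳.InjRes A} (D : StandardData I)
    (θ : SeqHom (n + 1) D.E (I (D.E.obj 0)).seq) (hθ : θ.app 0 = 𝟙 (D.E.obj 0)) :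
    SuspSeq.IsIsomorphic (angleOf hn I D.E (θ.app (n + 1))) (D.angle hn).rotate := by
  obtain ⟨w, hw, hwe⟩ : ∃ w : (I D.A).cosyzygy ⟶ D.E.obj (n + 1),
      D.φ.app (n + 1) = w ∧ w ≫ D.e.hom = 𝟙 _ := ⟨_, rfl, D.φ_last⟩
  have hδ : D.e.hom ≫ w = 𝟙 _ := by
    rw [← cancel_mono D.e.hom, Category.assoc, hwe, Category.id_comp, Category.comp_id]
  obtain ⟨δ, hδ'⟩ : ∃ δ : D.E.obj (n + 1) ⟶ (I (D.E.obj 0)).cosyzygy, θ.app (n + 1) = δ := ⟨_, rfl⟩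
  have hS : (suspension hn I).map (𝒳.Q.map (D.φ.app 0)) = 𝒳.Q.map (w ≫ δ) :=
    suspension_map hn I _ ⟨D.φ.comp θ, by
      change D.φ.app 0 ≫ θ.app 0 = _
      rw [hθ]
      exact Category.comp_id _, congrArg₂ _ hw hδ'⟩
  have hδS : (-1 : ℤ) ^ n • 𝒳.Q.map δ = 𝒳.Q.map D.e.hom ≫ ((-1 : ℤ) ^ n • 𝒳.Q.map (w ≫ δ)) := by
    rw [Preadditive.comp_zsmul, ← 𝒳.Q.map_comp, ← Category.assoc, hδ, Category.id_comp]
  rw [hδ']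
  obtain ⟨f, -, -, hf⟩ := SuspSeq.exists_hom_rotate (angleOf hn I D.E δ)
    (D.angle hn) (fun k => 𝟙 (𝒳.Q.obj (D.E.obj k))) (𝒳.Q.map D.e.hom)
    (fun k _ => (Category.comp_id _).trans (Category.id_comp _).symm)
    ((𝒳.Q.map_comp _ _).symm.trans (Category.id_comp _).symm)
    (((congrArg _ ((suspension hn I).map_id _)).trans (Category.comp_id _)).trans
      (hδS.trans (congrArg (fun z => 𝒳.Q.map D.e.hom ≫ ((-1 : ℤ) ^ n • z)) hS.symm)))
  exact ⟨f, hf (fun k _ => inferInstanceAs (IsIso (𝟙 _)))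
    (inferInstanceAs (IsIso (𝒳.Q.map D.e.hom)))⟩

/-- The functors `Hom(-, W)` turn standard angles into exact sequences. -/
theorem exact_angle (hn : 0 < n) (h𝒳 : 𝒳.IsFrobenius) {I : ∀ A : M, 𝒳.InjRes A}
    (D : StandardData I) : (D.angle hn).Exact := by
  have := isEquivalence_suspension hn h𝒳 I
  obtain ⟨θ, hθ⟩ := exists_ladder_to_injRes hn D.adm (I (D.E.obj 0))
  exact SuspSeq.Exact.of_rotate hn
    ((exact_angleOf hn h𝒳 I (𝒳.isNExactSeq _ D.adm).2 θ hθ).of_isIsomorphic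
      (isIsomorphic_angleOf_rotate hn D θ hθ))

lemma exact_of_angles (hn : 0 < n) (h𝒳 : 𝒳.IsFrobenius) {I : ∀ A : M, 𝒳.InjRes A}
    {X : SuspSeq n (suspension hn I)} (hX : angles hn I X) : X.Exact := by
  obtain ⟨D, hD⟩ := hX
  exact (exact_angle hn h𝒳 D).of_isIsomorphic hD

end NExactStructure

/-! ### Truncated mapping cones -/

section

variable {C : Type u} [Category.{v} C] [Preadditive C]

/-- The sequence `X⁰ ⟶ ⋯ ⟶ Xᵐ⁺¹ ⟶ Z`, whose terms beyond `Xᵐ⁺¹` are all replaced by `Z`. -/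
def Seq.splice (X : Seq C) (m : ℕ) {Z : C} (f : X.obj (m + 1) ⟶ Z) : Seq C where
  obj
    | 0 => X.obj 0
    | k + 1 => if k ≤ m then X.obj (k + 1) else Z
  d
    | 0 => X.d 0 ≫ eqToHom (if_pos (Nat.zero_le m)).symm
    | k + 1 => if h : k + 1 ≤ m then
        eqToHom (if_pos (by omega)) ≫ X.d (k + 1) ≫ eqToHom (if_pos h).symm
      else if h' : k = m then
        eqToHom (by subst h'; exact if_pos le_rfl) ≫ f ≫ eqToHom (if_neg h).symm
      else 0

section Splice

variable (X : Seq C) (m : ℕ) {Z : C} (f : X.obj (m + 1) ⟶ Z)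

/-- The terms of index at most `m + 1` of a spliced sequence are those of the original one. -/
def Seq.spliceIso : ∀ k, k ≤ m + 1 → ((X.splice m f).obj k ≅ X.obj k)
  | 0, _ => Iso.refl (X.obj 0)
  | _ + 1, hk => eqToIso (if_pos (Nat.succ_le_succ_iff.1 hk))

/-- The term of index `m + 2` of a spliced sequence. -/
def Seq.spliceTop : (X.splice m f).obj (m + 2) ≅ Z :=
  eqToIso (if_neg (show ¬ m + 1 ≤ m by omega))

lemma Seq.splice_d : ∀ k (hk : k < m + 1), (X.splice m f).d k ≫ (X.spliceIso m f (k + 1) hk).hom =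
    (X.spliceIso m f k hk.le).hom ≫ X.d k
  | 0, hk => by
    have : ∀ (h : X.obj 1 = (X.splice m f).obj 1) (h' : (X.splice m f).obj 1 = X.obj 1),
        (X.d 0 ≫ eqToHom h) ≫ eqToHom h' = 𝟙 (X.obj 0) ≫ X.d 0 := fun h h' => by
      rw [Category.assoc, eqToHom_trans, eqToHom_refl, Category.comp_id, Category.id_comp]
    exact this (show X.obj 1 = if 0 ≤ m then X.obj 1 else Z from (if_pos (Nat.zero_le m)).symm)
      (show (if 0 ≤ m then X.obj 1 else Z) = X.obj 1 from if_pos (Nat.zero_le m))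
  | k + 1, hk => by
    have e : (X.splice m f).d (k + 1) = (X.spliceIso m f (k + 1) hk.le).hom ≫ X.d (k + 1) ≫
      (X.spliceIso m f (k + 2) hk).inv := dif_pos (show k + 1 ≤ m by omega)
    rw [e]
    simp

lemma Seq.splice_d_top : (X.splice m f).d (m + 1) ≫ (X.spliceTop m f).hom =
    (X.spliceIso m f (m + 1) le_rfl).hom ≫ f := by
  have e : (X.splice m f).d (m + 1) = (X.spliceIso m f (m + 1) le_rfl).hom ≫ f ≫
      (X.spliceTop m f).inv :=
    (dif_neg (show ¬ m + 1 ≤ m by omega)).trans (dif_pos rfl)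
  rw [e]
  simp

/-- If `X⁰ ⟶ ⋯ ⟶ Xᵐ⁺¹ ⟶ Z` has the cokernel property, then so has the spliced sequence. -/
lemma Seq.isNCokernel_splice (hX : X.WeakCokernels m) (hf : IsWeakCokernel (X.d m) f)
    (hf' : Epi f) : IsNCokernel (m + 1) (X.splice m f) := by
  have h1 : ∀ k (hk : k < m + 1), X.d k ≫ (X.spliceIso m f (k + 1) hk).inv =
      (X.spliceIso m f k hk.le).inv ≫ (X.splice m f).d k := fun k hk => by
    rw [Iso.comp_inv_eq, Category.assoc, X.splice_d m f k hk, Iso.inv_hom_id_assoc]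
  have h2 : f ≫ (X.spliceTop m f).inv =
      (X.spliceIso m f (m + 1) le_rfl).inv ≫ (X.splice m f).d (m + 1) := by
    rw [Iso.comp_inv_eq, Category.assoc, X.splice_d_top m f, Iso.inv_hom_id_assoc]
  refine ⟨fun k hk => ?_, ?_⟩
  · rcases (Nat.lt_succ_iff.1 hk).eq_or_lt with rfl | hlt
    · exact hf.of_iso (X.spliceIso k f k hk.le).symm (X.spliceIso k f (k + 1) le_rfl).symm
        (X.spliceTop k f).symm (h1 k hk) h2
    · exact (hX k hlt).of_iso (X.spliceIso m f k hk.le).symm (X.spliceIso m f (k + 1) hk).symm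
        (X.spliceIso m f (k + 2) (by omega)).symm (h1 k hk) (h1 (k + 1) (by omega))
  · have : (X.splice m f).d (m + 1) =
        (X.spliceIso m f (m + 1) le_rfl).hom ≫ f ≫ (X.spliceTop m f).inv := by
      rw [h2, Iso.hom_inv_id_assoc]
    rw [this]
    infer_instance

end Splice

/-- The biproduct decomposition of the terms of the mapping cone of a ladder `P ⟶ E`: `a` and `b`
are the inclusions of the terms of `P` and `E`, `p` and `q` the projections to them. -/
structure ConeData {N : ℕ} {P E : Seq C} (φ : SeqHom N P E) (X : Seq C) where
  /-- the inclusions of the terms of `P` -/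
  a (k : ℕ) : P.obj k ⟶ X.obj k
  /-- the inclusions of the terms of `E` -/
  b (k : ℕ) : E.obj k ⟶ X.obj (k + 1)
  /-- the projections to the terms of `P` -/
  p (k : ℕ) : X.obj k ⟶ P.obj k
  /-- the projections to the terms of `E` -/
  q (k : ℕ) : X.obj (k + 1) ⟶ E.obj k
  a_p (k : ℕ) : a k ≫ p k = 𝟙 _
  b_q (k : ℕ) : b k ≫ q k = 𝟙 _
  b_p (k : ℕ) : b k ≫ p (k + 1) = 0
  a_q (k : ℕ) : a (k + 1) ≫ q k = 0
  p_a : p 0 ≫ a 0 = 𝟙 _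
  total (k : ℕ) : p (k + 1) ≫ a (k + 1) + q k ≫ b k = 𝟙 _
  a_d (k : ℕ) : a k ≫ X.d k = -(P.d k ≫ a (k + 1)) + φ.app k ≫ b k
  b_d (k : ℕ) : b k ≫ X.d (k + 1) = E.d k ≫ b (k + 1)

lemma biprod_inl_ofComponents [HasBinaryBiproducts C] {A B A' B' : C} (a : A ⟶ A') (b : A ⟶ B')
    (c : B ⟶ A') (d : B ⟶ B') :
    biprod.inl ≫ Biprod.ofComponents a b c d = a ≫ biprod.inl + b ≫ biprod.inr := by
  simp [Biprod.ofComponents]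

lemma biprod_inr_ofComponents [HasBinaryBiproducts C] {A B A' B' : C} (a : A ⟶ A') (b : A ⟶ B')
    (c : B ⟶ A') (d : B ⟶ B') :
    biprod.inr ≫ Biprod.ofComponents a b c d = c ≫ biprod.inl + d ≫ biprod.inr := by
  simp [Biprod.ofComponents]

/-- The mapping cone of a ladder. -/
def coneSeqData [HasBinaryBiproducts C] {N : ℕ} {P E : Seq C} (φ : SeqHom N P E) :
    ConeData φ (coneSeq φ) where
  a
    | 0 => 𝟙 (P.obj 0)
    | _ + 1 => biprod.inl
  b _ := biprod.inr
  p
    | 0 => 𝟙 (P.obj 0)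
    | _ + 1 => biprod.fst
  q _ := biprod.snd
  a_p
    | 0 => Category.comp_id _
    | _ + 1 => biprod.inl_fst
  b_q _ := biprod.inr_snd
  b_p _ := biprod.inr_fst
  a_q _ := biprod.inl_snd
  p_a := Category.comp_id _
  total _ := biprod.total
  a_d
    | 0 => (Category.id_comp _).trans
      (biprod.lift_eq.trans (congrArg (· + φ.app 0 ≫ biprod.inr) (Preadditive.neg_comp _ _)))
    | k + 1 => (biprod_inl_ofComponents _ _ _ _).trans
      (congrArg (· + φ.app (k + 1) ≫ biprod.inr) (Preadditive.neg_comp _ _))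
  b_d k := (biprod_inr_ofComponents _ _ _ _).trans
    ((congrArg (· + E.d k ≫ biprod.inr) zero_comp).trans (zero_add _))

namespace ConeData

variable {N m : ℕ} {P E X : Seq C} {φ : SeqHom N P E}

lemma hom_ext (D : ConeData φ X) (k : ℕ) {W : C} {h h' : X.obj (k + 1) ⟶ W}
    (h1 : D.a (k + 1) ≫ h = D.a (k + 1) ≫ h') (h2 : D.b k ≫ h = D.b k ≫ h') : h = h' := by
  rw [← Category.id_comp h, ← Category.id_comp h', ← D.total k, Preadditive.add_comp,
    Preadditive.add_comp, Category.assoc, Category.assoc, h1, h2, Category.assoc, Category.assoc]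

lemma hom_ext_zero (D : ConeData φ X) {W : C} {h h' : X.obj 0 ⟶ W}
    (h1 : D.a 0 ≫ h = D.a 0 ≫ h') : h = h' := by
  rw [← Category.id_comp h, ← Category.id_comp h', ← D.p_a, Category.assoc, Category.assoc, h1]

/-- The morphism on a term of the mapping cone with given components. -/
lemma exists_desc (D : ConeData φ X) (k : ℕ) {W : C} (x : P.obj (k + 1) ⟶ W) (y : E.obj k ⟶ W) :
    ∃ h : X.obj (k + 1) ⟶ W, D.a (k + 1) ≫ h = x ∧ D.b k ≫ h = y := by
  refine ⟨D.p (k + 1) ≫ x + D.q k ≫ y, ?_, ?_⟩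
  · rw [Preadditive.comp_add, ← Category.assoc, D.a_p, ← Category.assoc, D.a_q, zero_comp,
      Category.id_comp, add_zero]
  · rw [Preadditive.comp_add, ← Category.assoc, D.b_p, ← Category.assoc, D.b_q, zero_comp,
      Category.id_comp, zero_add]

lemma a_d_comp (D : ConeData φ X) (k : ℕ) {W : C} (h : X.obj (k + 1) ⟶ W) :
    D.a k ≫ X.d k ≫ h = -(P.d k ≫ D.a (k + 1) ≫ h) + φ.app k ≫ D.b k ≫ h := by
  rw [← Category.assoc, D.a_d, Preadditive.add_comp, Preadditive.neg_comp, Category.assoc,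
    Category.assoc]

lemma b_d_comp (D : ConeData φ X) (k : ℕ) {W : C} (h : X.obj (k + 2) ⟶ W) :
    D.b k ≫ X.d (k + 1) ≫ h = E.d k ≫ D.b (k + 1) ≫ h := by
  rw [← Category.assoc, D.b_d, Category.assoc]

lemma isComplex (D : ConeData φ X) (hP : P.IsComplex m) (hE : E.IsComplex m) (hm : m ≤ N) :
    X.IsComplex m := by
  intro k hk
  have h1 : D.a k ≫ X.d k ≫ X.d (k + 1) = 0 := by
    rw [D.a_d_comp, D.a_d, D.b_d, Preadditive.comp_add, Preadditive.comp_neg, ← Category.assoc,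
      hP k hk, zero_comp, neg_zero, zero_add, ← Category.assoc, φ.comm k (by omega),
      Category.assoc, neg_add_cancel]
  rcases k with _ | k
  · exact D.hom_ext_zero (h1.trans comp_zero.symm)
  · refine D.hom_ext k (h1.trans comp_zero.symm) ?_
    rw [D.b_d_comp, D.b_d, ← Category.assoc, hE k (by omega), zero_comp, comp_zero]

/-- The morphism `[φᵐ⁺¹, dᵐ]` out of the term of index `m + 1` of the mapping cone. -/
def top (D : ConeData φ X) (m : ℕ) : X.obj (m + 1) ⟶ E.obj (m + 1) :=
  D.p (m + 1) ≫ φ.app (m + 1) + D.q m ≫ E.d m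

lemma a_top (D : ConeData φ X) (m : ℕ) : D.a (m + 1) ≫ D.top m = φ.app (m + 1) := by
  rw [top, Preadditive.comp_add, ← Category.assoc, D.a_p, ← Category.assoc, D.a_q, zero_comp,
    Category.id_comp, add_zero]

lemma b_top (D : ConeData φ X) (m : ℕ) : D.b m ≫ D.top m = E.d m := by
  rw [top, Preadditive.comp_add, ← Category.assoc, D.b_p, ← Category.assoc, D.b_q, zero_comp,
    Category.id_comp, zero_add]

lemma d_top (D : ConeData φ X) (m : ℕ) (hm : m < N) (hE : E.IsComplex m) :
    X.d m ≫ D.top m = 0 := by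
  have h1 : D.a m ≫ X.d m ≫ D.top m = 0 := by
    rw [D.a_d_comp, D.a_top, D.b_top, φ.comm m hm, neg_add_cancel]
  rcases m with _ | m
  · exact D.hom_ext_zero (h1.trans comp_zero.symm)
  · refine D.hom_ext m (h1.trans comp_zero.symm) ?_
    rw [D.b_d_comp, D.b_top, hE m (by omega), comp_zero]

/-- The truncated mapping cone `P⁰ ⟶ P¹ ⊕ E⁰ ⟶ ⋯ ⟶ Pᵐ⁺¹ ⊕ Eᵐ ⟶ Eᵐ⁺¹`. -/
def trunc (D : ConeData φ X) (m : ℕ) : Seq C := X.splice m (D.top m)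

/-- The truncated mapping cone of a ladder whose last component is an isomorphism has the
cokernel property, provided that only morphisms `y` on `E⁰` that factor through `E⁰ ⟶ E¹` satisfy
`φ⁰ ≫ y = d⁰ ≫ x` for some `x`. -/
lemma isNCokernel_trunc {φ : SeqHom (m + 2) P E} (D : ConeData φ X) (hP : IsNCokernel (m + 1) P)
    (hE : IsNCokernel (m + 1) E) (e : E.obj (m + 2) ⟶ P.obj (m + 2))
    (he : φ.app (m + 2) ≫ e = 𝟙 _) (he' : e ≫ φ.app (m + 2) = 𝟙 _)
    (hφ : ∀ {W : C} (x : P.obj 1 ⟶ W) (y : E.obj 0 ⟶ W), φ.app 0 ≫ y = P.d 0 ≫ x →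
      ∃ z, E.d 0 ≫ z = y) :
    IsNCokernel (m + 1) (D.trunc m) := by
  have hPc : P.IsComplex (m + 1) := Seq.WeakCokernels.isComplex hP.1
  have hEc : E.IsComplex (m + 1) := Seq.WeakCokernels.isComplex hE.1
  have step : ∀ k, k ≤ m → ∀ {W : C} (h : X.obj (k + 1) ⟶ W), X.d k ≫ h = 0 →
      ∃ (z : E.obj (k + 1) ⟶ W) (x : P.obj (k + 2) ⟶ W), D.b k ≫ h = E.d k ≫ z ∧
        D.a (k + 1) ≫ h = -(P.d (k + 1) ≫ x) + φ.app (k + 1) ≫ z := by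
    intro k hk W h hh
    have h1 : φ.app k ≫ D.b k ≫ h = P.d k ≫ D.a (k + 1) ≫ h := by
      rw [← sub_eq_zero, sub_eq_neg_add, ← D.a_d_comp, hh, comp_zero]
    obtain ⟨z, hz⟩ : ∃ z, E.d k ≫ z = D.b k ≫ h := by
      rcases k with _ | k
      · exact hφ _ _ h1
      · exact (hE.1 k (by omega)).2 _ _ (by rw [← D.b_d_comp, hh, comp_zero])
    obtain ⟨x, hx⟩ := (hP.1 k (by omega)).2 _ (φ.app (k + 1) ≫ z - D.a (k + 1) ≫ h) (by
      rw [Preadditive.comp_sub, ← Category.assoc, φ.comm k (by omega), Category.assoc, hz, h1,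
        sub_self])
    exact ⟨z, x, hz.symm, by rw [hx]; abel⟩
  refine X.isNCokernel_splice m _ (fun k hk => ⟨D.isComplex (m := m + 1) hPc hEc (by omega) k
    (by omega), fun W h hh => ?_⟩) ⟨D.d_top m (by omega) fun k hk => hEc k (by omega),
    fun W h hh => ?_⟩ ⟨fun {W} u v huv => ?_⟩
  · obtain ⟨z, x, h1, h2⟩ := step k hk.le h hh
    obtain ⟨g, rfl, rfl⟩ := D.exists_desc (k + 1) x z
    refine ⟨g, D.hom_ext k ?_ ?_⟩
    · rw [h2, D.a_d_comp]
    · rw [h1, D.b_d_comp]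
  · obtain ⟨z, x, h1, h2⟩ := step m le_rfl h hh
    refine ⟨z - E.d (m + 1) ≫ e ≫ x, D.hom_ext m ?_ ?_⟩
    · rw [h2, ← Category.assoc, D.a_top, Preadditive.comp_sub,
        ← Category.assoc (φ.app (m + 1)), ← φ.comm (m + 1) (by omega), Category.assoc,
        ← Category.assoc (φ.app (m + 2)), he, Category.id_comp]
      abel
    · rw [h1, ← Category.assoc, D.b_top, Preadditive.comp_sub,
        ← Category.assoc (E.d m), hEc m (by omega), zero_comp, sub_zero]
  · have := hP.2
    rw [← sub_eq_zero, ← Preadditive.comp_sub] at huv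
    have h1 : φ.app (m + 1) ≫ (u - v) = 0 := by
      rw [← D.a_top, Category.assoc, huv, comp_zero]
    have h2 : E.d m ≫ (u - v) = 0 := by
      rw [← D.b_top, Category.assoc, huv, comp_zero]
    obtain ⟨z, hz⟩ := (hE.1 m (by omega)).2 _ _ h2
    have h3 : φ.app (m + 2) ≫ z = 0 := by
      rw [← cancel_epi (P.d (m + 1)), ← Category.assoc, φ.comm (m + 1) (by omega), Category.assoc,
        hz, h1, comp_zero]
    rw [← sub_eq_zero, ← hz, ← Category.id_comp z, ← he', Category.assoc, h3, comp_zero, comp_zero]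

end ConeData

end

section

variable {C : Type u} [Category.{v} C] [Preadditive C]

/-- A description of a truncated mapping cone `V` of a ladder `φ : P ⟶ E` with `n + 1` squares:
`Vᵏ⁺¹ = Pᵏ⁺¹ ⊕ Eᵏ` for `k < n`, while `V⁰ = P⁰` and `Vⁿ⁺¹ = Eⁿ`. -/
structure TruncCone {n : ℕ} {P E : Seq C} (φ : SeqHom (n + 1) P E) (V : Seq C) where
  /-- the inclusions of the terms of `P` -/
  μ (k : ℕ) : P.obj k ⟶ V.obj k
  /-- the inclusions of the terms of `E` -/
  ν (k : ℕ) : E.obj k ⟶ V.obj (k + 1)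
  /-- the projections to the terms of `P` -/
  p (k : ℕ) : V.obj k ⟶ P.obj k
  /-- the projections to the terms of `E` -/
  q (k : ℕ) : V.obj (k + 1) ⟶ E.obj k
  μ_p (k : ℕ) : k ≤ n → μ k ≫ p k = 𝟙 _
  p_μ : p 0 ≫ μ 0 = 𝟙 _
  ν_q (k : ℕ) : k ≤ n → ν k ≫ q k = 𝟙 _
  q_ν : q n ≫ ν n = 𝟙 _
  ν_p (k : ℕ) : k < n → ν k ≫ p (k + 1) = 0
  μ_q (k : ℕ) : k < n → μ (k + 1) ≫ q k = 0
  total (k : ℕ) : k < n → p (k + 1) ≫ μ (k + 1) + q k ≫ ν k = 𝟙 _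
  μ_d (k : ℕ) : k < n → μ k ≫ V.d k = -(P.d k ≫ μ (k + 1)) + φ.app k ≫ ν k
  μ_d_top : μ n ≫ V.d n = φ.app n ≫ ν n
  ν_d (k : ℕ) : k < n → ν k ≫ V.d (k + 1) = E.d k ≫ ν (k + 1)

/-- Mapping cones of ladders can be truncated. -/
lemma ConeData.nonempty_truncCone {m : ℕ} {P E X : Seq C} {φ : SeqHom (m + 2) P E}
    (D : ConeData φ X) : Nonempty (TruncCone (n := m + 1) φ (D.trunc m)) := by
  obtain ⟨V, hV⟩ : ∃ V, V = D.trunc m := ⟨_, rfl⟩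
  obtain ⟨i, t, hi, ht⟩ : ∃ (i : ∀ k, k ≤ m + 1 → (V.obj k ≅ X.obj k))
      (t : V.obj (m + 2) ≅ E.obj (m + 1)),
      (∀ k (hk : k < m + 1), V.d k ≫ (i (k + 1) hk).hom = (i k hk.le).hom ≫ X.d k) ∧
      V.d (m + 1) ≫ t.hom = (i (m + 1) le_rfl).hom ≫ D.top m := by
    subst hV
    exact ⟨X.spliceIso m (D.top m), X.spliceTop m (D.top m), X.splice_d m _, X.splice_d_top m _⟩
  rw [← hV]
  have hi' : ∀ k (hk : k < m + 1), (i k hk.le).inv ≫ V.d k = X.d k ≫ (i (k + 1) hk).inv :=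
    fun k hk => by
      rw [Iso.eq_comp_inv, Category.assoc, hi, Iso.inv_hom_id_assoc]
  have ht' : (i (m + 1) le_rfl).inv ≫ V.d (m + 1) = D.top m ≫ t.inv := by
    rw [Iso.eq_comp_inv, Category.assoc, ht, Iso.inv_hom_id_assoc]
  obtain ⟨μ, hμ, -⟩ := exists_family (O := fun k => P.obj k ⟶ V.obj k) (m + 2)
    (fun k hk => D.a k ≫ (i k (by omega)).inv) 0
  obtain ⟨ν, hν, hν'⟩ := exists_family (O := fun k => E.obj k ⟶ V.obj (k + 1)) (m + 1)
    (fun k hk => D.b k ≫ (i (k + 1) (by omega)).inv) t.inv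
  obtain ⟨p, hp, -⟩ := exists_family (O := fun k => V.obj k ⟶ P.obj k) (m + 2)
    (fun k hk => (i k (by omega)).hom ≫ D.p k) 0
  obtain ⟨q, hq, hq'⟩ := exists_family (O := fun k => V.obj (k + 1) ⟶ E.obj k) (m + 1)
    (fun k hk => (i (k + 1) (by omega)).hom ≫ D.q k) t.hom
  refine ⟨⟨μ, ν, p, q, fun k hk => ?_, ?_, fun k hk => ?_, ?_, fun k hk => ?_, fun k hk => ?_,
    fun k hk => ?_, fun k hk => ?_, ?_, fun k hk => ?_⟩⟩
  · rw [hμ k (by omega), hp k (by omega), Category.assoc, Iso.inv_hom_id_assoc, D.a_p]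
  · rw [hμ 0 (by omega), hp 0 (by omega), Category.assoc, ← Category.assoc (D.p 0), D.p_a,
      Category.id_comp, Iso.hom_inv_id]
  · rcases hk.eq_or_lt with rfl | hk
    · rw [hν', hq', Iso.inv_hom_id]
    · rw [hν k hk, hq k hk, Category.assoc, Iso.inv_hom_id_assoc, D.b_q]
  · rw [hν', hq', Iso.hom_inv_id]
  · rw [hν k hk, hp (k + 1) (by omega), Category.assoc, Iso.inv_hom_id_assoc, D.b_p]
  · rw [hq k hk, hμ (k + 1) (by omega), Category.assoc, Iso.inv_hom_id_assoc, D.a_q]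
  · rw [hq k hk, hν k hk, hp (k + 1) (by omega), hμ (k + 1) (by omega), Category.assoc,
      Category.assoc, ← Preadditive.comp_add, ← Category.assoc (D.p (k + 1)),
      ← Category.assoc (D.q k), ← Preadditive.add_comp, D.total, Category.id_comp,
      Iso.hom_inv_id]
  · rw [hμ k (by omega), hμ (k + 1) (by omega), hν k hk, Category.assoc, hi' k hk,
      ← Category.assoc, D.a_d, Preadditive.add_comp, Preadditive.neg_comp, Category.assoc,
      Category.assoc]
  · rw [hμ (m + 1) (by omega), hν', Category.assoc, ht', ← Category.assoc, D.a_top]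
  · rw [hν k hk, Category.assoc]
    rcases (Nat.lt_succ_iff.1 hk).eq_or_lt with rfl | hk
    · rw [hν', ht', ← Category.assoc, D.b_top]
    · rw [hν (k + 1) (by omega), hi' (k + 1) (by omega), ← Category.assoc, D.b_d, Category.assoc]

namespace TruncCone

variable {n : ℕ} {P E V : Seq C} {φ : SeqHom (n + 1) P E}

lemma hom_ext (K : TruncCone φ V) {k : ℕ} (hk : k < n) {W : C} {h h' : V.obj (k + 1) ⟶ W}
    (h1 : K.μ (k + 1) ≫ h = K.μ (k + 1) ≫ h') (h2 : K.ν k ≫ h = K.ν k ≫ h') : h = h' := by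
  rw [← Category.id_comp h, ← Category.id_comp h', ← K.total k hk, Preadditive.add_comp,
    Preadditive.add_comp, Category.assoc, Category.assoc, h1, h2, Category.assoc, Category.assoc]

lemma hom_ext_zero (K : TruncCone φ V) {W : C} {h h' : V.obj 0 ⟶ W}
    (h1 : K.μ 0 ≫ h = K.μ 0 ≫ h') : h = h' := by
  rw [← Category.id_comp h, ← Category.id_comp h', ← K.p_μ, Category.assoc, Category.assoc, h1]

/-- The morphism on a term of a truncated mapping cone with given components. -/
lemma exists_desc (K : TruncCone φ V) {k : ℕ} (hk : k < n) {W : C} (x : P.obj (k + 1) ⟶ W)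
    (y : E.obj k ⟶ W) :
    ∃ h : V.obj (k + 1) ⟶ W, K.μ (k + 1) ≫ h = x ∧ K.ν k ≫ h = y := by
  refine ⟨K.p (k + 1) ≫ x + K.q k ≫ y, ?_, ?_⟩
  · rw [Preadditive.comp_add, ← Category.assoc, K.μ_p _ hk, ← Category.assoc, K.μ_q _ hk,
      zero_comp, Category.id_comp, add_zero]
  · rw [Preadditive.comp_add, ← Category.assoc, K.ν_p _ hk, ← Category.assoc, K.ν_q _ hk.le,
      zero_comp, Category.id_comp, zero_add]

lemma μ_d_comp (K : TruncCone φ V) {k : ℕ} (hk : k < n) {W : C} (h : V.obj (k + 1) ⟶ W) :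
    K.μ k ≫ V.d k ≫ h = -(P.d k ≫ K.μ (k + 1) ≫ h) + φ.app k ≫ K.ν k ≫ h := by
  rw [← Category.assoc, K.μ_d k hk, Preadditive.add_comp, Preadditive.neg_comp, Category.assoc,
    Category.assoc]

lemma ν_d_comp (K : TruncCone φ V) {k : ℕ} (hk : k < n) {W : C} (h : V.obj (k + 2) ⟶ W) :
    K.ν k ≫ V.d (k + 1) ≫ h = E.d k ≫ K.ν (k + 1) ≫ h := by
  rw [← Category.assoc, K.ν_d k hk, Category.assoc]

/-- The projection of a truncated mapping cone to the upper row, with components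
`(-1)ᵏ : Pᵏ ⊕ Eᵏ⁻¹ ⟶ Pᵏ`; it extends to the last term if the last component of the ladder is split
by `e`. -/
lemma exists_proj (K : TruncCone φ V) (hE : E.IsComplex n) (e : E.obj (n + 1) ⟶ P.obj (n + 1))
    (he : φ.app (n + 1) ≫ e = 𝟙 _) : ∃ π : SeqHom (n + 1) V P, π.app 0 = K.p 0 ∧
      K.ν n ≫ π.app (n + 1) = (-1 : ℤ) ^ n • (E.d n ≫ e) := by
  obtain ⟨π, hπ, hπ'⟩ := exists_family (O := fun k => V.obj k ⟶ P.obj k) (n + 1)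
    (fun k _ => (-1 : ℤ) ^ k • K.p k) (K.q n ≫ ((-1 : ℤ) ^ n • (E.d n ≫ e)))
  refine ⟨⟨π, fun k hk => ?_⟩, ?_, ?_⟩
  · -- the square on the summand `Pᵏ`, followed by the one on the summand `Eᵏ⁻¹`
    have h1 : K.μ k ≫ V.d k ≫ π (k + 1) = K.μ k ≫ π k ≫ P.d k := by
      rcases (Nat.lt_succ_iff.1 hk).eq_or_lt with rfl | hlt
      · rw [hπ', hπ k (by omega), ← Category.assoc, K.μ_d_top, Category.assoc,
          ← Category.assoc (K.ν k), K.ν_q k le_rfl, Category.id_comp, Preadditive.comp_zsmul,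
          ← Category.assoc, ← φ.comm k (by omega), Category.assoc, he, Category.comp_id,
          ← Category.assoc, Preadditive.comp_zsmul, K.μ_p k le_rfl, Preadditive.zsmul_comp,
          Category.id_comp]
      · rw [K.μ_d_comp hlt, hπ k (by omega), hπ (k + 1) (by omega), Preadditive.comp_zsmul,
          K.μ_p _ hlt, Preadditive.comp_zsmul (K.ν k), K.ν_p k hlt, smul_zero, comp_zero,
          add_zero, Preadditive.comp_zsmul (P.d k), Category.comp_id, Preadditive.zsmul_comp,
          Preadditive.comp_zsmul (K.μ k), ← Category.assoc, K.μ_p k hlt.le, Category.id_comp,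
          pow_succ, mul_neg, mul_one, neg_smul, neg_neg]
    rcases k with _ | k
    · exact K.hom_ext_zero h1
    · refine K.hom_ext (by omega) h1 ?_
      rw [hπ (k + 1) (by omega), Preadditive.zsmul_comp, Preadditive.comp_zsmul,
        ← Category.assoc (K.ν k) (K.p (k + 1)), K.ν_p k (by omega), zero_comp, smul_zero,
        K.ν_d_comp (by omega)]
      rcases (Nat.lt_succ_iff.1 hk).eq_or_lt with rfl | hlt
      · rw [hπ', ← Category.assoc (K.ν (k + 1)), K.ν_q _ le_rfl, Category.id_comp,
          Preadditive.comp_zsmul, ← Category.assoc, hE k (by omega), zero_comp, smul_zero]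
      · rw [hπ (k + 2) (by omega), Preadditive.comp_zsmul, K.ν_p _ hlt, smul_zero, comp_zero]
  · change π 0 = _
    rw [hπ 0 (by omega), pow_zero, one_smul]
  · change K.ν n ≫ π (n + 1) = _
    rw [hπ', ← Category.assoc, K.ν_q n le_rfl, Category.id_comp]

lemma first_square (K : TruncCone φ V) (hn : 0 < n) {F : Seq C} (Λ : SeqHom (n + 1) V F) :
    φ.app 0 ≫ K.ν 0 ≫ Λ.app 1 - (K.μ 0 ≫ Λ.app 0) ≫ F.d 0 = P.d 0 ≫ K.μ 1 ≫ Λ.app 1 := by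
  rw [Category.assoc, ← Λ.comm 0 (by omega), K.μ_d_comp hn]
  abel

/-- Two ways to map the last term of `E` to the last term of a resolution of the first term of `F`
agree up to a morphism that factors through the last morphism of this resolution. -/
lemma exists_last_square (K : TruncCone φ V) (hV : IsNCokernel n V) (hE : E.IsComplex n)
    (e : E.obj (n + 1) ⟶ P.obj (n + 1)) (he : φ.app (n + 1) ≫ e = 𝟙 _) {F R : Seq C}
    (hR : R.IsComplex n) (Λ : SeqHom (n + 1) V F) (θ : SeqHom (n + 1) F R)
    (σ : SeqHom (n + 1) P R) (hσ : σ.app 0 = (K.μ 0 ≫ Λ.app 0) ≫ θ.app 0) :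
    ∃ h, (E.d n ≫ e) ≫ σ.app (n + 1) -
      (K.ν n ≫ Λ.app (n + 1)) ≫ ((-1 : ℤ) ^ n • θ.app (n + 1)) = h ≫ R.d n := by
  obtain ⟨π, hπ, hπ'⟩ := K.exists_proj hE e he
  obtain ⟨h, hh⟩ := exists_last_sub hV hR (π.comp σ) (Λ.comp θ) (by
    change π.app 0 ≫ σ.app 0 = Λ.app 0 ≫ θ.app 0
    rw [hπ, hσ, Category.assoc, ← Category.assoc (K.p 0), K.p_μ, Category.id_comp])
  change _ = π.app (n + 1) ≫ σ.app (n + 1) - Λ.app (n + 1) ≫ θ.app (n + 1) at hh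
  refine ⟨(-1 : ℤ) ^ n • (K.ν n ≫ h), ?_⟩
  rw [Preadditive.zsmul_comp, Category.assoc (K.ν n) h, hh, Preadditive.comp_sub,
    ← Category.assoc (K.ν n) (π.app _), hπ', Preadditive.zsmul_comp, smul_sub, smul_smul,
    neg_one_pow_mul_self, one_smul, Preadditive.comp_zsmul, Category.assoc (K.ν n)]

end TruncCone

end

namespace NExactStructure

variable {n : ℕ} {M : Type u} [Category.{v} M] [Preadditive M] [HasZeroObject M]
  [HasBinaryBiproducts M] {𝒳 : NExactStructure n M} {I : ∀ A : M, 𝒳.InjRes A}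

lemma FactorsInj.exists_extension {A B Z : M} {f : A ⟶ B} (hf : 𝒳.AdmMono f) {x : A ⟶ Z}
    (hx : 𝒳.FactorsInj x) : ∃ y, f ≫ y = x := by
  obtain ⟨J, hJ, a, b, rfl⟩ := hx
  obtain ⟨c, hc⟩ := hJ f hf a
  exact ⟨c ≫ b, by rw [← Category.assoc, hc]⟩

/-- The truncated mapping cone of the ladder of a standard angle consists of weak cokernels. -/
lemma StandardData.exists_truncCone (hn : 0 < n) (h𝒳 : 𝒳.IsFrobenius) (D : StandardData I) :
    ∃ V : Seq M, Nonempty (TruncCone D.φ V) ∧ IsNCokernel n V := by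
  have hex := exact_angle hn h𝒳 D
  obtain ⟨m, rfl⟩ : ∃ m, n = m + 1 := ⟨n - 1, by omega⟩
  refine ⟨(coneSeqData D.φ).trunc m, (coneSeqData D.φ).nonempty_truncCone,
    (coneSeqData D.φ).isNCokernel_trunc (I D.A).isNExactSeq.2 (𝒳.isNExactSeq _ D.adm).2 D.e.hom
      D.φ_last ?_ fun {W} x y hxy => ?_⟩
  · obtain ⟨w, hw⟩ : ∃ w : (I D.A).cosyzygy ⟶ D.E.obj (m + 2), D.φ.app (m + 2) = w := ⟨_, rfl⟩
    have h := D.φ_last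
    rw [hw] at h ⊢
    change D.e.hom ≫ w = 𝟙 _
    rw [← cancel_mono D.e.hom, Category.assoc]
    refine (congrArg (D.e.hom ≫ ·) h).trans ?_
    exact (Category.comp_id _).trans (Category.id_comp _).symm
  · obtain ⟨z, hz⟩ := (hex.1 0 hn).2 (𝒳.Q.obj W) (𝒳.Q.map y) (by
      refine (𝒳.Q.map_comp _ _).symm.trans ((Q_map_eq_zero_iff _).2 ?_)
      exact hxy.symm ▸ (FactorsInj.comp_of_inj ((I D.A).inj_seq 1 le_rfl hn) _ x))
    obtain ⟨z, rfl⟩ := exists_Q_map (A := D.E.obj 1) (B := W) z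
    have h1 : 𝒳.Q.map y = 𝒳.Q.map (D.E.d 0 ≫ z) := hz.symm.trans (𝒳.Q.map_comp _ _).symm
    obtain ⟨y', hy'⟩ := ((Q_map_eq_iff _ _ _).1 h1).exists_extension ⟨D.E, D.adm, rfl⟩
    exact ⟨z + y', by rw [Preadditive.comp_add, hy', add_sub_cancel]⟩

/-- A ladder from the truncated mapping cone of the ladder of a standard angle induces a morphism
from this standard angle. -/
lemma StandardData.exists_hom_of_ladder (hn : 0 < n) (D : StandardData I) {V F : Seq M}
    (K : TruncCone D.φ V) (hV : IsNCokernel n V) (θ : SeqHom (n + 1) F (I (F.obj 0)).seq)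
    (hθ : θ.app 0 = 𝟙 (F.obj 0)) (Λ : SeqHom (n + 1) V F) :
    ∃ f : SuspSeq.Hom (D.angle hn) (angleOf hn I F (θ.app (n + 1))),
      f.app 0 = 𝒳.Q.map (K.μ 0 ≫ Λ.app 0) ∧
      ∀ k, f.app (k + 1) = 𝒳.Q.map (K.ν k ≫ Λ.app (k + 1)) := by
  obtain ⟨σ, hσ⟩ := (I D.A).exists_ladder_of_first (I (F.obj 0)).adm
    ((I (F.obj 0)).inj_seq 1 le_rfl hn) (K.μ 0 ≫ Λ.app 0)
  obtain ⟨h, hh⟩ := K.exists_last_square hV (𝒳.isNExactSeq _ D.adm).isComplex D.e.hom D.φ_last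
    (I (F.obj 0)).isNExactSeq.isComplex Λ θ σ
    (hσ.trans ((Category.comp_id _).symm.trans (congrArg (_ ≫ ·) hθ.symm)))
  refine ⟨⟨⟨fun | 0 => 𝒳.Q.map (K.μ 0 ≫ Λ.app 0) | k + 1 => 𝒳.Q.map (K.ν k ≫ Λ.app (k + 1)),
    fun k hk => ?_⟩, ?_⟩, rfl, fun k => rfl⟩
  · rcases k with _ | k
    · refine (𝒳.Q.map_comp _ _).symm.trans (((Q_map_eq_iff _ _ _).2 ?_).trans (𝒳.Q.map_comp _ _))
      exact (K.first_square hn Λ).symm ▸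
        FactorsInj.comp_of_inj ((I D.A).inj_seq 1 le_rfl hn) ((I D.A).seq.d 0) (K.μ 1 ≫ Λ.app 1)
    · refine (𝒳.Q.map_comp _ _).symm.trans ((congrArg 𝒳.Q.map ?_).trans (𝒳.Q.map_comp _ _))
      refine (K.ν_d_comp (by omega) _).symm.trans ?_
      rw [Λ.comm (k + 1) (by omega)]
      exact (Category.assoc _ _ _).symm
  · refine (congrArg (_ ≫ ·) (suspension_map hn I _ ⟨σ, hσ, rfl⟩)).trans ?_
    refine (𝒳.Q.map_comp _ _).symm.trans (((Q_map_eq_iff _ _ _).2 ?_).trans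
      ((𝒳.Q.map_comp _ _).trans (congrArg (_ ≫ ·) (𝒳.Q.map_zsmul))))
    exact hh ▸ FactorsInj.comp_of_inj ((I (F.obj 0)).inj_seq n hn le_rfl) h _

end NExactStructure

/-! ### Standard angles on a given morphism -/

lemma arrow_comp_eqToHom {C : Type u} [Category.{v} C] {A B B' : C} (f : A ⟶ B) (h : B = B') :
    Arrow.mk (f ≫ eqToHom h) = Arrow.mk f := by
  subst h
  rw [eqToHom_refl, Category.comp_id]

section

variable {C : Type u} [Category.{v} C] [Preadditive C]

namespace ConeData

variable {N m : ℕ} {P E X : Seq C} {φ : SeqHom N P E}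

/-- The lower row of a ladder consists of weak cokernels if the upper row and the mapping cone
do. -/
lemma isWeakCokernel_lower (D : ConeData φ X) {k : ℕ} (hk : k < N) (hP : P.WeakCokernels (k + 1))
    (hd : E.d k ≫ E.d (k + 1) = 0)
    (h : (∃ Z g, IsWeakCokernel (X.d (k + 1)) g ∧
      ∃ z : E.obj (k + 2) ⟶ Z, D.b (k + 1) ≫ g = E.d (k + 1) ≫ z)) :
    IsWeakCokernel (E.d k) (E.d (k + 1)) := by
  obtain ⟨Z, g, hg, z, hz⟩ := h
  refine ⟨hd, fun W h hh => ?_⟩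
  obtain ⟨x, hx⟩ := (hP k (by omega)).2 W (φ.app (k + 1) ≫ h) (by
    rw [← Category.assoc, φ.comm k hk, Category.assoc, hh, comp_zero])
  obtain ⟨f, hf1, hf2⟩ := D.exists_desc (k + 1) x h
  obtain ⟨r, hr⟩ := hg.2 W f (D.hom_ext k
    (by rw [D.a_d_comp, hf1, hf2, hx, comp_zero, neg_add_cancel])
    (by rw [D.b_d_comp, hf2, hh, comp_zero]))
  exact ⟨z ≫ r, by rw [← Category.assoc, ← hz, Category.assoc, hr, hf2]⟩

/-- Let the mapping cone of a ladder from `P⁰ ⟶ ⋯ ⟶ Pᵐ⁺¹` to `E⁰ ⟶ ⋯ ⟶ Eᵐ⁺¹` have the cokernel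
property. If `P⁰ ⟶ ⋯ ⟶ Pᵐ⁺¹ ⟶ Pᵐ⁺²` has the cokernel property, then the lower row has an extension
`E⁰ ⟶ ⋯ ⟶ Eᵐ⁺¹ ⟶ Pᵐ⁺²` with the cokernel property. -/
lemma exists_isNCokernel_lower (D : ConeData φ X) (hm : m < N) (hP : IsNCokernel (m + 1) P)
    (hX : X.WeakCokernels m) (ht : IsWeakCokernel (X.d m) (D.top m)) (ht' : Epi (D.top m)) :
    ∃ t : E.obj (m + 1) ⟶ P.obj (m + 2), φ.app (m + 1) ≫ t = P.d (m + 1) ∧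
      IsNCokernel (m + 1) (E.splice m t) := by
  have hPc : P.IsComplex (m + 1) := Seq.WeakCokernels.isComplex hP.1
  obtain ⟨f, hf1, hf2⟩ := D.exists_desc m (P.d (m + 1)) (0 : E.obj m ⟶ P.obj (m + 2))
  obtain ⟨t, htf⟩ := ht.2 _ f (by
    have h1 : D.a m ≫ X.d m ≫ f = 0 := by
      rw [D.a_d_comp, hf1, hf2, hPc m (by omega), neg_zero, comp_zero, add_zero]
    rcases m with _ | m
    · exact D.hom_ext_zero (h1.trans comp_zero.symm)
    · exact D.hom_ext m (h1.trans comp_zero.symm) (by rw [D.b_d_comp, hf2, comp_zero, comp_zero]))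
  have ht1 : φ.app (m + 1) ≫ t = P.d (m + 1) := by rw [← D.a_top, Category.assoc, htf, hf1]
  have ht2 : E.d m ≫ t = 0 := by rw [← D.b_top, Category.assoc, htf, hf2]
  have hE : E.IsComplex m := fun k hk => by
    rcases (Nat.succ_le_of_lt hk).eq_or_lt with rfl | hlt
    · rw [← D.b_top (k + 1), ← Category.assoc, ← D.b_d, Category.assoc, ht.1, comp_zero]
    · rw [← Category.comp_id (E.d (k + 1)), ← D.b_q, ← Category.assoc (E.d (k + 1)), ← D.b_d,
        ← Category.assoc, ← Category.assoc, ← D.b_d, Category.assoc (D.b k), (hX _ hlt).1,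
        comp_zero, zero_comp]
  refine ⟨t, ht1, E.isNCokernel_splice m t (fun k hk => ?_) ⟨ht2, fun W h hh => ?_⟩ ?_⟩
  · refine D.isWeakCokernel_lower (by omega) (fun j hj => hP.1 j (by omega)) (hE k hk) ?_
    rcases (Nat.succ_le_of_lt hk).eq_or_lt with rfl | hlt
    · exact ⟨_, _, ht, 𝟙 _, by rw [D.b_top, Category.comp_id]⟩
    · exact ⟨_, _, hX _ hlt, D.b (k + 2), D.b_d (k + 1)⟩
  · obtain ⟨x, hx⟩ := (hP.1 m (by omega)).2 W (φ.app (m + 1) ≫ h) (by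
      rw [← Category.assoc, φ.comm m hm, Category.assoc, hh, comp_zero])
    refine ⟨x, ?_⟩
    rw [← cancel_epi (D.top m), ← Category.assoc]
    refine D.hom_ext m ?_ ?_
    · rw [← Category.assoc, ← Category.assoc, D.a_top, ht1, hx, ← Category.assoc, D.a_top]
    · rw [← Category.assoc, ← Category.assoc, D.b_top, ht2, zero_comp, ← Category.assoc, D.b_top,
        hh]
  · have := hP.2
    exact epi_of_epi_fac ht1

end ConeData

/-- A ladder `P⁰ ⟶ ⋯ ⟶ Pᵐ⁺¹` to `E⁰ ⟶ ⋯ ⟶ Eᵐ⁺¹` extends to the spliced sequence. -/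
lemma SeqHom.exists_splice {m : ℕ} {P E : Seq C} (φ : SeqHom (m + 1) P E)
    {t : E.obj (m + 1) ⟶ P.obj (m + 2)} (ht : φ.app (m + 1) ≫ t = P.d (m + 1)) :
    ∃ ψ : SeqHom (m + 2) P (E.splice m t), ψ.app 0 = φ.app 0 ∧
      ψ.app (m + 2) ≫ (E.spliceTop m t).hom = 𝟙 _ := by
  obtain ⟨ψ, hψ, hψ'⟩ := exists_family (O := fun k => P.obj k ⟶ (E.splice m t).obj k) (m + 2)
    (fun k hk => φ.app k ≫ (E.spliceIso m t k (by omega)).inv) (E.spliceTop m t).inv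
  refine ⟨⟨ψ, fun k hk => ?_⟩, (hψ 0 (by omega)).trans (Category.comp_id _), ?_⟩
  · rw [hψ k hk]
    rcases (Nat.lt_succ_iff.1 hk).eq_or_lt with rfl | hlt
    · rw [hψ', ← cancel_mono (E.spliceTop m t).hom, Category.assoc, Category.assoc,
        Category.assoc, E.splice_d_top, Iso.inv_hom_id, Iso.inv_hom_id_assoc, ht,
        Category.comp_id]
    · rw [hψ (k + 1) (by omega), ← cancel_mono (E.spliceIso m t (k + 1) hlt).hom,
        Category.assoc, Category.assoc, Category.assoc, Category.assoc, E.splice_d,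
        Iso.inv_hom_id, Iso.inv_hom_id_assoc, Category.comp_id, φ.comm k hlt]
  · change ψ (m + 2) ≫ _ = _
    rw [hψ', Iso.inv_hom_id]

end

namespace NExactStructure

variable {n : ℕ} {M : Type u} [Category.{v} M] [Preadditive M] [HasZeroObject M]
  [HasBinaryBiproducts M] {𝒳 : NExactStructure n M} {I : ∀ A : M, 𝒳.InjRes A}

/-- A sequence with the cokernel property is admissible as soon as its first morphism is an
admissible monomorphism. -/
lemma adm_of_isNCokernel {E : Seq M} (hE : IsNCokernel n E) (h : 𝒳.AdmMono (E.d 0)) :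
    𝒳.adm E := by
  obtain ⟨Z, hZ, hZE⟩ := h
  have hZe := 𝒳.isNExactSeq _ hZ
  obtain ⟨i, j, hij⟩ : ∃ (i : Z.obj 0 ≅ E.obj 0) (j : Z.obj 1 ≅ E.obj 1),
      Z.d 0 ≫ j.hom = i.hom ≫ E.d 0 :=
    ⟨Arrow.leftFunc.mapIso (eqToIso hZE), Arrow.rightFunc.mapIso (eqToIso hZE),
      (eqToIso hZE).hom.w.symm⟩
  obtain ⟨u, hu, hu'⟩ := exists_ladder_of_first hZe.2.1 (Seq.WeakCokernels.isComplex hE.1)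
    i.hom j.hom hij
  obtain ⟨v, hv, -⟩ := exists_ladder_of_first hE.1 hZe.isComplex i.inv j.inv (by
    rw [Iso.comp_inv_eq, Category.assoc, hij, Iso.inv_hom_id_assoc])
  refine (𝒳.weakIso Z E hZe (hE.isNExactSeq hZe u v ?_) u (Or.inl ⟨0, Nat.zero_le n, ?_, ?_⟩)).1 hZ
  · rw [hv, hu, Iso.inv_hom_id]
  · rw [hu]
    infer_instance
  · rw [hu']
    infer_instance

/-- Every morphism is the first morphism of a standard angle: its lower row is a pushout of the
resolution of the source. -/
theorem exists_standardData (hn : 0 < n) (I : ∀ A : M, 𝒳.InjRes A) {A B : M} (f : A ⟶ B) :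
    ∃ D : StandardData I, Arrow.mk (show D.A ⟶ D.E.obj 0 from D.φ.app 0) = Arrow.mk f := by
  obtain ⟨m, rfl⟩ : ∃ m, n = m + 1 := ⟨n - 1, by omega⟩
  obtain ⟨Y, p, hpf, hp, hY⟩ := 𝒳.pushout (I A).seq (I A).adm f
  have hp2 := hp.2 m rfl
  have htop : (coneSeqData p).top m = biprod.desc (p.app (m + 1)) (Y.d m) :=
    biprod.desc_eq.symm
  rw [← htop] at hp2
  obtain ⟨t, ht, hE⟩ := (coneSeqData p).exists_isNCokernel_lower (by omega)
    (I A).isNExactSeq.2 (fun k hk => hp.1 k (by omega)) hp2.1 hp2.2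
  obtain ⟨ψ, hψ, hψ'⟩ := p.exists_splice ht
  obtain ⟨Z, hZ, hZY⟩ := hY
  exact ⟨⟨A, Y.splice m t, adm_of_isNCokernel hE
    ⟨Z, hZ, hZY.trans (arrow_comp_eqToHom _ (if_pos (Nat.zero_le m)).symm).symm⟩,
    Y.spliceTop m t, ψ, hψ'⟩, (congrArg Arrow.mk hψ).trans hpf⟩

end NExactStructure

/-! ### Morphisms from standard angles -/

section

variable {C : Type u} [Category.{v} C] [Preadditive C] {n : ℕ} {P E V : Seq C}
  {φ : SeqHom (n + 1) P E}

/-- A ladder from a truncated mapping cone to a complex, given by its first two components. -/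
lemma TruncCone.exists_ladder (K : TruncCone φ V) (hV : V.WeakCokernels n) (hn : 0 < n)
    {F : Seq C} (hF : F.IsComplex n) (a : P.obj 0 ⟶ F.obj 0) (b : E.obj 0 ⟶ F.obj 1)
    (w : P.obj 1 ⟶ F.obj 1) (hw : P.d 0 ≫ w = φ.app 0 ≫ b - a ≫ F.d 0) :
    ∃ Λ : SeqHom (n + 1) V F, K.μ 0 ≫ Λ.app 0 = a ∧ K.ν 0 ≫ Λ.app 1 = b := by
  obtain ⟨c, hc1, hc2⟩ := K.exists_desc hn w b
  obtain ⟨Λ, h0, h1⟩ := exists_ladder_of_first hV hF (K.p 0 ≫ a) c (K.hom_ext_zero (by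
    rw [K.μ_d_comp hn, hc1, hc2, hw, Category.assoc, ← Category.assoc (K.μ 0), K.μ_p 0 hn.le,
      Category.id_comp, neg_sub, sub_add_cancel]))
  exact ⟨Λ, by rw [h0, ← Category.assoc, K.μ_p 0 hn.le, Category.id_comp], by rw [h1, hc2]⟩

end

namespace NExactStructure

variable {n : ℕ} {M : Type u} [Category.{v} M] [Preadditive M] [HasZeroObject M]
  [HasBinaryBiproducts M] {𝒳 : NExactStructure n M} {I : ∀ A : M, 𝒳.InjRes A}

/-- If the middle terms of `P` are injective, then the terms `Pᵏ⁺¹ ⊕ Eᵏ` of the truncated mapping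
cone are stably isomorphic to those of `E`. -/
lemma _root_.NExact.TruncCone.isIso_Q_map_ν {P E V : Seq M} {φ : SeqHom (n + 1) P E}
    (K : TruncCone φ V) (hP : ∀ k, 1 ≤ k → k ≤ n → 𝒳.Inj (P.obj k)) (k : ℕ) (hk : k ≤ n) :
    IsIso (𝒳.Q.map (K.ν k)) := by
  refine ⟨𝒳.Q.map (K.q k), by rw [← 𝒳.Q.map_comp, K.ν_q k hk, 𝒳.Q.map_id], ?_⟩
  rw [← 𝒳.Q.map_comp, ← 𝒳.Q.map_id]
  rcases hk.eq_or_lt with rfl | hlt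
  · rw [K.q_ν]
  · rw [Q_map_eq_iff, ← K.total k hlt, sub_add_cancel_right]
    exact (FactorsInj.comp_of_inj (hP (k + 1) (by omega) (by omega)) _ _).neg

/-- A square that commutes in the stable category gives a ladder from the truncated mapping cone
in `M`: the failure of the square to commute factors through `A ⟶ I¹(A)` and is absorbed by the
component on `I¹(A)`. -/
lemma StandardData.exists_ladder (hn : 0 < n) (D : StandardData I) {V F : Seq M}
    (K : TruncCone D.φ V) (hV : V.WeakCokernels n) (hF : F.IsComplex n) (a : D.A ⟶ F.obj 0)
    (b : D.E.obj 0 ⟶ F.obj 1)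
    (hab : 𝒳.Q.map (D.φ.app 0 ≫ b) = 𝒳.Q.map (a ≫ F.d 0)) :
    ∃ Λ : SeqHom (n + 1) V F, K.μ 0 ≫ Λ.app 0 = a ∧ K.ν 0 ≫ Λ.app 1 = b := by
  obtain ⟨w, hw⟩ := ((Q_map_eq_iff 𝒳 _ _).1 hab).exists_extension (I D.A).admMono
  exact K.exists_ladder hV hn hF a b w hw

/-- A commutative square in the stable category extends to a morphism from a standard angle to the
sequence of the stable category that is given by a complex. -/
lemma StandardData.exists_hom_angleOf (hn : 0 < n) (h𝒳 : 𝒳.IsFrobenius) (D : StandardData I)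
    {F : Seq M} (hF : F.IsComplex n) (θ : SeqHom (n + 1) F (I (F.obj 0)).seq)
    (hθ : θ.app 0 = 𝟙 (F.obj 0)) (a : (D.angle hn).obj 0 ⟶ 𝒳.Q.obj (F.obj 0))
    (b : (D.angle hn).obj 1 ⟶ 𝒳.Q.obj (F.obj 1))
    (hab : (D.angle hn).d 0 ≫ b = a ≫ 𝒳.Q.map (F.d 0)) :
    ∃ f : SuspSeq.Hom (D.angle hn) (angleOf hn I F (θ.app (n + 1))),
      f.app 0 = a ∧ f.app 1 = b := by
  obtain ⟨V, ⟨K⟩, hV⟩ := D.exists_truncCone hn h𝒳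
  obtain ⟨a, rfl⟩ := exists_Q_map (A := D.A) (B := F.obj 0) a
  obtain ⟨b, rfl⟩ := exists_Q_map (A := D.E.obj 0) (B := F.obj 1) b
  obtain ⟨Λ, h0, h1⟩ := D.exists_ladder hn K hV.1 hF a b
    ((𝒳.Q.map_comp _ _).trans (hab.trans (𝒳.Q.map_comp _ _).symm))
  obtain ⟨f, hf0, hf⟩ := D.exists_hom_of_ladder hn K hV θ hθ Λ
  exact ⟨f, hf0.trans (congrArg 𝒳.Q.map h0), (hf 0).trans (congrArg 𝒳.Q.map h1)⟩

/-- Every standard angle is given by the truncated mapping cone of its ladder. -/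
theorem StandardData.exists_isIsomorphic_angleOf (hn : 0 < n) (h𝒳 : 𝒳.IsFrobenius)
    (D : StandardData I) : ∃ (V : Seq M) (θ : SeqHom (n + 1) V (I (V.obj 0)).seq),
      IsNCokernel n V ∧ θ.app 0 = 𝟙 (V.obj 0) ∧
      SuspSeq.IsIsomorphic (D.angle hn) (angleOf hn I V (θ.app (n + 1))) := by
  obtain ⟨V, ⟨K⟩, hV⟩ := D.exists_truncCone hn h𝒳
  obtain ⟨π, hπ, -⟩ := K.exists_proj (𝒳.isNExactSeq _ D.adm).isComplex D.e.hom D.φ_last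
  obtain ⟨σ, hσ⟩ := (I D.A).exists_ladder_of_first (I (V.obj 0)).adm
    ((I (V.obj 0)).inj_seq 1 le_rfl hn) (K.μ 0)
  have hθ : (π.comp σ).app 0 = 𝟙 (V.obj 0) := by
    change π.app 0 ≫ σ.app 0 = _
    rw [hπ, hσ]
    exact K.p_μ
  obtain ⟨f, hf0, hf⟩ := D.exists_hom_of_ladder hn K hV _ hθ
    ⟨fun k => 𝟙 (V.obj k), fun k _ => by simp⟩
  refine ⟨V, _, hV, hθ, f, fun k hk => ?_⟩
  rcases k with _ | k
  · rw [hf0]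
    have : IsIso (K.μ 0) := ⟨K.p 0, K.μ_p 0 hn.le, K.p_μ⟩
    exact inferInstanceAs (IsIso (𝒳.Q.map (K.μ 0 ≫ 𝟙 (V.obj 0))))
  · rw [hf k]
    have := K.isIso_Q_map_ν (fun j h1 h2 => (I D.A).inj_seq j h1 h2) k (by omega)
    exact (congrArg 𝒳.Q.map (Category.comp_id (K.ν k))).symm ▸ this

end NExactStructure

/-! ### Replacing terms of a sequence by stably isomorphic ones -/

section

variable {C : Type u} [Category.{v} C] [Preadditive C]

/-- The data for replacing the middle of `F⁰ ⟶ F¹ ⟶ F² ⟶ F³`, where `d : F¹ ⟶ F²`, by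
`F⁰ ⟶ Y ⟶ V ⟶ F³`. The object `F¹` is a retract of `Y` up to the morphism `d ≫ h`, and `V` is the
complement of the direct summand `(-d, f) : F¹ ⟶ F² ⊕ Y`, whose retraction is `[h, g]`. -/
structure Surgery {F₁ F₂ : C} (d : F₁ ⟶ F₂) (Y V : C) where
  /-- the replacement of the first object -/
  f : F₁ ⟶ Y
  /-- the morphism back, a retraction of `f` up to `d ≫ h` -/
  g : Y ⟶ F₁
  /-- the correction term -/
  h : F₂ ⟶ F₁
  /-- the first component of the inclusion of `V` into `F² ⊕ Y` -/
  i : V ⟶ F₂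
  /-- the second component of the inclusion of `V` into `F² ⊕ Y` -/
  j : V ⟶ Y
  /-- the first component of the projection of `F² ⊕ Y` to `V` -/
  p : F₂ ⟶ V
  /-- the second component of the projection of `F² ⊕ Y` to `V` -/
  q : Y ⟶ V
  f_g : f ≫ g = 𝟙 _ + d ≫ h
  total : i ≫ p + j ≫ q = 𝟙 _
  p_i : p ≫ i = 𝟙 _ + h ≫ d
  p_j : p ≫ j = -(h ≫ f)
  q_i : q ≫ i = g ≫ d
  q_j : q ≫ j = 𝟙 _ - g ≫ f
  d_p : d ≫ p = f ≫ q

namespace Surgery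

variable {F₀ F₁ F₂ F₃ F₄ Y V : C} {d₀ : F₀ ⟶ F₁} {d : F₁ ⟶ F₂} {d₂ : F₂ ⟶ F₃} {d₃ : F₃ ⟶ F₄}

/-- The image of surgery data under an additive functor. -/
def map {D : Type u} [Category.{v} D] [Preadditive D] (L : C ⥤ D) [L.Additive]
    (S : Surgery d Y V) : Surgery (L.map d) (L.obj Y) (L.obj V) where
  f := L.map S.f
  g := L.map S.g
  h := L.map S.h
  i := L.map S.i
  j := L.map S.j
  p := L.map S.p
  q := L.map S.q
  f_g := by rw [← L.map_comp, S.f_g, L.map_add, L.map_id, L.map_comp]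
  total := by rw [← L.map_comp, ← L.map_comp, ← L.map_add, S.total, L.map_id]
  p_i := by rw [← L.map_comp, S.p_i, L.map_add, L.map_id, L.map_comp]
  p_j := by rw [← L.map_comp, S.p_j, L.map_neg, L.map_comp]
  q_i := by rw [← L.map_comp, S.q_i, L.map_comp]
  q_j := by rw [← L.map_comp, S.q_j, L.map_sub, L.map_id, L.map_comp]
  d_p := by rw [← L.map_comp, S.d_p, L.map_comp]

lemma p_i_comp (S : Surgery d Y V) (h : d ≫ d₂ = 0) : S.p ≫ S.i ≫ d₂ = d₂ := by
  rw [← Category.assoc, S.p_i, Preadditive.add_comp, Category.id_comp, Category.assoc, h,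
    comp_zero, add_zero]

lemma comp_f_g (S : Surgery d Y V) (h : d₀ ≫ d = 0) : (d₀ ≫ S.f) ≫ S.g = d₀ := by
  rw [Category.assoc, S.f_g, Preadditive.comp_add, Category.comp_id, ← Category.assoc, h,
    zero_comp, add_zero]

lemma isWeakCokernel_first (S : Surgery d Y V) (h : IsWeakCokernel d₀ d) :
    IsWeakCokernel (d₀ ≫ S.f) S.q := by
  refine ⟨by rw [Category.assoc, ← S.d_p, ← Category.assoc, h.1, zero_comp], fun W x hx => ?_⟩
  obtain ⟨z, hz⟩ := h.2 W (S.f ≫ x) (by rw [← Category.assoc, hx])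
  refine ⟨S.i ≫ z + S.j ≫ x, ?_⟩
  rw [Preadditive.comp_add, ← Category.assoc, ← Category.assoc, S.q_i, S.q_j, Category.assoc, hz,
    Preadditive.sub_comp, Category.id_comp, Category.assoc, add_sub_cancel]

lemma isWeakCokernel_second (S : Surgery d Y V) (h : IsWeakCokernel d d₂) :
    IsWeakCokernel S.q (S.i ≫ d₂) := by
  refine ⟨by rw [← Category.assoc, S.q_i, Category.assoc, h.1, comp_zero], fun W x hx => ?_⟩
  obtain ⟨z, hz⟩ := h.2 W (S.p ≫ x) (by
    rw [← Category.assoc, S.d_p, Category.assoc, hx, comp_zero])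
  have hx' : S.i ≫ S.p ≫ x = x := by
    rw [← add_zero (S.i ≫ S.p ≫ x), ← comp_zero (f := S.j), ← hx, ← Category.assoc,
      ← Category.assoc S.j, ← Preadditive.add_comp, S.total, Category.id_comp]
  exact ⟨z, by rw [Category.assoc, hz, hx']⟩

lemma isWeakCokernel_third (S : Surgery d Y V) (hd : d ≫ d₂ = 0) (h : IsWeakCokernel d₂ d₃) :
    IsWeakCokernel (S.i ≫ d₂) d₃ := by
  refine ⟨by rw [Category.assoc, h.1, comp_zero], fun W x hx => h.2 W x ?_⟩
  rw [← S.p_i_comp hd, Category.assoc, hx, comp_zero]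

lemma epi_third (S : Surgery d Y V) (hd : d ≫ d₂ = 0) (h : Epi d₂) : Epi (S.i ≫ d₂) :=
  epi_of_epi_fac (S.p_i_comp hd)

lemma isWeakKernel_first (S : Surgery d Y V) (h : IsWeakKernel d₀ d) :
    IsWeakKernel (d₀ ≫ S.f) S.q := by
  refine ⟨by rw [Category.assoc, ← S.d_p, ← Category.assoc, h.1, zero_comp], fun W x hx => ?_⟩
  obtain ⟨z, hz⟩ := h.2 W (x ≫ S.g) (by
    rw [Category.assoc, ← S.q_i, ← Category.assoc, hx, zero_comp])
  have h2 : x ≫ S.q ≫ S.j = 0 := by rw [← Category.assoc, hx, zero_comp]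
  rw [S.q_j, Preadditive.comp_sub, Category.comp_id, sub_eq_zero] at h2
  exact ⟨z, by rw [← Category.assoc, hz, Category.assoc, ← h2]⟩

lemma isWeakKernel_second (S : Surgery d Y V) (h : IsWeakKernel d d₂) :
    IsWeakKernel S.q (S.i ≫ d₂) := by
  refine ⟨by rw [← Category.assoc, S.q_i, Category.assoc, h.1, comp_zero], fun W x hx => ?_⟩
  obtain ⟨z, hz⟩ := h.2 W (x ≫ S.i) (by rw [Category.assoc, hx])
  refine ⟨z ≫ S.f + x ≫ S.j, ?_⟩
  rw [Preadditive.add_comp, Category.assoc, ← S.d_p, ← Category.assoc, hz, Category.assoc,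
    Category.assoc, ← Preadditive.comp_add, S.total, Category.comp_id]

lemma isWeakKernel_third (S : Surgery d Y V) (hd : d ≫ d₂ = 0) (h : IsWeakKernel d₂ d₃) :
    IsWeakKernel (S.i ≫ d₂) d₃ := by
  refine ⟨by rw [Category.assoc, h.1, comp_zero], fun W x hx => ?_⟩
  obtain ⟨z, hz⟩ := h.2 W x hx
  exact ⟨z ≫ S.p, by rw [Category.assoc, S.p_i_comp hd, hz]⟩

/-- In idempotent complete categories, every choice of `f`, `g` and `h` with `f ≫ g = 𝟙 _ + d ≫ h`
is part of surgery data. -/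
lemma nonempty_of_isIdempotentComplete [HasBinaryBiproducts C] [IsIdempotentComplete C]
    (f : F₁ ⟶ Y) (g : Y ⟶ F₁) (h : F₂ ⟶ F₁) (hfg : f ≫ g = 𝟙 _ + d ≫ h) :
    ∃ (V : C) (S : Surgery d Y V), S.f = f ∧ S.g = g := by
  have hs : biprod.lift (-d) f ≫ biprod.desc h g = 𝟙 F₁ := by
    rw [biprod.lift_desc, hfg, Preadditive.neg_comp]
    abel
  obtain ⟨V, i, p, hip, hpi⟩ := IsIdempotentComplete.idempotents_split (F₂ ⊞ Y)
    (𝟙 _ - biprod.desc h g ≫ biprod.lift (-d) f) (by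
      have : (biprod.desc h g ≫ biprod.lift (-d) f) ≫ biprod.desc h g ≫ biprod.lift (-d) f =
          biprod.desc h g ≫ biprod.lift (-d) f := by
        rw [Category.assoc, ← Category.assoc (biprod.lift (-d) f), hs, Category.id_comp]
      rw [Preadditive.sub_comp, Preadditive.comp_sub, Preadditive.comp_sub, this,
        Category.id_comp, Category.comp_id, Category.id_comp, sub_self, sub_zero])
  have hd : biprod.lift (-d) f ≫ p = 0 := by
    rw [← Category.comp_id p, ← hip, ← Category.assoc p, hpi, ← Category.assoc,
      Preadditive.comp_sub, Category.comp_id, ← Category.assoc (biprod.lift (-d) f)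
      (biprod.desc h g), hs, Category.id_comp, sub_self, zero_comp]
  refine ⟨V, ⟨f, g, h, i ≫ biprod.fst, i ≫ biprod.snd, biprod.inl ≫ p, biprod.inr ≫ p, hfg,
    ?_, ?_, ?_, ?_, ?_, ?_⟩, rfl, rfl⟩
  · rw [Category.assoc, Category.assoc, ← Preadditive.comp_add, ← Category.assoc biprod.fst,
      ← Category.assoc biprod.snd, ← Preadditive.add_comp, biprod.total, Category.id_comp, hip]
  · rw [Category.assoc, ← Category.assoc p, hpi]
    simp
  · rw [Category.assoc, ← Category.assoc p, hpi]
    simp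
  · rw [Category.assoc, ← Category.assoc p, hpi]
    simp
  · rw [Category.assoc, ← Category.assoc p, hpi]
    simp
  · rw [biprod.lift_eq, Preadditive.add_comp, Preadditive.neg_comp, Preadditive.neg_comp,
      neg_add_eq_zero, Category.assoc, Category.assoc] at hd
    exact hd

end Surgery

/-- The image of a sequence under a functor. -/
abbrev Seq.map {D : Type u} [Category.{v} D] (L : C ⥤ D) (F : Seq C) : Seq D where
  obj k := L.obj (F.obj k)
  d k := L.map (F.d k)

variable [HasBinaryBiproducts C] {D : Type u} [Category.{v} D] [Preadditive D] (L : C ⥤ D)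
  [L.Additive] [L.Full] [L.EssSurj]

/-- Surgery data that replace `F¹` by a preimage of a given object `X`. -/
lemma Surgery.exists_of_map [IsIdempotentComplete C]
    (hL : ∀ {A B : C} (f : A ⟶ B), L.map f = 0 →
      ∃ (J : C) (u : A ⟶ J) (v : J ⟶ B), IsZero (L.obj J) ∧ u ≫ v = f)
    {F₁ F₂ : C} {d : F₁ ⟶ F₂} {X : D} (f : L.obj F₁ ⟶ X) (g : X ⟶ L.obj F₁)
    (h : L.obj F₂ ⟶ L.obj F₁) (hfg : f ≫ g = 𝟙 _ + L.map d ≫ h) :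
    ∃ (Y V : C) (S : Surgery d Y V) (y : L.obj Y ⟶ X), IsIso y ∧ L.map S.f ≫ y = f := by
  obtain ⟨f', hf'⟩ := L.map_surjective (f ≫ (L.objObjPreimageIso X).inv)
  obtain ⟨g', hg'⟩ := L.map_surjective ((L.objObjPreimageIso X).hom ≫ g)
  obtain ⟨h, rfl⟩ := L.map_surjective h
  obtain ⟨J, u, v, hJ, huv⟩ := hL (f' ≫ g' - (𝟙 _ + d ≫ h)) (by
    rw [L.map_sub, L.map_comp, hf', hg', L.map_add, L.map_id, L.map_comp, ← hfg]
    simp)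
  obtain ⟨V, S, hS, -⟩ := Surgery.nonempty_of_isIdempotentComplete (d := d)
    (biprod.lift f' u) (biprod.desc g' (-v)) h (by
      rw [biprod.lift_desc, Preadditive.comp_neg, huv]
      abel)
  refine ⟨_, V, S, L.map biprod.fst ≫ (L.objObjPreimageIso X).hom, ?_, ?_⟩
  · have : IsIso (L.map (biprod.fst : L.objPreimage X ⊞ J ⟶ _)) := by
      refine ⟨L.map biprod.inl, ?_, by rw [← L.map_comp, biprod.inl_fst, L.map_id]⟩
      have h1 : L.map (biprod.snd : L.objPreimage X ⊞ J ⟶ _) = 0 := hJ.eq_of_tgt _ _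
      rw [← L.map_comp, ← L.map_id, ← biprod.total, L.map_add, L.map_comp biprod.snd, h1,
        zero_comp, add_zero]
    infer_instance
  · rw [hS, ← Category.assoc, ← L.map_comp, biprod.lift_fst, hf', Category.assoc, Iso.inv_hom_id,
      Category.comp_id]

/-- Let `f` be a ladder from the image of `F` to a sequence `X` of weak cokernels, let `f⁰` be an
isomorphism, and let the first morphism of the image of `F` factor through `X⁰ ⟶ X¹` by means of
`f⁰`. Then `F` can be replaced by a sequence `G` whose image is isomorphic to `X` in all degrees up
to `N`, while the first and last terms stay the same. The terms are replaced one after the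
other. -/
theorem exists_replacement
    (hL : ∀ {A B : C} (f : A ⟶ B), L.map f = 0 →
      ∃ (J : C) (u : A ⟶ J) (v : J ⟶ B), IsZero (L.obj J) ∧ u ≫ v = f) :
    ∀ (N : ℕ) (_ : N = 0 ∨ IsIdempotentComplete C) (F : Seq C) (X : Seq D)
      (_ : F.WeakKernels (N + 1)) (_ : F.WeakCokernels (N + 1))
      (_ : (F.map L).WeakCokernels (N + 1)) (_ : X.WeakCokernels (N + 1))
      (f : SeqHom (N + 2) (F.map L) X) (_ : IsIso (f.app 0)) (g : X.obj 1 ⟶ L.obj (F.obj 1))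
      (_ : f.app 0 ≫ X.d 0 ≫ g = L.map (F.d 0)),
    ∃ (G : Seq C) (χ : SeqHom (N + 2) F G) (r : G.obj 1 ⟶ F.obj 1)
      (f' : SeqHom (N + 2) (G.map L) X),
      G.WeakKernels (N + 1) ∧ G.WeakCokernels (N + 1) ∧ (Epi (F.d (N + 1)) → Epi (G.d (N + 1))) ∧
      IsIso (χ.app 0) ∧ IsIso (χ.app (N + 2)) ∧ F.d 0 = χ.app 0 ≫ G.d 0 ≫ r ∧
      (∀ k, k ≤ N + 2 → L.map (χ.app k) ≫ f'.app k = f.app k) ∧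
      ∀ k, k ≤ N → IsIso (f'.app k) := by
  intro N
  induction N with
  | zero =>
    intro _ F X hF hF' _ _ f hf _ _
    refine ⟨F, ⟨fun _ => 𝟙 _, fun _ _ => by simp⟩, 𝟙 _, f, hF, hF', id,
      IsIso.id (F.obj 0), IsIso.id (F.obj 2), ?_,
      fun k _ => ?_, fun k hk => ?_⟩
    · change _ = 𝟙 _ ≫ _ ≫ 𝟙 _
      rw [Category.id_comp, Category.comp_id]
    · change L.map (𝟙 _) ≫ _ = _
      rw [L.map_id]
      exact Category.id_comp _
    · obtain rfl : k = 0 := by omega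
      exact hf
  | succ N ih =>
    intro hC F X hF hFw hLF hX f hf g hg
    have hC : IsIdempotentComplete C := hC.resolve_left (by omega)
    have hFc : F.IsComplex (N + 2) := hF.isComplex
    obtain ⟨f₀, hf₀⟩ : ∃ f₀ : L.obj (F.obj 0) ⟶ X.obj 0, f.app 0 = f₀ := ⟨_, rfl⟩
    obtain ⟨f₁, hf₁⟩ : ∃ f₁ : L.obj (F.obj 1) ⟶ X.obj 1, f.app 1 = f₁ := ⟨_, rfl⟩
    obtain ⟨f₂, hf₂⟩ : ∃ f₂ : L.obj (F.obj 2) ⟶ X.obj 2, f.app 2 = f₂ := ⟨_, rfl⟩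
    have e₀ : L.map (F.d 0) ≫ f₁ = f₀ ≫ X.d 0 := hf₁ ▸ hf₀ ▸ f.comm 0 (by omega)
    have e₁ : L.map (F.d 1) ≫ f₂ = f₁ ≫ X.d 1 := hf₁ ▸ hf₂ ▸ f.comm 1 (by omega)
    rw [hf₀] at hf hg
    have h0 : IsWeakCokernel (L.map (F.d 0)) (L.map (F.d 1)) := hLF 0 (by omega)
    obtain ⟨h, hh⟩ := h0.2 _ (f₁ ≫ g - 𝟙 _) (by
      rw [Preadditive.comp_sub, ← Category.assoc, e₀, Category.assoc, hg, Category.comp_id,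
        sub_self])
    obtain ⟨Y, V, S, y, hy, hSy⟩ := Surgery.exists_of_map L hL f₁ g h (by
      rw [hh, add_sub_cancel])
    -- the ladder from the new tail `Y ⟶ V ⟶ F³ ⟶ ⋯` to the tail of `X`
    let F' : Seq C := (F.tail.tail.tail.cons (S.i ≫ F.d 2)).cons S.q
    have hcomm1 : L.map S.q ≫ (L.map S.i ≫ f₂ + L.map S.j ≫ y ≫ X.d 1) = y ≫ X.d 1 := by
      rw [Preadditive.comp_add, ← Category.assoc, ← L.map_comp, S.q_i, L.map_comp, Category.assoc,
        e₁, ← hSy, ← Category.assoc (L.map S.q), ← L.map_comp, S.q_j, L.map_sub, L.map_id,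
        L.map_comp, Preadditive.sub_comp]
      simp only [Category.assoc, Category.id_comp, add_sub_cancel]
    have hcomm2 : L.map S.p ≫ (L.map S.i ≫ f₂ + L.map S.j ≫ y ≫ X.d 1) = f₂ := by
      rw [Preadditive.comp_add, ← Category.assoc, ← L.map_comp, S.p_i, L.map_add, L.map_id,
        L.map_comp, Preadditive.add_comp, Category.assoc, e₁, ← hSy, ← Category.assoc (L.map S.p),
        ← L.map_comp, S.p_j, L.map_neg, L.map_comp, Preadditive.neg_comp]
      simp only [Category.assoc, Category.id_comp, add_neg_cancel_right]
    have hcomm3 : (L.map S.i ≫ f₂ + L.map S.j ≫ y ≫ X.d 1) ≫ X.d 2 =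
        L.map (S.i ≫ F.d 2) ≫ f.app 3 := by
      have e₂ : L.map (F.d 2) ≫ f.app 3 = f₂ ≫ X.d 2 := hf₂ ▸ f.comm 2 (by omega)
      rw [Preadditive.add_comp, Category.assoc, Category.assoc, Category.assoc,
        (hX 1 (by omega)).1, comp_zero, comp_zero, add_zero, L.map_comp, Category.assoc, e₂]
    have hd₁ : F.d 1 ≫ F.d 2 = 0 := hFc 1 (by omega)
    have hLd₁ : L.map (F.d 1) ≫ L.map (F.d 2) = 0 := by rw [← L.map_comp, hd₁, L.map_zero]
    obtain ⟨g', hg'⟩ := (hX 0 (by omega)).2 _ (inv y ≫ L.map S.q) (by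
      rw [← cancel_epi f₀, ← Category.assoc, ← e₀, ← hSy, Category.assoc, Category.assoc,
        IsIso.hom_inv_id_assoc, ← L.map_comp, ← L.map_comp, ← S.d_p, ← Category.assoc,
        hFc 0 (by omega), zero_comp, L.map_zero, comp_zero])
    obtain ⟨G, χ, r, f', hG1, hG2, hG3, hχ0, hχ, hr, hχf, hf'⟩ := ih (Or.inr hC) F' X.tail
      (by
        rintro (_ | _ | k) hk
        · exact S.isWeakKernel_second (hF 1 (by omega))
        · exact S.isWeakKernel_third hd₁ (hF 2 (by omega))
        · exact hF (k + 3) (by omega))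
      (by
        rintro (_ | _ | k) hk
        · exact S.isWeakCokernel_second (hFw 1 (by omega))
        · exact S.isWeakCokernel_third hd₁ (hFw 2 (by omega))
        · exact hFw (k + 3) (by omega))
      (by
        rintro (_ | _ | k) hk
        · have := (S.map L).isWeakCokernel_second (hLF 1 (by omega))
          change IsWeakCokernel (L.map S.q) (L.map (S.i ≫ F.d 2))
          rw [L.map_comp]
          exact this
        · have := (S.map L).isWeakCokernel_third hLd₁ (hLF 2 (by omega))
          change IsWeakCokernel (L.map (S.i ≫ F.d 2)) (L.map (F.d 3))
          rw [L.map_comp]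
          exact this
        · exact hLF (k + 3) (by omega))
      (fun k hk => hX (k + 1) (by omega))
      ⟨fun
        | 0 => y
        | 1 => L.map S.i ≫ f₂ + L.map S.j ≫ y ≫ X.d 1
        | k + 2 => f.app (k + 3), by
        rintro (_ | _ | k) hk
        · exact hcomm1
        · exact hcomm3.symm
        · exact f.comm (k + 3) (by omega)⟩
      hy g' (by
        change y ≫ X.d 1 ≫ g' = L.map S.q
        rw [hg', IsIso.hom_inv_id_assoc])
    -- names with the right types for the relevant components of the ladders
    obtain ⟨χ₀, hχ₀⟩ : ∃ χ₀ : Y ⟶ G.obj 0, χ.app 0 = χ₀ := ⟨_, rfl⟩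
    obtain ⟨χ₁, hχ₁⟩ : ∃ χ₁ : V ⟶ G.obj 1, χ.app 1 = χ₁ := ⟨_, rfl⟩
    obtain ⟨χ₂, hχ₂⟩ : ∃ χ₂ : F.obj 3 ⟶ G.obj 2, χ.app 2 = χ₂ := ⟨_, rfl⟩
    obtain ⟨t₀, ht₀⟩ : ∃ t₀ : L.obj (G.obj 0) ⟶ X.obj 1, f'.app 0 = t₀ := ⟨_, rfl⟩
    obtain ⟨t₁, ht₁⟩ : ∃ t₁ : L.obj (G.obj 1) ⟶ X.obj 2, f'.app 1 = t₁ := ⟨_, rfl⟩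
    obtain ⟨r, hr⟩ : ∃ r' : G.obj 1 ⟶ V, S.q = χ₀ ≫ G.d 0 ≫ r' := ⟨r, hχ₀ ▸ hr⟩
    obtain ⟨ψ, hψ, hψ'⟩ : ∃ ψ : G.obj 0 ⟶ Y, χ₀ ≫ ψ = 𝟙 _ ∧ ψ ≫ χ₀ = 𝟙 _ := (hχ₀ ▸ hχ0).1
    have c0 : S.q ≫ χ₁ = χ₀ ≫ G.d 0 := hχ₀ ▸ hχ₁ ▸ χ.comm 0 (by omega)
    have c1 : (S.i ≫ F.d 2) ≫ χ₂ = χ₁ ≫ G.d 1 := hχ₁ ▸ hχ₂ ▸ χ.comm 1 (by omega)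
    have k0 : L.map χ₀ ≫ t₀ = y := hχ₀ ▸ ht₀ ▸ hχf 0 (by omega)
    have k1 : L.map χ₁ ≫ t₁ = L.map S.i ≫ f₂ + L.map S.j ≫ y ≫ X.d 1 :=
      hχ₁ ▸ ht₁ ▸ hχf 1 (by omega)
    have hq := S.isWeakCokernel_first (hFw 0 (by omega))
    have hq' := S.isWeakKernel_first (hF 0 (by omega))
    have hcomp : ((F.d 0 ≫ S.f) ≫ χ₀) ≫ G.d 0 = 0 := by
      rw [Category.assoc, ← c0, ← Category.assoc, hq.1, zero_comp]
    have hcoker : IsWeakCokernel ((F.d 0 ≫ S.f) ≫ χ₀) (G.d 0) := by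
      refine ⟨hcomp, fun W x hx => ?_⟩
      obtain ⟨z, hz⟩ := hq.2 W (χ₀ ≫ x) (by rw [← Category.assoc, hx])
      refine ⟨r ≫ z, ?_⟩
      rw [← Category.id_comp (G.d 0 ≫ r ≫ z), ← hψ', Category.assoc, ← Category.assoc (G.d 0),
        ← Category.assoc χ₀, ← hr, hz, ← Category.assoc, hψ', Category.id_comp]
    have hker : IsWeakKernel ((F.d 0 ≫ S.f) ≫ χ₀) (G.d 0) := by
      refine ⟨hcomp, fun W x hx => ?_⟩
      obtain ⟨z, hz⟩ := hq'.2 W (x ≫ ψ) (by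
        rw [hr, Category.assoc, ← Category.assoc ψ, hψ', Category.id_comp, ← Category.assoc, hx,
          zero_comp])
      refine ⟨z, ?_⟩
      rw [← Category.assoc, hz, Category.assoc, hψ', Category.comp_id]
    have c2 : F.d 1 ≫ S.p ≫ χ₁ = (S.f ≫ χ₀) ≫ G.d 0 := by
      rw [← Category.assoc, S.d_p, Category.assoc, c0, Category.assoc]
    have c3 : F.d 2 ≫ χ₂ = (S.p ≫ χ₁) ≫ G.d 1 := by
      rw [Category.assoc, ← c1, Category.assoc, ← Category.assoc S.i, ← Category.assoc S.p,
        S.p_i_comp hd₁]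
    have k2 : L.map ((F.d 0 ≫ S.f) ≫ χ₀) ≫ t₀ = f₀ ≫ X.d 0 := by
      rw [L.map_comp, L.map_comp, Category.assoc, Category.assoc, k0, hSy, e₀]
    have k3 : L.map (S.f ≫ χ₀) ≫ t₀ = f.app 1 := by
      rw [L.map_comp, Category.assoc, k0, hSy, hf₁]
    have k4 : L.map (S.p ≫ χ₁) ≫ t₁ = f.app 2 := by
      rw [L.map_comp, Category.assoc, k1, hcomm2, hf₂]
    have k5 : F.d 0 = 𝟙 _ ≫ ((F.d 0 ≫ S.f) ≫ χ₀) ≫ ψ ≫ S.g := by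
      rw [Category.id_comp, Category.assoc _ χ₀, ← Category.assoc χ₀, hψ, Category.id_comp,
        S.comp_f_g (hFc 0 (by omega))]
    refine ⟨G.cons ((F.d 0 ≫ S.f) ≫ χ₀), ⟨fun
        | 0 => 𝟙 _
        | 1 => S.f ≫ χ₀
        | 2 => S.p ≫ χ₁
        | k + 3 => χ.app (k + 2), ?_⟩, ψ ≫ S.g, ⟨fun
        | 0 => f₀
        | k + 1 => f'.app k, ?_⟩, ?_, ?_, ?_, IsIso.id (F.obj 0), hχ, k5, ?_, ?_⟩
    · rintro (_ | _ | _ | k) hk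
      · exact (Category.assoc _ _ _).symm.trans (Category.id_comp _).symm
      · exact c2
      · exact (congrArg (F.d 2 ≫ ·) hχ₂).trans c3
      · exact χ.comm (k + 2) (by omega)
    · rintro (_ | k) hk
      · exact (congrArg (L.map ((F.d 0 ≫ S.f) ≫ χ₀) ≫ ·) ht₀).trans k2
      · exact f'.comm k (by omega)
    · rintro (_ | k) hk
      · exact hker
      · exact hG1 k (by omega)
    · rintro (_ | k) hk
      · exact hcoker
      · exact hG2 k (by omega)
    · intro h
      refine hG3 ?_
      rcases N with _ | N
      · exact S.epi_third hd₁ h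
      · exact h
    · rintro (_ | _ | _ | k) hk
      · exact (congrArg (· ≫ f₀) (L.map_id _)).trans ((Category.id_comp _).trans hf₀.symm)
      · exact (congrArg (L.map (S.f ≫ χ₀) ≫ ·) ht₀).trans k3
      · exact (congrArg (L.map (S.p ≫ χ₁) ≫ ·) ht₁).trans k4
      · exact hχf (k + 2) (by omega)
    · rintro (_ | k) hk
      · exact hf
      · exact hf' k (by omega)

end

/-! ### Recognizing angles -/

section

variable {C : Type u} [Category.{v} C] [Preadditive C]

/-- A version of the five lemma for sequences of weak cokernels. -/
lemma isIso_of_isWeakCokernel {A B X D E A' B' X' D' E' : C} {f₁ : A ⟶ B} {f₂ : B ⟶ X}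
    {f₃ : X ⟶ D} {f₄ : D ⟶ E} {g₁ : A' ⟶ B'} {g₂ : B' ⟶ X'} {g₃ : X' ⟶ D'} {g₄ : D' ⟶ E'}
    (hf₁ : f₁ ≫ f₂ = 0) (hf₂ : IsWeakCokernel f₂ f₃) (hf₃ : IsWeakCokernel f₃ f₄)
    (hg₁ : IsWeakCokernel g₁ g₂) (hg₂ : IsWeakCokernel g₂ g₃) (hg₃ : g₃ ≫ g₄ = 0)
    {a : A ⟶ A'} {b : B ⟶ B'} {c : X ⟶ X'} {d : D ⟶ D'} {e : E ⟶ E'} (h₁ : f₁ ≫ b = a ≫ g₁)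
    (h₂ : f₂ ≫ c = b ≫ g₂) (h₃ : f₃ ≫ d = c ≫ g₃) (h₄ : f₄ ≫ e = d ≫ g₄) [IsIso a] [IsIso b]
    [IsIso d] [IsIso e] : IsIso c := by
  have : Epi c := Preadditive.epi_of_cancel_zero _ fun {W} x hx => by
    obtain ⟨y, rfl⟩ := hg₂.2 W x (by
      rw [← cancel_epi b, ← Category.assoc, ← h₂, Category.assoc, hx, comp_zero, comp_zero])
    obtain ⟨z, hz⟩ := hf₃.2 W (d ≫ y) (by rw [← Category.assoc, h₃, Category.assoc, hx])
    have : y = g₄ ≫ inv e ≫ z := by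
      rw [← cancel_epi d, ← hz, ← Category.assoc, ← h₄, Category.assoc, IsIso.hom_inv_id_assoc]
    rw [this, ← Category.assoc, hg₃, zero_comp]
  obtain ⟨s, hs⟩ := hg₁.2 X (inv b ≫ f₂) (by
    rw [← cancel_epi a, ← Category.assoc, ← h₁, Category.assoc, IsIso.hom_inv_id_assoc, hf₁,
      comp_zero])
  obtain ⟨y, hy⟩ := hf₂.2 X (c ≫ s - 𝟙 X) (by
    rw [Preadditive.comp_sub, ← Category.assoc, h₂, Category.assoc, hs, IsIso.hom_inv_id_assoc,
      Category.comp_id, sub_self])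
  have : IsSplitMono c := ⟨⟨⟨s - g₃ ≫ inv d ≫ y, by
    rw [Preadditive.comp_sub, ← Category.assoc c, ← h₃, Category.assoc, IsIso.hom_inv_id_assoc,
      hy, sub_sub_cancel]⟩⟩⟩
  exact isIso_of_epi_of_isSplitMono c

end

namespace SuspSeq

variable {n : ℕ} {F : Type u} [Category.{v} F] {T : F ⥤ F} [Preadditive F] {X Y : SuspSeq n T}

/-- A morphism between exact sequences whose components of index at most `n` are isomorphisms is an
isomorphism. -/
lemma Exact.isIso_last (hn : 0 < n) (hX : X.Exact) (hY : Y.Exact) (f : Hom X Y)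
    (hf : ∀ k, k ≤ n → IsIso (f.app k)) : IsIso (f.app (n + 1)) := by
  obtain ⟨m, rfl⟩ : ∃ m, n = m + 1 := ⟨n - 1, by omega⟩
  have := hf m (by omega)
  have := hf (m + 1) le_rfl
  have := hf 0 (by omega)
  have := hf 1 (by omega)
  exact isIso_of_isWeakCokernel (hX.1 m (by omega)).1 hX.2.1 hX.2.2 (hY.1 m (by omega)) hY.2.1
    hY.2.2.1 (f.comm m (by omega)) (f.comm (m + 1) (by omega)) f.comm_last
    (e := T.map (f.app 1)) (by rw [← T.map_comp, f.comm 0 (by omega), T.map_comp])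

lemma Exact.weakCokernels_rotate (hX : X.Exact) : X.rotate.WeakCokernels n := by
  intro k hk
  change IsWeakCokernel (X.extMap (k + 1)) (X.extMap (k + 2))
  rw [extMap_of_le _ _ (show k + 1 ≤ n by omega)]
  rcases (Nat.succ_le_of_lt hk).eq_or_lt with rfl | hlt
  · rw [extMap_last]
    exact hX.2.1.of_iso (X.extIso (k + 1) (by omega)).symm (X.extIso (k + 2) (by omega)).symm
      (X.extTop (k + 3) (by omega)).symm (by simp) (by simp)
  · rw [extMap_of_le _ _ (by omega)]
    exact (hX.1 (k + 1) hlt).of_iso (X.extIso (k + 1) (by omega)).symm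
      (X.extIso (k + 2) (by omega)).symm (X.extIso (k + 3) (by omega)).symm (by simp) (by simp)

/-- A ladder into a rotated sequence that extends to the left gives a morphism into the sequence
itself. -/
lemma Hom.exists_of_seqHom_rotate {W : SuspSeq n T} (a : W.obj 0 ⟶ X.obj 0)
    (t : ∀ k, W.obj (k + 1) ⟶ X.extObj (k + 1))
    (h0 : W.d 0 ≫ t 0 ≫ (X.extIso 1 (by omega)).hom = a ≫ X.d 0)
    (ht : ∀ k, k < n → W.d (k + 1) ≫ t (k + 1) = t k ≫ X.extMap (k + 1))
    (hl : W.last ≫ T.map a ≫ (X.extTop (n + 2) (by omega)).inv = t n ≫ X.extMap (n + 1)) :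
    ∃ g : Hom W X, g.app 0 = a ∧
      ∀ k (hk : k ≤ n), g.app (k + 1) = t k ≫ (X.extIso (k + 1) (by omega)).hom := by
  obtain ⟨q, hq⟩ : ∃ q : ∀ k, W.obj (k + 1) ⟶ X.obj (k + 1),
      ∀ k (hk : k ≤ n), q k = t k ≫ (X.extIso (k + 1) (by omega)).hom := by
    obtain ⟨q, hq, -⟩ := exists_family (O := fun k => W.obj (k + 1) ⟶ X.obj (k + 1)) (n + 1)
      (fun k hk => t k ≫ (X.extIso (k + 1) (by omega)).hom) 0
    exact ⟨q, fun k hk => hq k (by omega)⟩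
  refine ⟨⟨⟨fun | 0 => a | k + 1 => q k, ?_⟩, ?_⟩, rfl, hq⟩
  · rintro (_ | k) hk
    · change W.d 0 ≫ q 0 = a ≫ X.d 0
      rw [hq 0 (by omega), h0]
    · change W.d (k + 1) ≫ q (k + 1) = q k ≫ X.d (k + 1)
      rw [hq k (by omega), hq (k + 1) (by omega), ← Category.assoc, ht k (by omega),
        extMap_of_le _ _ (by omega)]
      simp
  · change W.last ≫ T.map a = q n ≫ X.last
    rw [extMap_last] at hl
    rw [hq n le_rfl, ← cancel_mono (X.extTop (n + 2) (by omega)).inv, Category.assoc, hl]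
    simp

/-- A morphism to an exact sequence `X`, with isomorphisms as first two components, from the
sequence `A ⟶ Z⁰ ⟶ ⋯ ⟶ Zⁿ⁺¹ ⟶ T A` gives a ladder from `Z` to the rotation of `X` as it is needed
for replacing terms. -/
lemma Exact.exists_ladder_rotate (hn : 0 < n) (hX : X.Exact) {Z : Seq F} {A : F} {α : A ⟶ Z.obj 0}
    (hα : α ≫ Z.d 0 = 0) (e : Z.obj (n + 1) ⟶ T.obj A) (f₀ : A ⟶ X.obj 0) [IsIso f₀]
    (r : ∀ k, Z.obj k ⟶ X.obj (k + 1)) [IsIso (r 0)] (h0 : α ≫ r 0 = f₀ ≫ X.d 0)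
    (hr : ∀ k, k < n → Z.d k ≫ r (k + 1) = r k ≫ X.d (k + 1))
    (he : Z.d n ≫ e ≫ T.map f₀ = r n ≫ X.last) :
    ∃ (ρ : SeqHom (n + 1) Z X.rotate.toSeq) (g : X.rotate.obj 1 ⟶ Z.obj 1),
      IsIso (ρ.app 0) ∧ ρ.app 0 ≫ X.rotate.d 0 ≫ g = Z.d 0 ∧
      ρ.app 0 = r 0 ≫ (X.extIso 1 (by omega)).inv ∧
      ρ.app (n + 1) = (e ≫ T.map f₀) ≫ (X.extTop (n + 2) (by omega)).inv := by
  obtain ⟨ρ, hρ, hρ'⟩ := exists_seqHom_rotate Z X r (e ≫ T.map f₀) hr he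
  obtain ⟨g, hg⟩ := (hX.1 0 hn).2 _ (inv (r 0) ≫ Z.d 0) (by
    rw [← cancel_epi f₀, ← Category.assoc, ← h0, Category.assoc, IsIso.hom_inv_id_assoc, hα,
      comp_zero])
  refine ⟨ρ, (X.extIso 2 (by omega)).hom ≫ g, ?_, ?_, hρ 0 (by omega), hρ'⟩
  · have : IsIso (r 0 ≫ (X.extIso 1 (by omega)).inv) := inferInstance
    rw [hρ 0 (by omega)]
    exact this
  · rw [hρ 0 (by omega)]
    change (r 0 ≫ (X.extIso 1 (by omega)).inv) ≫ X.extMap 1 ≫ (X.extIso 2 (by omega)).hom ≫ g = _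
    rw [extMap_of_le _ 1 (by omega)]
    simp only [Category.assoc, Iso.inv_hom_id_assoc]
    have hg : X.d 1 ≫ g = inv (r 0) ≫ Z.d 0 := hg
    rw [hg, IsIso.hom_inv_id_assoc]

end SuspSeq

namespace NExactStructure

variable {n : ℕ} {M : Type u} [Category.{v} M] [Preadditive M] [HasZeroObject M]
  [HasBinaryBiproducts M] {𝒳 : NExactStructure n M} {I : ∀ A : M, 𝒳.InjRes A}

lemma isZero_Q_obj {J : M} (hJ : 𝒳.Inj J) : IsZero (𝒳.Q.obj J) := by
  rw [IsZero.iff_id_eq_zero, ← 𝒳.Q.map_id, Q_map_eq_zero_iff]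
  exact ⟨J, hJ, 𝟙 _, 𝟙 _, Category.comp_id _⟩

/-- A sequence that maps isomorphically to an admissible one in the first and the last degree is
admissible. -/
lemma adm_of_seqHom {E G : Seq M} (hE : 𝒳.adm E) (χ : SeqHom (n + 1) E G)
    (hG : G.WeakKernels n) (hG' : G.WeakCokernels n) (he : Epi (G.d n)) (hm : Mono (G.d 0))
    (h0 : IsIso (χ.app 0)) (h1 : IsIso (χ.app (n + 1))) : 𝒳.adm G :=
  (𝒳.weakIso E G (𝒳.isNExactSeq _ hE) ⟨⟨hG, hm⟩, hG', he⟩ χ (Or.inr ⟨h1, h0⟩)).1 hE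

end NExactStructure

namespace NExactStructure

variable {n : ℕ} {M : Type u} [Category.{v} M] [Preadditive M] [HasZeroObject M]
  [HasBinaryBiproducts M] {𝒳 : NExactStructure n M} {I : ∀ A : M, 𝒳.InjRes A}

/-- The replacement of the terms of an admissible sequence `E` by stably isomorphic ones. -/
lemma exists_adm_replacement (hn : 0 < n) (hM : n = 1 ∨ IsIdempotentComplete M)
    {E : Seq M} (hE : 𝒳.adm E) {X : Seq 𝒳.Stable} (hX : X.WeakCokernels n)
    (hQE : (E.map 𝒳.Q).WeakCokernels n)
    (f : SeqHom (n + 1) (E.map 𝒳.Q) X) (hf : IsIso (f.app 0)) (g : X.obj 1 ⟶ 𝒳.Q.obj (E.obj 1))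
    (hg : f.app 0 ≫ X.d 0 ≫ g = 𝒳.Q.map (E.d 0)) :
    ∃ (G : Seq M) (χ : SeqHom (n + 1) E G) (ψ : G.obj (n + 1) ⟶ E.obj (n + 1))
      (f' : SeqHom (n + 1) (G.map 𝒳.Q) X), 𝒳.adm G ∧ χ.app (n + 1) ≫ ψ = 𝟙 _ ∧
      ψ ≫ χ.app (n + 1) = 𝟙 _ ∧
      (∀ k, k ≤ n + 1 → 𝒳.Q.map (χ.app k) ≫ f'.app k = f.app k) ∧
      ∀ k, k < n → IsIso (f'.app k) := by
  have hEe := 𝒳.isNExactSeq _ hE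
  obtain ⟨N, rfl⟩ : ∃ N, n = N + 1 := ⟨n - 1, by omega⟩
  obtain ⟨G, χ, r, f', h1, h2, h3, h4, h5, h6, h7, h8⟩ := exists_replacement 𝒳.Q
    (fun f hf => by
      obtain ⟨J, hJ, u, v, h⟩ := (Q_map_eq_zero_iff f).1 hf
      exact ⟨J, u, v, isZero_Q_obj hJ, h⟩)
    N (hM.imp (by omega) id) E X hEe.1.1 hEe.2.1 hQE hX f hf g hg
  refine ⟨G, χ, inv (χ.app (N + 1 + 1)), f', ?_, by simp, by simp, h7, fun k hk => h8 k (by omega)⟩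
  refine adm_of_seqHom hE χ h1 h2 (h3 hEe.2.2) ?_ h4 h5
  have := hEe.1.2
  have : Mono ((χ.app 0 ≫ G.d 0) ≫ r) := by
    rw [Category.assoc, ← h6]
    infer_instance
  have := mono_of_mono (χ.app 0 ≫ G.d 0) r
  have h : G.d 0 = inv (χ.app 0) ≫ χ.app 0 ≫ G.d 0 := by simp
  rw [h]
  infer_instance

/-- An exact sequence is an angle as soon as some standard angle maps to it with isomorphisms as
first two components: the lower row of the standard angle can be replaced by an admissible sequence
whose image is isomorphic to the tail of the given sequence. -/
theorem angles_of_hom (hn : 0 < n) (h𝒳 : 𝒳.IsFrobenius) (hM : n = 1 ∨ IsIdempotentComplete M)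
    (D : StandardData I) {X : SuspSeq n (suspension hn I)} (hX : X.Exact)
    (f : SuspSeq.Hom (D.angle hn) X) (h0 : IsIso (f.app 0)) (h1 : IsIso (f.app 1)) :
    angles hn I X := by
  obtain ⟨θ, hθ⟩ := exists_ladder_to_injRes hn D.adm (I (D.E.obj 0))
  have hQE := (exact_angleOf hn h𝒳 I (𝒳.isNExactSeq _ D.adm).2 θ hθ).1
  obtain ⟨f₀, hf₀⟩ : ∃ f₀ : 𝒳.Q.obj D.A ⟶ X.obj 0, f.app 0 = f₀ := ⟨_, rfl⟩
  obtain ⟨r, hr⟩ : ∃ r : ∀ k, 𝒳.Q.obj (D.E.obj k) ⟶ X.obj (k + 1), ∀ k, f.app (k + 1) = r k :=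
    ⟨_, fun _ => rfl⟩
  obtain ⟨α, hα⟩ : ∃ α : D.A ⟶ D.E.obj 0, D.φ.app 0 = α := ⟨_, rfl⟩
  have e₀ : 𝒳.Q.map α ≫ r 0 = f₀ ≫ X.d 0 := hf₀ ▸ hr 0 ▸ hα ▸ f.comm 0 (by omega)
  have e₁ : ∀ k, k < n → 𝒳.Q.map (D.E.d k) ≫ r (k + 1) = r k ≫ X.d (k + 1) := fun k hk =>
    hr k ▸ hr (k + 1) ▸ f.comm (k + 1) (by omega)
  have e₂ : 𝒳.Q.map (D.E.d n) ≫ 𝒳.Q.map D.e.hom ≫ (suspension hn I).map f₀ = r n ≫ X.last := by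
    refine (Category.assoc _ _ _).symm.trans
      ((congrArg (· ≫ (suspension hn I).map f₀) (𝒳.Q.map_comp _ _).symm).trans ?_)
    exact hf₀ ▸ hr n ▸ f.comm_last
  replace h0 : IsIso f₀ := hf₀ ▸ h0
  replace h1 : IsIso (r 0) := hr 0 ▸ h1
  obtain ⟨ρ, g, hρ, hg, hρ0, hρ1⟩ := hX.exists_ladder_rotate hn (Z := D.E.map 𝒳.Q)
    (α := 𝒳.Q.map α) (hα ▸ ((exact_angle hn h𝒳 D).1 0 hn).1) (𝒳.Q.map D.e.hom) f₀ r e₀ e₁ e₂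
  obtain ⟨G, χ, ψ, f', hG, hψ, hψ', hχf, hf'⟩ := exists_adm_replacement hn hM D.adm
    hX.weakCokernels_rotate hQE ρ hρ g hg
  obtain ⟨t, ht⟩ : ∃ t : ∀ k, 𝒳.Q.obj (G.obj k) ⟶ X.extObj (k + 1), ∀ k, f'.app k = t k :=
    ⟨_, fun _ => rfl⟩
  let D' : StandardData I := ⟨D.A, G, hG, ⟨ψ ≫ D.e.hom, D.e.inv ≫ χ.app (n + 1), by
    rw [Category.assoc, Iso.hom_inv_id_assoc, hψ'], by
    rw [Category.assoc, ← Category.assoc (χ.app (n + 1)), hψ, Category.id_comp,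
      Iso.inv_hom_id]⟩, D.φ.comp χ, by
    refine (Category.assoc _ _ _).trans (Eq.trans ?_ D.φ_last)
    rw [← Category.assoc (χ.app (n + 1)), hψ, Category.id_comp]⟩
  have t₀ : 𝒳.Q.map (χ.app 0) ≫ t 0 = r 0 ≫ (X.extIso 1 (by omega)).inv :=
    ht 0 ▸ (hχf 0 (by omega)).trans hρ0
  have t₁ : 𝒳.Q.map (α ≫ χ.app 0) ≫ t 0 ≫ (X.extIso 1 (by omega)).hom = f₀ ≫ X.d 0 := by
    rw [𝒳.Q.map_comp, Category.assoc, ← Category.assoc (𝒳.Q.map (χ.app 0)), t₀, Category.assoc,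
      Iso.inv_hom_id, Category.comp_id, e₀]
  have t₂ : ∀ k, k < n → 𝒳.Q.map (G.d k) ≫ t (k + 1) = t k ≫ X.extMap (k + 1) := fun k hk =>
    ht k ▸ ht (k + 1) ▸ f'.comm k (by omega)
  obtain ⟨s, hs⟩ : ∃ s : 𝒳.Q.obj (I D.A).cosyzygy ⟶ X.extObj (n + 2),
    (suspension hn I).map f₀ ≫ (X.extTop (n + 2) (by omega)).inv = s := ⟨_, rfl⟩
  have t₃ : 𝒳.Q.map (χ.app (n + 1)) ≫ t (n + 1) = 𝒳.Q.map D.e.hom ≫ s :=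
    ht (n + 1) ▸ hs ▸ (hχf (n + 1) le_rfl).trans (hρ1.trans (Category.assoc _ _ _))
  have t₄ : t (n + 1) = 𝒳.Q.map (ψ ≫ D.e.hom) ≫ s := by
    rw [𝒳.Q.map_comp, Category.assoc, ← t₃, ← Category.assoc, ← 𝒳.Q.map_comp, hψ', 𝒳.Q.map_id,
      Category.id_comp]
  have t₅ : 𝒳.Q.map (G.d n ≫ ψ ≫ D.e.hom) ≫ s = t n ≫ X.extMap (n + 1) := by
    rw [𝒳.Q.map_comp, Category.assoc, ← t₄]
    exact ht n ▸ ht (n + 1) ▸ f'.comm n (by omega)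
  obtain ⟨q, hq0, hq⟩ := SuspSeq.Hom.exists_of_seqHom_rotate (W := D'.angle hn) (X := X) f₀ t
    ((congrArg (fun a => 𝒳.Q.map (a ≫ χ.app 0) ≫ t 0 ≫ (X.extIso 1 (by omega)).hom) hα).trans t₁)
    t₂ ((congrArg (𝒳.Q.map (G.d n ≫ ψ ≫ D.e.hom) ≫ ·) hs).trans t₅)
  have hq' : ∀ k, k ≤ n → IsIso (q.app k) := by
    rintro (_ | k) hk
    · exact hq0 ▸ h0
    · rw [hq k (by omega)]
      have : IsIso (t k) := ht k ▸ hf' k (by omega)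
      exact (inferInstance : IsIso (t k ≫ (X.extIso (k + 1) (by omega)).hom))
  exact ⟨D', q, fun k hk => (Nat.le_succ_iff.1 hk).elim (hq' k)
    (fun h => h ▸ (exact_angle hn h𝒳 D').isIso_last hn hX q hq')⟩

end NExactStructure

/-! ### Extension of morphisms, sums, summands and rotation -/

section

variable {C : Type u} [Category.{v} C] [Preadditive C] [HasBinaryBiproducts C]

lemma IsWeakCokernel.biprod_map {A B D A' B' D' : C} {f : A ⟶ B} {g : B ⟶ D} {f' : A' ⟶ B'}
    {g' : B' ⟶ D'} (h : IsWeakCokernel f g) (h' : IsWeakCokernel f' g') :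
    IsWeakCokernel (biprod.map f f') (biprod.map g g') := by
  refine ⟨by ext <;> simp [h.1, h'.1], fun W x hx => ?_⟩
  obtain ⟨y, hy⟩ := h.2 W (biprod.inl ≫ x) (by
    rw [← biprod.inl_map_assoc f f', hx, comp_zero])
  obtain ⟨y', hy'⟩ := h'.2 W (biprod.inr ≫ x) (by
    rw [← biprod.inr_map_assoc f f', hx, comp_zero])
  exact ⟨biprod.desc y y', by ext <;> simp [hy, hy']⟩

end

namespace SuspSeq

variable {n : ℕ} {F : Type u} [Category.{v} F] {T : F ⥤ F} [Preadditive F]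
  [HasBinaryBiproducts F] {W X Y Z : SuspSeq n T}

/-- A morphism to a direct sum. -/
def Hom.lift [T.Additive] (f : Hom W X) (g : Hom W Y) : Hom W (X.sum Y) where
  app k := biprod.lift (f.app k) (g.app k)
  comm k hk := by
    change W.d k ≫ biprod.lift _ _ = biprod.lift _ _ ≫ biprod.map _ _
    ext
    · simpa using f.comm k hk
    · simpa using g.comm k hk
  comm_last := by
    change W.last ≫ T.map (biprod.lift _ _) = biprod.lift _ _ ≫ biprod.desc _ _
    rw [biprod.lift_desc, biprod.lift_eq, T.map_add, T.map_comp, T.map_comp,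
      Preadditive.comp_add, ← Category.assoc, ← Category.assoc, f.comm_last, g.comm_last,
      Category.assoc, Category.assoc]

/-- The projection of a direct sum to the first summand. -/
def Hom.fst [T.Additive] (X Y : SuspSeq n T) : Hom (X.sum Y) X where
  app _ := biprod.fst
  comm _ _ := biprod.map_fst _ _
  comm_last := by
    change biprod.desc _ _ ≫ T.map biprod.fst = biprod.fst ≫ X.last
    ext
    · simp [← T.map_comp]
    · simp [← T.map_comp]

/-- The inclusion of the first summand of a direct sum. -/
def Hom.inl (X Y : SuspSeq n T) : Hom X (X.sum Y) where
  app _ := biprod.inl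
  comm _ _ := (biprod.inl_map _ _).symm
  comm_last := (biprod.inl_desc _ _).symm

/-- An additive functor preserves direct sums. -/
lemma exists_iso_map_biprod [T.Additive] (A B : F) :
    ∃ e : T.obj A ⊞ T.obj B ≅ T.obj (A ⊞ B),
      e.hom = biprod.desc (T.map biprod.inl) (T.map biprod.inr) :=
  ⟨⟨biprod.desc (T.map biprod.inl) (T.map biprod.inr),
      biprod.lift (T.map biprod.fst) (T.map biprod.snd), by ext <;> simp [← T.map_comp], by
      rw [biprod.lift_desc, ← T.map_comp, ← T.map_comp, ← T.map_add, biprod.total, T.map_id]⟩,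
    rfl⟩

lemma Exact.sum [T.Additive] (hX : X.Exact) (hY : Y.Exact) : (X.sum Y).Exact := by
  obtain ⟨e, he⟩ := exists_iso_map_biprod (T := T) (X.obj 0) (Y.obj 0)
  obtain ⟨e', he'⟩ := exists_iso_map_biprod (T := T) (X.obj 1) (Y.obj 1)
  have h1 : biprod.map X.last Y.last ≫ e.hom =
      biprod.desc (X.last ≫ T.map biprod.inl) (Y.last ≫ T.map biprod.inr) := by
    rw [he]
    ext <;> simp
  have h2 : biprod.map (T.map (X.d 0)) (T.map (Y.d 0)) ≫ e'.hom =
      e.hom ≫ T.map (biprod.map (X.d 0) (Y.d 0)) := by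
    rw [he, he']
    ext
    · rw [biprod.inl_map_assoc, biprod.inl_desc, biprod.inl_desc_assoc, ← T.map_comp,
        ← T.map_comp, biprod.inl_map]
    · rw [biprod.inr_map_assoc, biprod.inr_desc, biprod.inr_desc_assoc, ← T.map_comp,
        ← T.map_comp, biprod.inr_map]
  exact ⟨fun k hk => (hX.1 k hk).biprod_map (hY.1 k hk),
    (hX.2.1.biprod_map hY.2.1).of_iso (Iso.refl _) (Iso.refl _) e
      ((Category.comp_id _).trans (Category.id_comp _).symm)
      (h1.trans (Category.id_comp _).symm),
    (hX.2.2.biprod_map hY.2.2).of_iso (Iso.refl _) e e' (h1.trans (Category.id_comp _).symm) h2⟩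

end SuspSeq

namespace NExactStructure

variable {n : ℕ} {M : Type u} [Category.{v} M] [Preadditive M] [HasZeroObject M]
  [HasBinaryBiproducts M] {𝒳 : NExactStructure n M} {I : ∀ A : M, 𝒳.InjRes A}

/-- Up to isomorphism, every morphism of the stable category is the first one of a standard
angle. -/
lemma exists_standardData_of_stable (hn : 0 < n) (I : ∀ A : M, 𝒳.InjRes A) {A B : 𝒳.Stable}
    (α : A ⟶ B) : ∃ (D : StandardData I) (i : (D.angle hn).obj 0 ≅ A) (j : (D.angle hn).obj 1 ≅ B),
      Arrow.mk ((D.angle hn).d 0) = Arrow.mk α ∧ (D.angle hn).d 0 ≫ j.hom = i.hom ≫ α := by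
  obtain ⟨f, rfl⟩ := exists_Q_map (A := A.as) (B := B.as) α
  obtain ⟨D, hD⟩ := exists_standardData hn I f
  have h : Arrow.mk ((D.angle hn).d 0) = Arrow.mk (𝒳.Q.map f) := congrArg 𝒳.Q.mapArrow.obj hD
  exact ⟨D, Arrow.leftFunc.mapIso (eqToIso h), Arrow.rightFunc.mapIso (eqToIso h), h,
    (eqToIso h).hom.w.symm⟩

/-- The sequence of the stable category that is given by a sequence of weak cokernels is an
angle. -/
theorem angles_angleOf (hn : 0 < n) (h𝒳 : 𝒳.IsFrobenius) (hM : n = 1 ∨ IsIdempotentComplete M)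
    {F : Seq M} (hF : IsNCokernel n F) (θ : SeqHom (n + 1) F (I (F.obj 0)).seq)
    (hθ : θ.app 0 = 𝟙 (F.obj 0)) : angles hn I (angleOf hn I F (θ.app (n + 1))) := by
  obtain ⟨D, i, j, -, hij⟩ := exists_standardData_of_stable hn I (𝒳.Q.map (F.d 0))
  obtain ⟨f, h0, h1⟩ := D.exists_hom_angleOf hn h𝒳 (Seq.WeakCokernels.isComplex hF.1) θ hθ
    i.hom j.hom hij
  exact angles_of_hom hn h𝒳 hM D (exact_angleOf hn h𝒳 I hF θ hθ) f
    (h0 ▸ inferInstanceAs (IsIso i.hom)) (h1 ▸ inferInstanceAs (IsIso j.hom))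

/-- A commutative square extends to a morphism from a standard angle to an angle. -/
lemma StandardData.exists_hom (hn : 0 < n) (h𝒳 : 𝒳.IsFrobenius) (D : StandardData I)
    {Y : SuspSeq n (suspension hn I)} (hY : angles hn I Y) (a : (D.angle hn).obj 0 ⟶ Y.obj 0)
    (b : (D.angle hn).obj 1 ⟶ Y.obj 1) (hab : (D.angle hn).d 0 ≫ b = a ≫ Y.d 0) :
    ∃ f : SuspSeq.Hom (D.angle hn) Y, f.app 0 = a ∧ f.app 1 = b := by
  obtain ⟨D', hD'⟩ := hY
  obtain ⟨V, θ, hV, hθ, h⟩ := D'.exists_isIsomorphic_angleOf hn h𝒳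
  obtain ⟨u, hu⟩ := hD'.symm.trans h
  obtain ⟨w, hw⟩ := u.exists_inverse hu
  obtain ⟨f, h0, h1⟩ := D.exists_hom_angleOf hn h𝒳 (Seq.WeakCokernels.isComplex hV.1) θ hθ
    (a ≫ u.app 0) (b ≫ u.app 1) (by
      refine (Category.assoc _ _ _).symm.trans ((congrArg (· ≫ u.app 1) hab).trans ?_)
      refine (Category.assoc _ _ _).trans ((congrArg (a ≫ ·) (u.comm 0 (by omega))).trans ?_)
      exact (Category.assoc _ _ _).symm)
  refine ⟨f.comp w, ?_, ?_⟩
  · refine (congrArg (· ≫ w.app 0) h0).trans ((Category.assoc _ _ _).trans ?_)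
    rw [(hw 0 (by omega)).1, Category.comp_id]
  · refine (congrArg (· ≫ w.app 1) h1).trans ((Category.assoc _ _ _).trans ?_)
    rw [(hw 1 (by omega)).1, Category.comp_id]

/-- Trivial sequences are angles: they are given by the resolutions. -/
lemma angles_trivial (hn : 0 < n) (A : 𝒳.Stable) :
    angles hn I (SuspSeq.trivial n (suspension hn I) A) := by
  obtain ⟨A⟩ := A
  let D : StandardData I := ⟨A, (I A).seq, (I A).adm, Iso.refl _,
    ⟨fun _ => 𝟙 _, fun _ _ => (Category.comp_id _).trans (Category.id_comp _).symm⟩,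
    Category.comp_id _⟩
  have hz : ∀ k, k < n → IsZero ((D.angle hn).obj (k + 2)) := fun k hk =>
    isZero_Q_obj ((I A).inj_seq (k + 1) (by omega) (by omega))
  refine ⟨D, ⟨⟨fun
    | 0 => 𝟙 (𝒳.Q.obj A)
    | 1 => 𝟙 (𝒳.Q.obj A)
    | _ + 2 => 0, ?_⟩, ?_⟩, ?_⟩
  · rintro (_ | k) hk
    · change 𝒳.Q.map (𝟙 A) ≫ 𝟙 (𝒳.Q.obj A) = 𝟙 (𝒳.Q.obj A) ≫ 𝟙 (𝒳.Q.obj A)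
      rw [𝒳.Q.map_id]
    · exact (isZero_zero _).eq_of_tgt _ _
  · obtain ⟨m, rfl⟩ : ∃ m, n = m + 1 := ⟨n - 1, by omega⟩
    exact (hz m (by omega)).eq_of_src _ _
  · rintro (_ | _ | k) hk
    · exact IsIso.id (𝒳.Q.obj A)
    · exact IsIso.id (𝒳.Q.obj A)
    · exact ⟨0, (hz k (by omega)).eq_of_src _ _, (isZero_zero _).eq_of_src _ _⟩

/-- A commutative square between angles extends to a morphism. -/
lemma exists_hom_of_angles (hn : 0 < n) (h𝒳 : 𝒳.IsFrobenius) {X Y : SuspSeq n (suspension hn I)}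
    (hX : angles hn I X) (hY : angles hn I Y) (a : X.obj 0 ⟶ Y.obj 0) (b : X.obj 1 ⟶ Y.obj 1)
    (hab : X.d 0 ≫ b = a ≫ Y.d 0) : ∃ f : SuspSeq.Hom X Y, f.app 0 = a ∧ f.app 1 = b := by
  obtain ⟨D, u, hu⟩ := hX
  obtain ⟨w, hw⟩ := u.exists_inverse hu
  obtain ⟨f, h0, h1⟩ := D.exists_hom hn h𝒳 hY (u.app 0 ≫ a) (u.app 1 ≫ b) (by
    rw [← Category.assoc, u.comm 0 (by omega), Category.assoc, hab, Category.assoc])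
  refine ⟨w.comp f, ?_, ?_⟩
  · change w.app 0 ≫ f.app 0 = a
    rw [h0, ← Category.assoc, (hw 0 (by omega)).2, Category.id_comp]
  · change w.app 1 ≫ f.app 1 = b
    rw [h1, ← Category.assoc, (hw 1 (by omega)).2, Category.id_comp]

/-- An exact sequence `X` is an angle as soon as every morphism to it from the beginning of a
standard angle extends. -/
lemma angles_of_exact (hn : 0 < n) (h𝒳 : 𝒳.IsFrobenius) (hM : n = 1 ∨ IsIdempotentComplete M)
    {X : SuspSeq n (suspension hn I)} (hX : X.Exact)
    (h : ∀ (D : StandardData I) (a : (D.angle hn).obj 0 ⟶ X.obj 0)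
      (b : (D.angle hn).obj 1 ⟶ X.obj 1), (D.angle hn).d 0 ≫ b = a ≫ X.d 0 →
      ∃ f : SuspSeq.Hom (D.angle hn) X, f.app 0 = a ∧ f.app 1 = b) : angles hn I X := by
  obtain ⟨D, i, j, -, hij⟩ := exists_standardData_of_stable hn I (X.d 0)
  obtain ⟨f, h0, h1⟩ := h D i.hom j.hom hij
  exact angles_of_hom hn h𝒳 hM D hX f (h0 ▸ inferInstanceAs (IsIso i.hom))
    (h1 ▸ inferInstanceAs (IsIso j.hom))

/-- The sum of two angles is exact, and morphisms to it extend componentwise. -/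
theorem angles_sum (hn : 0 < n) (h𝒳 : 𝒳.IsFrobenius) (hM : n = 1 ∨ IsIdempotentComplete M)
    {X Y : SuspSeq n (suspension hn I)} (hX : angles hn I X) (hY : angles hn I Y) :
    angles hn I (X.sum Y) := by
  refine angles_of_exact hn h𝒳 hM ((exact_of_angles hn h𝒳 hX).sum (exact_of_angles hn h𝒳 hY))
    fun D a b hab => ?_
  change (D.angle hn).obj 0 ⟶ X.obj 0 ⊞ Y.obj 0 at a
  change (D.angle hn).obj 1 ⟶ X.obj 1 ⊞ Y.obj 1 at b
  replace hab : (D.angle hn).d 0 ≫ b = a ≫ biprod.map (X.d 0) (Y.d 0) := hab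
  obtain ⟨f, f0, f1⟩ := D.exists_hom hn h𝒳 hX (a ≫ biprod.fst) (b ≫ biprod.fst) (by
    rw [← Category.assoc, hab, Category.assoc, Category.assoc, biprod.map_fst])
  obtain ⟨g, g0, g1⟩ := D.exists_hom hn h𝒳 hY (a ≫ biprod.snd) (b ≫ biprod.snd) (by
    rw [← Category.assoc, hab, Category.assoc, Category.assoc, biprod.map_snd])
  refine ⟨f.lift g, ?_, ?_⟩
  · change biprod.lift (f.app 0) (g.app 0) = a
    rw [f0, g0]
    ext <;> simp
  · change biprod.lift (f.app 1) (g.app 1) = b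
    rw [f1, g1]
    ext <;> simp

/-- A summand of an angle is exact, and morphisms to it extend through the angle. -/
theorem angles_summand (hn : 0 < n) (h𝒳 : 𝒳.IsFrobenius) (hM : n = 1 ∨ IsIdempotentComplete M)
    {X Y Z : SuspSeq n (suspension hn I)} (hZ : angles hn I Z)
    (h : SuspSeq.IsIsomorphic Z (X.sum Y)) : angles hn I X := by
  obtain ⟨D, hD⟩ := hZ
  have hS : angles hn I (X.sum Y) := ⟨D, hD.trans h⟩
  refine angles_of_exact hn h𝒳 hM ((exact_of_angles hn h𝒳 hS).of_retract (SuspSeq.Hom.inl X Y)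
    (SuspSeq.Hom.fst X Y) fun k _ => biprod.inl_fst) fun D a b hab => ?_
  obtain ⟨f, f0, f1⟩ := D.exists_hom hn h𝒳 hS (a ≫ biprod.inl) (b ≫ biprod.inl) (by
    change _ = (a ≫ biprod.inl) ≫ biprod.map (X.d 0) (Y.d 0)
    rw [Category.assoc, biprod.inl_map, ← Category.assoc, ← hab]
    exact (Category.assoc _ _ _).symm)
  refine ⟨f.comp (SuspSeq.Hom.fst X Y), ?_, ?_⟩
  · refine (congrArg (· ≫ biprod.fst) f0).trans ((Category.assoc _ _ _).trans ?_)
    rw [biprod.inl_fst]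
    exact Category.comp_id _
  · refine (congrArg (· ≫ biprod.fst) f1).trans ((Category.assoc _ _ _).trans ?_)
    rw [biprod.inl_fst]
    exact Category.comp_id _

/-- The rotation of a standard angle is given by its lower row. -/
lemma angles_rotate (hn : 0 < n) (h𝒳 : 𝒳.IsFrobenius) (hM : n = 1 ∨ IsIdempotentComplete M)
    {X : SuspSeq n (suspension hn I)} (hX : angles hn I X) : angles hn I X.rotate := by
  obtain ⟨D, hD⟩ := hX
  obtain ⟨θ, hθ⟩ := exists_ladder_to_injRes hn D.adm (I (D.E.obj 0))
  obtain ⟨D', hD'⟩ := angles_angleOf hn h𝒳 hM (𝒳.isNExactSeq _ D.adm).2 θ hθ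
  exact ⟨D', hD'.trans ((isIsomorphic_angleOf_rotate hn D θ hθ).trans hD.rotate)⟩

end NExactStructure

namespace SuspSeq

variable {n : ℕ} {F : Type u} [Category.{v} F] {T : F ⥤ F}

lemma IsIsomorphic.refl (X : SuspSeq n T) : IsIsomorphic X X :=
  ⟨⟨⟨fun _ => 𝟙 _, fun _ _ => by simp⟩, by simp⟩, fun _ _ => inferInstance⟩

end SuspSeq

section

variable {C : Type u} [Category.{v} C] [Preadditive C]

/-- Let `φ : P ⟶ E` and `φ' : P' ⟶ E'` be ladders whose last components are isomorphisms, with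
inverses `e` and `e'`. A ladder `σ : P ⟶ P'` and a compatible morphism `y` between the last but one
terms of `E` and `E'` give a ladder `β : E ⟶ E'` such that `φ β` and `σ φ'` agree up to homotopy. -/
lemma exists_ladder_of_last_square {n : ℕ} {P P' E E' : Seq C} (hP : P.IsComplex n)
    (hE : E.IsComplex n) (hE' : IsNKernel n E') (φ : SeqHom (n + 1) P E)
    (φ' : SeqHom (n + 1) P' E') (σ : SeqHom (n + 1) P P') {S S' : C} (e : E.obj (n + 1) ≅ S)
    (e' : E'.obj (n + 1) ≅ S') (i : P.obj (n + 1) = S) (i' : P'.obj (n + 1) = S')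
    (he : φ.app (n + 1) ≫ e.hom = eqToHom i) (he' : φ'.app (n + 1) ≫ e'.hom = eqToHom i')
    (s : S ⟶ S') (hs : eqToHom i ≫ s = σ.app (n + 1) ≫ eqToHom i')
    (y : E.obj n ⟶ E'.obj n) (hy : y ≫ E'.d n ≫ e'.hom = (E.d n ≫ e.hom) ≫ s) :
    ∃ β : SeqHom (n + 1) E E', β.app n = y ∧
      ∃ w, P.d 0 ≫ w = φ.app 0 ≫ β.app 0 - σ.app 0 ≫ φ'.app 0 := by
  subst i i'
  obtain ⟨β, hβ, hβ'⟩ := exists_ladder_of_last hE hE'.1 y (e.hom ≫ s ≫ e'.inv) (by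
    rw [← cancel_mono e'.hom, Category.assoc y, hy]
    simp)
  refine ⟨β, hβ, exists_first_factor hP hE' ((φ.comp β).sub (σ.comp φ')) 0 ?_⟩
  change _ = φ.app (n + 1) ≫ β.app (n + 1) - σ.app (n + 1) ≫ φ'.app (n + 1)
  rw [zero_comp, hβ', eq_comm, sub_eq_zero, ← cancel_mono e'.hom, Category.assoc (σ.app _), he']
  simp only [eqToHom_refl, Category.id_comp, Category.comp_id] at he hs ⊢
  rw [← Category.assoc, he]
  simpa using hs

end

namespace NExactStructure

variable {n : ℕ} {M : Type u} [Category.{v} M] [Preadditive M] [HasZeroObject M]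
  [HasBinaryBiproducts M] {𝒳 : NExactStructure n M} {I : ∀ A : M, 𝒳.InjRes A}

/-- A morphism that factors through an injective object lifts along the last morphism of an
admissible sequence to a morphism that also factors through an injective object. -/
lemma FactorsInj.exists_factorsInj_lift (h𝒳 : 𝒳.IsFrobenius) {R : Seq M} (hR : 𝒳.adm R) {V : M}
    {x : V ⟶ R.obj (n + 1)} (hx : 𝒳.FactorsInj x) :
    ∃ y : V ⟶ R.obj n, 𝒳.FactorsInj y ∧ y ≫ R.d n = x := by
  obtain ⟨J, hJ, a, b, rfl⟩ := hx
  obtain ⟨y, hy⟩ := (Category.id_comp b ▸ FactorsInj.comp_of_inj hJ (𝟙 J) b).exists_lift h𝒳 hR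
  exact ⟨a ≫ y, FactorsInj.comp_of_inj hJ a y, by rw [Category.assoc, hy]⟩

/-- A morphism between standard angles can be extended from its last square, which consists of
components at the two ends of the angles. This is the extension of the first square to the
right, read backwards through the lower rows. -/
lemma StandardData.exists_hom_of_last (hn : 0 < n) (h𝒳 : 𝒳.IsFrobenius) (D D' : StandardData I)
    (a : (D.angle hn).obj 0 ⟶ (D'.angle hn).obj 0)
    (c : (D.angle hn).obj (n + 1) ⟶ (D'.angle hn).obj (n + 1))
    (h : (D.angle hn).last ≫ (suspension hn I).map a = c ≫ (D'.angle hn).last) :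
    ∃ f : SuspSeq.Hom (D.angle hn) (D'.angle hn), f.app 0 = a ∧ f.app (n + 1) = c := by
  obtain ⟨a, rfl⟩ := exists_Q_map (A := D.A) (B := D'.A) a
  obtain ⟨c, rfl⟩ := exists_Q_map (A := D.E.obj n) (B := D'.E.obj n) c
  obtain ⟨σ, hσ⟩ := (I D.A).exists_ladder_of_first (I D'.A).adm ((I D'.A).inj_seq 1 le_rfl hn) a
  obtain ⟨s, hs⟩ : ∃ s : (I D.A).cosyzygy ⟶ (I D'.A).cosyzygy, s = σ.app (n + 1) := ⟨_, rfl⟩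
  have hT : (suspension hn I).map (𝒳.Q.map a) = 𝒳.Q.map s :=
    suspension_map hn I a ⟨σ, hσ, hs.symm⟩
  have h' : 𝒳.FactorsInj ((D.E.d n ≫ D.e.hom) ≫ s - c ≫ D'.E.d n ≫ D'.e.hom) := by
    refine (Q_map_eq_iff 𝒳 _ _).1 ?_
    refine (𝒳.Q.map_comp _ _).trans (Eq.trans ?_ (𝒳.Q.map_comp _ _).symm)
    exact (congrArg (𝒳.Q.map (D.E.d n ≫ D.e.hom) ≫ ·) hT.symm).trans h
  -- the last square can be made to commute in `M`
  obtain ⟨y, hy, hy'⟩ := (h'.comp_right D'.e.inv).exists_factorsInj_lift h𝒳 D'.adm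
  obtain ⟨β, hβ, w, hw⟩ := exists_ladder_of_last_square (𝒳.isNExactSeq _ (I D.A).adm).isComplex
    (𝒳.isNExactSeq _ D.adm).isComplex (𝒳.isNExactSeq _ D'.adm).1 D.φ D'.φ σ D.e D'.e rfl rfl
    D.φ_last D'.φ_last s ((Category.id_comp _).trans (hs.trans (Category.comp_id _).symm))
    (c + y) (by
      rw [Preadditive.add_comp, ← Category.assoc y, hy', Category.assoc _ D'.e.inv,
        D'.e.inv_hom_id, Category.comp_id]
      exact add_sub_cancel _ _)
  have hc : 𝒳.Q.map (β.app n) = 𝒳.Q.map c := by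
    rw [hβ, Q_map_eq_iff, add_sub_cancel_left]
    exact hy
  have hsq : 𝒳.Q.map (D.φ.app 0 ≫ β.app 0) = 𝒳.Q.map (a ≫ D'.φ.app 0) := by
    rw [← hσ]
    exact (Q_map_eq_iff 𝒳 _ _).2
      (hw ▸ FactorsInj.comp_of_inj ((I D.A).inj_seq 1 le_rfl hn) _ _)
  refine ⟨⟨⟨fun
    | 0 => 𝒳.Q.map a
    | k + 1 => 𝒳.Q.map (β.app k), ?_⟩, ?_⟩, rfl, hc⟩
  · rintro (_ | k) hk
    · exact (𝒳.Q.map_comp _ _).symm.trans (hsq.trans (𝒳.Q.map_comp _ _))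
    · exact (𝒳.Q.map_comp _ _).symm.trans ((congrArg 𝒳.Q.map (β.comm k (by omega))).trans
        (𝒳.Q.map_comp _ _))
  · exact h.trans (congrArg (· ≫ (D'.angle hn).last) hc.symm)

/-- Morphisms between angles can also be extended from their last square. -/
lemma exists_hom_of_last (hn : 0 < n) (h𝒳 : 𝒳.IsFrobenius) {X Y : SuspSeq n (suspension hn I)}
    (hX : angles hn I X) (hY : angles hn I Y) (a : X.obj 0 ⟶ Y.obj 0)
    (c : X.obj (n + 1) ⟶ Y.obj (n + 1))
    (h : X.last ≫ (suspension hn I).map a = c ≫ Y.last) :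
    ∃ f : SuspSeq.Hom X Y, f.app 0 = a ∧ f.app (n + 1) = c := by
  obtain ⟨D, u, hu⟩ := hX
  obtain ⟨w, hw⟩ := u.exists_inverse hu
  obtain ⟨D', u', hu'⟩ := hY
  obtain ⟨w', hw'⟩ := u'.exists_inverse hu'
  obtain ⟨f, h0, h1⟩ := D.exists_hom_of_last hn h𝒳 D' (u.app 0 ≫ a ≫ w'.app 0)
    (u.app (n + 1) ≫ c ≫ w'.app (n + 1)) (by
    rw [Functor.map_comp, Functor.map_comp, ← Category.assoc, u.comm_last, Category.assoc,
      Category.assoc, Category.assoc, ← w'.comm_last, ← Category.assoc X.last, h, Category.assoc])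
  refine ⟨(w.comp f).comp u', ?_, ?_⟩
  · change (w.app 0 ≫ f.app 0) ≫ u'.app 0 = a
    rw [h0, ← Category.assoc (w.app 0), (hw 0 (by omega)).2, Category.id_comp, Category.assoc,
      (hw' 0 (by omega)).2, Category.comp_id]
  · change (w.app (n + 1) ≫ f.app (n + 1)) ≫ u'.app (n + 1) = c
    rw [h1, ← Category.assoc (w.app (n + 1)), (hw (n + 1) le_rfl).2, Category.id_comp,
      Category.assoc, (hw' (n + 1) le_rfl).2, Category.comp_id]

/-- If the rotation of `X` is an angle, then `X` is exact, as `Σ` is fully faithful, and a morphism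
to `X` from the beginning of a standard angle extends: it is part of a last square for the
rotated sequences. -/
theorem angles_rotate_iff (hn : 0 < n) (h𝒳 : 𝒳.IsFrobenius) (hM : n = 1 ∨ IsIdempotentComplete M)
    (X : SuspSeq n (suspension hn I)) : angles hn I X ↔ angles hn I X.rotate := by
  refine ⟨angles_rotate hn h𝒳 hM, fun h => ?_⟩
  have := isEquivalence_suspension hn h𝒳 I
  refine angles_of_exact hn h𝒳 hM ((exact_of_angles hn h𝒳 h).of_rotate hn) fun D a b hab => ?_
  obtain ⟨f, h0, h1⟩ := exists_hom_of_last hn h𝒳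
    (angles_rotate hn h𝒳 hM ⟨D, SuspSeq.IsIsomorphic.refl _⟩) h
    (((D.angle hn).extIso 1 (by omega)).hom ≫ b ≫ (X.extIso 1 (by omega)).inv)
    (((D.angle hn).extTop (n + 2) (by omega)).hom ≫ (suspension hn I).map a ≫
      (X.extTop (n + 2) (by omega)).inv) (by
      simp only [SuspSeq.rotate, Functor.map_comp, Category.assoc, Preadditive.zsmul_comp,
        Preadditive.comp_zsmul, Iso.inv_hom_id_assoc]
      rw [← Functor.map_comp_assoc _ _ (SuspSeq.extIso _ _ _).hom, Iso.inv_hom_id,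
        CategoryTheory.Functor.map_id, Category.id_comp, ← Functor.map_comp_assoc, hab,
        Functor.map_comp_assoc])
  exact SuspSeq.Hom.exists_of_rotate f a b h0 hab h1

end NExactStructure

/-! ### Mapping cones -/

section

variable {C : Type u} [Category.{v} C] [Preadditive C] [HasBinaryBiproducts C]

section

variable {E₀ E₁ E₂ G₀ G₁ G₂ : C} {e : E₀ ⟶ E₁} {e' : E₁ ⟶ E₂} {g : G₀ ⟶ G₁} {g' : G₁ ⟶ G₂}
  {ψ : E₀ ⟶ G₁} {ψ' : E₁ ⟶ G₂}

lemma inl_matrix {W : C} (h : E₁ ⊞ G₁ ⟶ W) :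
    biprod.inl ≫ Biprod.ofComponents (-e) ψ 0 g ≫ h =
      -(e ≫ biprod.inl ≫ h) + ψ ≫ biprod.inr ≫ h := by
  rw [← Category.assoc, biprod_inl_ofComponents]
  simp

lemma inr_matrix {W : C} (h : E₁ ⊞ G₁ ⟶ W) :
    biprod.inr ≫ Biprod.ofComponents (-e) ψ 0 g ≫ h = g ≫ biprod.inr ≫ h := by
  rw [← Category.assoc, biprod_inr_ofComponents]
  simp

lemma comp_biprod_lift {W V : C} (v : V ⟶ W) (x : W ⟶ E₀) (y : W ⟶ G₀) :
    v ≫ biprod.lift x y = biprod.lift (v ≫ x) (v ≫ y) := by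
  ext <;> simp

lemma isIso_biprod_map (x : E₀ ⟶ E₁) (y : G₀ ⟶ G₁) [IsIso x] [IsIso y] : IsIso (biprod.map x y) :=
  inferInstanceAs (IsIso (biprod.mapIso (asIso x) (asIso y)).hom)

lemma lift_matrix {W : C} (x : W ⟶ E₀) (y : W ⟶ G₀) :
    biprod.lift x y ≫ Biprod.ofComponents (-e) ψ 0 g =
      biprod.lift (-(x ≫ e)) (x ≫ ψ + y ≫ g) := by
  ext <;> simp

/-- A morphism on `E₀ ⊕ G₀` extends along `[[-e, ψ], [0, g]]` if its restriction to `G₀` extends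
along `g` and every morphism on `E₀` extends along `e`. -/
lemma exists_extension_matrix {W : C} (he : ∀ z : E₀ ⟶ W, ∃ x, e ≫ x = z) (h : E₀ ⊞ G₀ ⟶ W)
    (y : G₁ ⟶ W) (hy : g ≫ y = biprod.inr ≫ h) :
    ∃ k, Biprod.ofComponents (-e) ψ 0 g ≫ k = h := by
  obtain ⟨x, hx⟩ := he (biprod.inl ≫ h - ψ ≫ y)
  refine ⟨biprod.desc (-x) y, ?_⟩
  apply biprod.hom_ext'
  · rw [inl_matrix]
    simp [hx]
  · rw [inr_matrix]
    simp [hy]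

lemma IsWeakCokernel.matrix (he : IsWeakCokernel e e') (hg : IsWeakCokernel g g')
    (h : e ≫ ψ' = ψ ≫ g') :
    IsWeakCokernel (Biprod.ofComponents (-e) ψ 0 g) (Biprod.ofComponents (-e') ψ' 0 g') := by
  refine ⟨?_, fun W x hx => ?_⟩
  · apply biprod.hom_ext'
    · rw [inl_matrix, biprod_inl_ofComponents, biprod_inr_ofComponents, Preadditive.comp_add,
        ← Category.assoc e ψ', h, zero_comp, zero_add, comp_zero, Preadditive.neg_comp,
        Preadditive.comp_neg, ← Category.assoc e e', he.1, Category.assoc, zero_comp, neg_zero,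
        zero_add, neg_add_cancel]
    · rw [inr_matrix, biprod_inr_ofComponents, zero_comp, zero_add, ← Category.assoc, hg.1,
        zero_comp, comp_zero]
  · have h1 := (inl_matrix (e := e) (g := g) (ψ := ψ) x).symm
    have h2 := (inr_matrix (e := e) (g := g) (ψ := ψ) x).symm
    rw [hx, comp_zero] at h1 h2
    obtain ⟨y, hy⟩ := hg.2 _ _ h2
    obtain ⟨z, hz⟩ := he.2 _ (biprod.inl ≫ x - ψ' ≫ y) (by
      rw [Preadditive.comp_sub, ← Category.assoc e ψ', h, Category.assoc, hy, ← neg_eq_zero,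
        neg_sub, sub_eq_neg_add, h1])
    refine ⟨biprod.desc (-z) y, ?_⟩
    apply biprod.hom_ext'
    · rw [inl_matrix]
      simp [hz]
    · rw [inr_matrix]
      simp [hy]

lemma epi_matrix [Epi e] [Epi g] : Epi (Biprod.ofComponents (-e) ψ 0 g) := by
  refine ⟨fun {W} x y hxy => ?_⟩
  have h1 := congrArg (biprod.inl ≫ ·) hxy
  have h2 := congrArg (biprod.inr ≫ ·) hxy
  rw [inr_matrix, inr_matrix, cancel_epi] at h2
  rw [inl_matrix, inl_matrix, h2, add_left_inj, neg_inj, cancel_epi] at h1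
  exact biprod.hom_ext' _ _ h1 h2

end

/-- The sequence `E⁰ ⊕ G⁰ ⟶ E¹ ⊕ G¹ ⟶ ⋯` with the matrices `[[-d, ψ], [0, d]]`. -/
def Seq.extension (E G : Seq C) (ψ : ∀ k, E.obj k ⟶ G.obj (k + 1)) : Seq C where
  obj k := E.obj k ⊞ G.obj k
  d k := Biprod.ofComponents (-(E.d k)) (ψ k) 0 (G.d k)

variable {n : ℕ} {E G : Seq C} {ψ : ∀ k, E.obj k ⟶ G.obj (k + 1)}

lemma Seq.isNCokernel_extension (hE : IsNCokernel n E) (hG : IsNCokernel n G)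
    (hψ : ∀ k, k < n → E.d k ≫ ψ (k + 1) = ψ k ≫ G.d (k + 1)) :
    IsNCokernel n (E.extension G ψ) :=
  ⟨fun k hk => (hE.1 k hk).matrix (hG.1 k hk) (hψ k hk),
    have := hE.2
    have := hG.2
    epi_matrix⟩

/-- The inclusion of `G` into the extension. -/
def Seq.extensionInr (N : ℕ) (E G : Seq C) (ψ : ∀ k, E.obj k ⟶ G.obj (k + 1)) :
    SeqHom N G (E.extension G ψ) where
  app _ := biprod.inr
  comm k _ := by
    refine ((biprod_inr_ofComponents (-(E.d k)) (ψ k) 0 (G.d k)).trans ?_).symm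
    rw [zero_comp, zero_add]
    rfl

/-- A ladder from a truncated mapping cone of `φ : P ⟶ E` to `G` gives a homotopy from `φ ψ` to
zero, hence a ladder from `P` to the extension. -/
lemma TruncCone.exists_seqHom_extension {P V : Seq C} {φ : SeqHom (n + 1) P E}
    (K : TruncCone φ V) (Λ : SeqHom (n + 1) V G) (hψ : ∀ k, ψ k = K.ν k ≫ Λ.app (k + 1)) :
    ∃ κ : SeqHom (n + 1) P (E.extension G ψ),
      κ.app 0 = biprod.lift (-(φ.app 0)) (K.μ 0 ≫ Λ.app 0) ∧
      κ.app (n + 1) = (-1 : ℤ) ^ n • (φ.app (n + 1) ≫ biprod.inl) := by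
  have key : ∀ k (hk : k ≤ n) (x : P.obj (k + 1) ⟶ G.obj (k + 1)),
      K.μ k ≫ Λ.app k ≫ G.d k = -(P.d k ≫ x) + φ.app k ≫ ψ k →
      P.d k ≫ ((-1 : ℤ) ^ (k + 1) • biprod.lift (-(φ.app (k + 1))) x) =
        ((-1 : ℤ) ^ k • biprod.lift (-(φ.app k)) (K.μ k ≫ Λ.app k)) ≫
          Biprod.ofComponents (-(E.d k)) (ψ k) 0 (G.d k) := by
    intro k hk x hx
    rw [pow_succ, mul_smul, neg_one_smul, Preadditive.comp_zsmul, Preadditive.zsmul_comp]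
    congr 1
    apply biprod.hom_ext
    · simp [φ.comm k (by omega)]
    · simp [hx]
  obtain ⟨κ, hκ, hκ'⟩ := exists_family (O := fun k => P.obj k ⟶ (E.extension G ψ).obj k) (n + 1)
    (fun k _ => (-1 : ℤ) ^ k • biprod.lift (-(φ.app k)) (K.μ k ≫ Λ.app k))
    ((-1 : ℤ) ^ (n + 1) • biprod.lift (-(φ.app (n + 1))) 0)
  refine ⟨⟨κ, fun k hk => ?_⟩, ?_, ?_⟩
  · obtain hk | rfl : k < n ∨ k = n := by omega
    · refine (congrArg (P.d k ≫ ·) (hκ (k + 1) (by omega))).trans (Eq.trans ?_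
        (congrArg (· ≫ (E.extension G ψ).d k) (hκ k (by omega))).symm)
      refine key k hk.le _ ?_
      rw [← Λ.comm k (by omega), K.μ_d_comp hk, hψ]
    · refine (congrArg (P.d k ≫ ·) hκ').trans (Eq.trans ?_
        (congrArg (· ≫ (E.extension G ψ).d k) (hκ k (by omega))).symm)
      refine key k le_rfl _ ?_
      rw [← Λ.comm k (by omega), ← Category.assoc, K.μ_d_top, Category.assoc, hψ]
      simp
  · refine (hκ 0 (by omega)).trans ?_
    rw [pow_zero, one_smul]
  · refine hκ'.trans ?_
    rw [pow_succ, mul_smul, neg_one_smul]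
    congr 1
    apply biprod.hom_ext <;> simp

end

namespace SuspSeq

variable {n : ℕ} {F : Type u} [Category.{v} F] {T : F ⥤ F} [Preadditive F]
  [HasBinaryBiproducts F] {X Y Z X' Y' : SuspSeq n T}

/-- A morphism to a mapping cone, given by its components. -/
lemma exists_hom_cone [T.Additive] (f : Hom X Y) (x : ∀ k, Z.obj k ⟶ X.obj (k + 1))
    (x' : Z.obj (n + 1) ⟶ T.obj (X.obj 0)) (y : ∀ k, Z.obj k ⟶ Y.obj k)
    (hx : ∀ k, k < n → Z.d k ≫ x (k + 1) = -(x k ≫ X.d (k + 1)))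
    (hx' : Z.d n ≫ x' = -(x n ≫ X.last))
    (hy : ∀ k, k ≤ n → Z.d k ≫ y (k + 1) = x k ≫ f.app (k + 1) + y k ≫ Y.d k)
    (hl : Z.last ≫ T.map (biprod.lift (x 0) (y 0)) =
      x' ≫ T.map (biprod.lift (-(X.d 0)) (f.app 0)) + y (n + 1) ≫ Y.last ≫ T.map biprod.inr)
    (hi : ∀ k, k ≤ n → IsIso (biprod.lift (x k) (y k)))
    (hi' : IsIso (biprod.lift x' (y (n + 1)))) : IsIsomorphic Z (cone f) := by
  obtain ⟨g, hg, hg'⟩ := exists_family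
    (O := fun k => Z.obj k ⟶ X.extObj (k + 1) ⊞ Y.extObj k) (n + 1)
    (fun k hk => biprod.lift (x k ≫ (X.extIso (k + 1) (by omega)).inv)
      (y k ≫ (Y.extIso k (by omega)).inv))
    (biprod.lift (x' ≫ (X.extTop (n + 2) (by omega)).inv)
      (y (n + 1) ≫ (Y.extIso (n + 1) le_rfl).inv))
  have hg0 := hg 0 (by omega)
  refine ⟨⟨⟨g, fun k hk => ?_⟩, ?_⟩, fun k hk => ?_⟩
  · change Z.d k ≫ g (k + 1) = g k ≫ Biprod.ofComponents _ _ _ _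
    rw [hg k hk, lift_matrix, f.extApp_of_le _ (by omega), Y.extMap_of_le k (by omega)]
    simp only [Category.assoc, Iso.inv_hom_id_assoc]
    obtain hk | rfl : k < n ∨ k = n := by omega
    · rw [hg (k + 1) (by omega), X.extMap_of_le _ (by omega), comp_biprod_lift,
        ← Category.assoc, hx k hk, ← Category.assoc, hy k hk.le]
      simp
    · rw [hg', X.extMap_last, comp_biprod_lift, ← Category.assoc, hx', ← Category.assoc,
        hy k le_rfl]
      simp
  · change Z.last ≫ T.map (g 0) = g (n + 1) ≫ biprod.desc _ _
    have e0 : g 0 = biprod.lift (x 0) (y 0) ≫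
        biprod.map (X.extIso 1 (by omega)).inv (Y.extIso 0 (by omega)).inv := by
      rw [hg0]
      ext <;> simp
    rw [e0, hg', Functor.map_comp, ← Category.assoc, hl, biprod.lift_desc,
      Preadditive.add_comp, Category.assoc, Category.assoc, Category.assoc, Category.assoc,
      Category.assoc, Iso.inv_hom_id_assoc, Iso.inv_hom_id_assoc, ← Functor.map_comp,
      ← Functor.map_comp, biprod.inr_map, ← Functor.map_neg, ← Functor.map_add]
    congr 3
    ext <;> simp
  · obtain hk | rfl : k < n + 1 ∨ k = n + 1 := by omega
    · have := hi k (by omega)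
      have e : g k = biprod.lift (x k) (y k) ≫
          biprod.map (X.extIso (k + 1) (by omega)).inv (Y.extIso k (by omega)).inv := by
        rw [hg k hk]
        ext <;> simp
      change IsIso (g k)
      rw [e]
      have := isIso_biprod_map (X.extIso (k + 1) (by omega)).inv (Y.extIso k (by omega)).inv
      infer_instance
    · have e : g (n + 1) = biprod.lift x' (y (n + 1)) ≫
          biprod.map (X.extTop (n + 2) (by omega)).inv (Y.extIso (n + 1) le_rfl).inv := by
        rw [hg']
        ext <;> simp
      change IsIso (g (n + 1))
      rw [e]
      have := isIso_biprod_map (X.extTop (n + 2) (by omega)).inv (Y.extIso (n + 1) le_rfl).inv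
      infer_instance

/-- Isomorphic morphisms have isomorphic mapping cones. -/
lemma isIsomorphic_cone [T.Additive] (f : Hom X Y) (f' : Hom X' Y') (p : Hom X X') (q : Hom Y Y')
    (h : ∀ k, k ≤ n + 1 → f.app k ≫ q.app k = p.app k ≫ f'.app k)
    (hp : ∀ k, k ≤ n + 1 → IsIso (p.app k)) (hq : ∀ k, k ≤ n + 1 → IsIso (q.app k)) :
    IsIsomorphic (cone f) (cone f') := by
  have hsq : ∀ k, f.extApp k ≫ q.extApp k = p.extApp k ≫ f'.extApp k := by
    intro k
    by_cases hk : k ≤ n + 1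
    · simp only [Hom.extApp_of_le _ k hk, Category.assoc, Iso.inv_hom_id_assoc]
      rw [← Category.assoc (f.app k), h k hk, Category.assoc]
    · simp only [Hom.extApp_top _ k hk, Category.assoc, Iso.inv_hom_id_assoc]
      rw [← Functor.map_comp_assoc, h 0 (by omega), Functor.map_comp_assoc]
  have hp' := p.isIso_extApp hp
  have hq' := q.isIso_extApp hq
  refine ⟨⟨⟨fun k => biprod.map (p.extApp (k + 1)) (q.extApp k), fun k hk => ?_⟩, ?_⟩,
    fun k _ => isIso_biprod_map (p.extApp (k + 1)) (q.extApp k)⟩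
  · change Biprod.ofComponents _ _ _ _ ≫ biprod.map _ _ =
      biprod.map _ _ ≫ Biprod.ofComponents _ _ _ _
    apply biprod.hom_ext'
    · rw [inl_matrix, biprod.inl_map_assoc, biprod_inl_ofComponents, biprod.inl_map,
        biprod.inr_map, ← Category.assoc, p.extApp_comm (k + 1) (by omega), ← Category.assoc, hsq]
      simp
    · rw [inr_matrix, biprod.inr_map_assoc, biprod_inr_ofComponents, biprod.inr_map,
        ← Category.assoc, q.extApp_comm k (by omega)]
      simp
  · have e : ∀ (A A' : SuspSeq n T) (r : Hom A A') (k : ℕ) (hk : k ≤ n + 1),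
        (A.extIso k hk).inv ≫ r.extApp k = r.app k ≫ (A'.extIso k hk).inv := by
      intro A A' r k hk
      rw [r.extApp_of_le k hk, Iso.inv_hom_id_assoc]
    change biprod.desc _ _ ≫ T.map (biprod.map _ _) = biprod.map _ _ ≫ biprod.desc _ _
    apply biprod.hom_ext'
    · rw [biprod.inl_desc_assoc, biprod.inl_map_assoc, biprod.inl_desc,
        p.extApp_top (n + 2) (by omega), Category.assoc, Category.assoc, Category.assoc,
        Iso.inv_hom_id_assoc, ← T.map_neg, ← T.map_neg, ← T.map_add, ← T.map_add, ← T.map_comp,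
        ← T.map_comp]
      congr 2
      rw [Preadditive.add_comp, Preadditive.comp_add, Preadditive.neg_comp, Preadditive.comp_neg]
      simp only [Category.assoc, biprod.inl_map, biprod.inr_map]
      rw [← Category.assoc (X.extIso 1 _).inv, ← Category.assoc (Y.extIso 0 _).inv, e, e,
        Category.assoc, Category.assoc, ← Category.assoc (f.app 0), h 0 (by omega),
        ← Category.assoc (X.d 0), p.comm 0 (by omega)]
      simp only [Category.assoc]
    · rw [biprod.inr_desc_assoc, biprod.inr_map_assoc, biprod.inr_desc,
        q.extApp_of_le (n + 1) le_rfl, Category.assoc, Category.assoc, Category.assoc,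
        Category.assoc, Iso.inv_hom_id_assoc, ← T.map_comp, ← Category.assoc (q.app (n + 1)),
        ← q.comm_last, Category.assoc Y.last, ← T.map_comp]
      congr 3
      rw [Category.assoc, biprod.inr_map, ← Category.assoc, e, Category.assoc]

/-- Up to isomorphism, the mapping cones of the extensions of a commutative square depend only on
the isomorphism classes of the rows. -/
lemma exists_isIsomorphic_cone [T.Additive] (hX : IsIsomorphic X' X) (hY : IsIsomorphic Y' Y)
    (a : X.obj 0 ⟶ Y.obj 0) (b : X.obj 1 ⟶ Y.obj 1) (hab : X.d 0 ≫ b = a ≫ Y.d 0) :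
    ∃ (a' : X'.obj 0 ⟶ Y'.obj 0) (b' : X'.obj 1 ⟶ Y'.obj 1), X'.d 0 ≫ b' = a' ≫ Y'.d 0 ∧
      ∀ f : Hom X' Y', f.app 0 = a' → f.app 1 = b' →
        ∃ φ : Hom X Y, φ.app 0 = a ∧ φ.app 1 = b ∧ IsIsomorphic (cone f) (cone φ) := by
  obtain ⟨u, hu⟩ := hX
  obtain ⟨w, hw⟩ := u.exists_inverse hu
  obtain ⟨v', hv'⟩ := hY
  obtain ⟨v, hv⟩ := v'.exists_inverse hv'
  refine ⟨u.app 0 ≫ a ≫ v.app 0, u.app 1 ≫ b ≫ v.app 1, ?_, fun f h0 h1 =>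
    ⟨(w.comp f).comp v', ?_, ?_, isIsomorphic_cone _ _ u v' ?_ hu hv'⟩⟩
  · rw [← Category.assoc, u.comm 0 (by omega), Category.assoc, ← Category.assoc (X.d 0), hab,
      Category.assoc, v.comm 0 (by omega), Category.assoc, Category.assoc]
  · change (w.app 0 ≫ f.app 0) ≫ v'.app 0 = a
    rw [h0, ← Category.assoc (w.app 0), (hw 0 (by omega)).2, Category.id_comp, Category.assoc,
      (hv 0 (by omega)).2, Category.comp_id]
  · change (w.app 1 ≫ f.app 1) ≫ v'.app 1 = b
    rw [h1, ← Category.assoc (w.app 1), (hw 1 (by omega)).2, Category.id_comp, Category.assoc,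
      (hv 1 (by omega)).2, Category.comp_id]
  · intro k hk
    change _ = u.app k ≫ (w.app k ≫ f.app k) ≫ v'.app k
    rw [Category.assoc, ← Category.assoc (u.app k), (hw k hk).1, Category.id_comp]

end SuspSeq

section

variable {C : Type u} [Category.{v} C] [Preadditive C] [HasBinaryBiproducts C] {E₀ E₁ G₀ G₁ : C}
  {e : E₀ ⟶ E₁} {g : G₀ ⟶ G₁} {ψ : E₀ ⟶ G₁}

lemma matrix_fst : Biprod.ofComponents (-e) ψ 0 g ≫ biprod.fst = -(biprod.fst ≫ e) := by
  simp [Biprod.ofComponents]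

lemma matrix_snd :
    Biprod.ofComponents (-e) ψ 0 g ≫ biprod.snd = biprod.fst ≫ ψ + biprod.snd ≫ g := by
  simp [Biprod.ofComponents]

end

lemma iso_hom_comp_eq_id {C : Type u} [Category.{v} C] {A B : C} (e : A ≅ B) (f : B ⟶ A)
    (h : f ≫ e.hom = 𝟙 B) : e.hom ≫ f = 𝟙 A := by
  rw [← cancel_mono e.hom, Category.assoc, h, Category.comp_id, Category.id_comp]

namespace NExactStructure

variable {n : ℕ} {M : Type u} [Category.{v} M] [Preadditive M] [HasZeroObject M]
  [HasBinaryBiproducts M] {𝒳 : NExactStructure n M} {I : ∀ A : M, 𝒳.InjRes A}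

lemma Q_map_lift {A B W : M} (x : W ⟶ A) (y : W ⟶ B) :
    𝒳.Q.map (biprod.lift x y) ≫ biprod.lift (𝒳.Q.map biprod.fst) (𝒳.Q.map biprod.snd) =
      biprod.lift (𝒳.Q.map x) (𝒳.Q.map y) := by
  rw [comp_biprod_lift, ← 𝒳.Q.map_comp, ← 𝒳.Q.map_comp, biprod.lift_fst, biprod.lift_snd]

lemma Q_map_inl_lift {A B : M} :
    𝒳.Q.map (biprod.inl : A ⟶ A ⊞ B) ≫
      biprod.lift (𝒳.Q.map biprod.fst) (𝒳.Q.map biprod.snd) = biprod.inl := by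
  rw [comp_biprod_lift, ← 𝒳.Q.map_comp, ← 𝒳.Q.map_comp, biprod.inl_fst, biprod.inl_snd,
    𝒳.Q.map_id, 𝒳.Q.map_zero]
  apply biprod.hom_ext <;> simp

lemma Q_map_inr_lift {A B : M} :
    𝒳.Q.map (biprod.inr : B ⟶ A ⊞ B) ≫
      biprod.lift (𝒳.Q.map biprod.fst) (𝒳.Q.map biprod.snd) = biprod.inr := by
  rw [comp_biprod_lift, ← 𝒳.Q.map_comp, ← 𝒳.Q.map_comp, biprod.inr_fst, biprod.inr_snd,
    𝒳.Q.map_id, 𝒳.Q.map_zero]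
  apply biprod.hom_ext <;> simp

/-- The image in the stable category of a direct sum is the direct sum of the images. -/
lemma isIso_lift_Q {A B : M} :
    IsIso (biprod.lift (𝒳.Q.map (biprod.fst : A ⊞ B ⟶ A)) (𝒳.Q.map (biprod.snd : A ⊞ B ⟶ B))) := by
  refine ⟨biprod.desc (𝒳.Q.map biprod.inl) (𝒳.Q.map biprod.inr), ?_, ?_⟩
  · rw [biprod.lift_desc, ← 𝒳.Q.map_comp, ← 𝒳.Q.map_comp, ← 𝒳.Q.map_add, biprod.total,
      𝒳.Q.map_id]
  · apply biprod.hom_ext'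
    · rw [biprod.inl_desc_assoc, Q_map_inl_lift, Category.comp_id]
    · rw [biprod.inr_desc_assoc, Q_map_inr_lift, Category.comp_id]

lemma isIso_lift_Q_comp {A A' B : M} (e : A ≅ A') :
    IsIso (biprod.lift (𝒳.Q.map ((biprod.fst : A ⊞ B ⟶ A) ≫ e.hom))
      (𝒳.Q.map (biprod.snd : A ⊞ B ⟶ B))) := by
  have h : biprod.lift (𝒳.Q.map ((biprod.fst : A ⊞ B ⟶ A) ≫ e.hom))
      (𝒳.Q.map (biprod.snd : A ⊞ B ⟶ B)) =
      biprod.lift (𝒳.Q.map (biprod.fst : A ⊞ B ⟶ A)) (𝒳.Q.map (biprod.snd : A ⊞ B ⟶ B)) ≫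
        biprod.map (𝒳.Q.map e.hom) (𝟙 (𝒳.Q.obj B)) := by
    apply biprod.hom_ext <;> simp
  rw [h]
  have := isIso_lift_Q (𝒳 := 𝒳) (A := A) (B := B)
  have := isIso_biprod_map (𝒳.Q.map e.hom) (𝟙 (𝒳.Q.obj B))
  exact IsIso.comp_isIso' ‹_› ‹_›

/-- The identity of `E⁰ ⊕ G⁰` extends to a ladder from the extension of `E` by `G` to an injective
resolution: the first morphism of the extension has the extension property for injective objects,
since those of `E` and `G` have it. -/
lemma exists_ladder_extension (hn : 0 < n) {E G : Seq M} (hE : 𝒳.adm E)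
    (θ : SeqHom (n + 1) G (I (G.obj 0)).seq) (hθ : θ.app 0 = 𝟙 (G.obj 0))
    {ψ : ∀ k, E.obj k ⟶ G.obj (k + 1)} (h : IsNCokernel n (E.extension G ψ))
    (J : 𝒳.InjRes ((E.extension G ψ).obj 0)) :
    ∃ Θ : SeqHom (n + 1) (E.extension G ψ) J.seq, Θ.app 0 = 𝟙 ((E.extension G ψ).obj 0) := by
  obtain ⟨y, hy⟩ := exists_extension_of_ladder θ hθ (J.inj 0 hn) (biprod.inr ≫ J.ι)
  obtain ⟨Θ₁, h₁⟩ := exists_extension_matrix (e := E.d 0) (g := G.d 0) (ψ := ψ 0)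
    (fun z => J.inj 0 hn (E.d 0) ⟨E, hE, rfl⟩ z) J.ι y hy
  obtain ⟨Θ, h0, -⟩ := exists_ladder_of_first h.1 J.isNExactSeq.isComplex
    (𝟙 ((E.extension G ψ).obj 0)) Θ₁ (h₁.trans (Category.id_comp _).symm)
  exact ⟨Θ, h0⟩

/-- A morphism `t` on `A ⊕ B` is the sum of its two restrictions; that to `A` is rewritten through
the isomorphism `e` with inverse `φ`, that to `B` through its stable factorization `θ r`. -/
lemma zsmul_Q_map_eq_add {A B S S' Z : M} (t : A ⊞ B ⟶ Z) (e : A ⟶ S) (φ : S ⟶ A)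
    (he : e ≫ φ = 𝟙 A) (θ : B ⟶ S') (r : S' ⟶ Z)
    (h : 𝒳.Q.map (θ ≫ r) = 𝒳.Q.map (biprod.inr ≫ t)) (ε : ℤ) :
    ε • 𝒳.Q.map t = 𝒳.Q.map (biprod.fst ≫ e) ≫ 𝒳.Q.map ((ε • (φ ≫ biprod.inl)) ≫ t) +
      𝒳.Q.map biprod.snd ≫ (ε • 𝒳.Q.map θ) ≫ 𝒳.Q.map r := by
  rw [Preadditive.zsmul_comp, Preadditive.zsmul_comp, ← 𝒳.Q.map_comp θ, h, Preadditive.comp_zsmul,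
    ← 𝒳.Q.map_comp, ← 𝒳.Q.map_comp, Preadditive.comp_zsmul,
    𝒳.Q.map_zsmul, ← smul_add, ← 𝒳.Q.map_add]
  congr 2
  apply biprod.hom_ext' <;> simp [reassoc_of% he]

/-- The last morphism of the mapping cone of a morphism of angles. Here `κ` shows how the
connecting morphism restricts to the end of `E`, and the inclusion of `G` how it restricts to the
end of `G`. -/
lemma last_extension (hn : 0 < n) {P : M} {E G : Seq M} {ψ : ∀ k, E.obj k ⟶ G.obj (k + 1)}
    (θ : SeqHom (n + 1) G (I (G.obj 0)).seq) (hθ : θ.app 0 = 𝟙 (G.obj 0))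
    (hG : IsNCokernel n G)
    (Θ : SeqHom (n + 1) (E.extension G ψ) (I ((E.extension G ψ).obj 0)).seq)
    (hΘ : Θ.app 0 = 𝟙 ((E.extension G ψ).obj 0)) (κ : SeqHom (n + 1) (I P).seq (E.extension G ψ))
    (φ : (I P).cosyzygy ⟶ E.obj (n + 1)) (e : E.obj (n + 1) ⟶ (I P).cosyzygy) (he : e ≫ φ = 𝟙 _)
    (hκ : κ.app (n + 1) = (-1 : ℤ) ^ n • (φ ≫ biprod.inl)) :
    (-1 : ℤ) ^ n • 𝒳.Q.map (Θ.app (n + 1)) =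
      𝒳.Q.map (biprod.fst ≫ e) ≫ (suspension hn I).map (𝒳.Q.map (κ.app 0)) +
        𝒳.Q.map biprod.snd ≫ ((-1 : ℤ) ^ n • 𝒳.Q.map (θ.app (n + 1))) ≫
          (suspension hn I).map
            (𝒳.Q.map (biprod.inr : G.obj 0 ⟶ (E.extension G ψ).obj 0)) := by
  have hκ' : (suspension hn I).map (𝒳.Q.map (κ.app 0)) =
      𝒳.Q.map (κ.app (n + 1) ≫ Θ.app (n + 1)) :=
    suspension_map hn I (κ.app 0) ⟨κ.comp Θ, (congrArg (κ.app 0 ≫ ·) hΘ).trans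
      (Category.comp_id _), rfl⟩
  obtain ⟨ρ, hρ⟩ := (I (G.obj 0)).exists_ladder_of_first (I ((E.extension G ψ).obj 0)).adm
    ((I ((E.extension G ψ).obj 0)).inj_seq 1 le_rfl hn)
    (biprod.inr : G.obj 0 ⟶ (E.extension G ψ).obj 0)
  have hρ' : (suspension hn I).map (𝒳.Q.map (biprod.inr : G.obj 0 ⟶ (E.extension G ψ).obj 0)) =
      𝒳.Q.map (ρ.app (n + 1)) := suspension_map hn I _ ⟨ρ, hρ, rfl⟩
  obtain ⟨h, hh⟩ := exists_last_sub hG (I ((E.extension G ψ).obj 0)).isNExactSeq.isComplex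
    (θ.comp ρ) ((Seq.extensionInr (n + 1) E G ψ).comp Θ) (by
      change θ.app 0 ≫ ρ.app 0 = biprod.inr ≫ Θ.app 0
      refine (congrArg (· ≫ ρ.app 0) hθ).trans ((Category.id_comp _).trans (hρ.trans ?_))
      exact ((congrArg (biprod.inr ≫ ·) hΘ).trans (Category.comp_id _)).symm)
  have hr : 𝒳.Q.map (θ.app (n + 1) ≫ ρ.app (n + 1)) =
      𝒳.Q.map (biprod.inr ≫ Θ.app (n + 1)) :=
    (Q_map_eq_iff 𝒳 _ _).2
      (hh ▸ FactorsInj.comp_of_inj ((I ((E.extension G ψ).obj 0)).inj_seq n hn le_rfl) _ _)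
  refine (zsmul_Q_map_eq_add (Θ.app (n + 1)) e φ he (θ.app (n + 1)) (ρ.app (n + 1)) hr _).trans ?_
  exact congrArg₂ (· + ·) (congrArg (𝒳.Q.map (biprod.fst ≫ e) ≫ ·)
      ((congrArg (fun z => 𝒳.Q.map (z ≫ Θ.app (n + 1))) hκ).symm.trans hκ'.symm))
    (congrArg (fun z => 𝒳.Q.map biprod.snd ≫ ((-1 : ℤ) ^ n • 𝒳.Q.map (θ.app (n + 1))) ≫ z)
      hρ'.symm)

/-- The commutative square is lifted to a ladder `Λ` from the truncated mapping cone. The cone of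
the induced morphism is given by the extension of the lower row `E` by `G` along the components
`ψ` of `Λ`, and is therefore an angle. -/
theorem StandardData.exists_hom_cone (hn : 0 < n) (h𝒳 : 𝒳.IsFrobenius)
    (hM : n = 1 ∨ IsIdempotentComplete M) (D : StandardData I) {G : Seq M} (hG : IsNCokernel n G)
    (θ : SeqHom (n + 1) G (I (G.obj 0)).seq) (hθ : θ.app 0 = 𝟙 (G.obj 0))
    (a : (D.angle hn).obj 0 ⟶ 𝒳.Q.obj (G.obj 0)) (b : (D.angle hn).obj 1 ⟶ 𝒳.Q.obj (G.obj 1))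
    (hab : (D.angle hn).d 0 ≫ b = a ≫ 𝒳.Q.map (G.d 0)) :
    ∃ f : SuspSeq.Hom (D.angle hn) (angleOf hn I G (θ.app (n + 1))),
      f.app 0 = a ∧ f.app 1 = b ∧ angles hn I (SuspSeq.cone f) := by
  obtain ⟨V, ⟨K⟩, hV⟩ := D.exists_truncCone hn h𝒳
  obtain ⟨a, rfl⟩ := exists_Q_map (A := D.A) (B := G.obj 0) a
  obtain ⟨b, rfl⟩ := exists_Q_map (A := D.E.obj 0) (B := G.obj 1) b
  obtain ⟨Λ, h0, h1⟩ := D.exists_ladder hn K hV.1 (Seq.WeakCokernels.isComplex hG.1) a b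
    ((𝒳.Q.map_comp _ _).trans (hab.trans (𝒳.Q.map_comp _ _).symm))
  obtain ⟨f, hf0, hf⟩ := D.exists_hom_of_ladder hn K hV θ hθ Λ
  refine ⟨f, hf0.trans (congrArg 𝒳.Q.map h0), (hf 0).trans (congrArg 𝒳.Q.map h1), ?_⟩
  obtain ⟨ψ, hψ⟩ : ∃ ψ : ∀ k, D.E.obj k ⟶ G.obj (k + 1), ∀ k, ψ k = K.ν k ≫ Λ.app (k + 1) :=
    ⟨_, fun _ => rfl⟩
  have hfψ : ∀ k, f.app (k + 1) = 𝒳.Q.map (ψ k) := fun k => by rw [hf k, hψ k]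
  have hEG : IsNCokernel n (D.E.extension G ψ) :=
    Seq.isNCokernel_extension (𝒳.isNExactSeq _ D.adm).2 hG fun k hk => by
      rw [hψ, hψ, ← Category.assoc, ← K.ν_d k hk, Category.assoc, Category.assoc,
        Λ.comm (k + 1) (by omega)]
  obtain ⟨Θ, hΘ⟩ := exists_ladder_extension hn D.adm θ hθ hEG (I _)
  obtain ⟨κ, hκ0, hκ⟩ := K.exists_seqHom_extension Λ hψ
  obtain ⟨D', hD'⟩ := angles_angleOf hn h𝒳 hM hEG Θ hΘ
  refine ⟨D', hD'.trans (SuspSeq.exists_hom_cone f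
    (fun k => 𝒳.Q.map (biprod.fst : D.E.obj k ⊞ G.obj k ⟶ D.E.obj k))
    (𝒳.Q.map ((biprod.fst : D.E.obj (n + 1) ⊞ G.obj (n + 1) ⟶ D.E.obj (n + 1)) ≫ D.e.hom))
    (fun k => 𝒳.Q.map (biprod.snd : D.E.obj k ⊞ G.obj k ⟶ G.obj k)) ?_ ?_ ?_ ?_ ?_ ?_)⟩
  · intro k _
    refine (𝒳.Q.map_comp _ _).symm.trans ((congrArg 𝒳.Q.map (matrix_fst (g := G.d k))).trans ?_)
    exact 𝒳.Q.map_neg.trans (congrArg Neg.neg (𝒳.Q.map_comp _ _))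
  · refine (𝒳.Q.map_comp _ _).symm.trans ((congrArg 𝒳.Q.map ((Category.assoc _ _ _).symm.trans
      (congrArg (· ≫ D.e.hom) (matrix_fst (g := G.d n))))).trans ?_)
    rw [Preadditive.neg_comp, Category.assoc]
    exact 𝒳.Q.map_neg.trans (congrArg Neg.neg (𝒳.Q.map_comp _ _))
  · intro k _
    rw [hfψ]
    refine (𝒳.Q.map_comp _ _).symm.trans ((congrArg 𝒳.Q.map (matrix_snd (e := D.E.d k))).trans ?_)
    exact 𝒳.Q.map_add.trans
      (congrArg₂ (· + ·) (𝒳.Q.map_comp _ _) (𝒳.Q.map_comp _ _))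
  · have hlast := last_extension hn θ hθ hG Θ hΘ κ (D.φ.app (n + 1)) D.e.hom
      (iso_hom_comp_eq_id D.e _ D.φ_last) hκ
    have h1 : 𝒳.Q.map (κ.app 0) ≫ biprod.lift (𝒳.Q.map biprod.fst) (𝒳.Q.map biprod.snd) =
        biprod.lift (-((D.angle hn).d 0)) (f.app 0) := by
      refine (congrArg (𝒳.Q.map · ≫ biprod.lift (𝒳.Q.map biprod.fst) (𝒳.Q.map biprod.snd))
        hκ0).trans ((Q_map_lift _ _).trans ?_)
      exact congrArg₂ biprod.lift 𝒳.Q.map_neg hf0.symm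
    refine (congrArg (· ≫ (suspension hn I).map _) hlast).trans
      ((Preadditive.add_comp _ _ _ _ _ _).trans (congrArg₂ (· + ·) ?_ ?_))
    · refine (Category.assoc _ _ _).trans (congrArg (_ ≫ ·) ?_)
      exact ((suspension hn I).map_comp _ _).symm.trans (congrArg (suspension hn I).map h1)
    · refine (Category.assoc _ _ _).trans (congrArg (_ ≫ ·) ?_)
      refine (Category.assoc _ _ _).trans (congrArg (_ ≫ ·) ?_)
      exact ((suspension hn I).map_comp _ _).symm.trans
        (congrArg (suspension hn I).map Q_map_inr_lift)
  · exact fun k _ => isIso_lift_Q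
  · exact isIso_lift_Q_comp D.e

/-- Mapping cones of suitable morphisms of angles are angles. -/
theorem exists_hom_cone_of_angles (hn : 0 < n) (h𝒳 : 𝒳.IsFrobenius)
    (hM : n = 1 ∨ IsIdempotentComplete M) {X Y : SuspSeq n (suspension hn I)}
    (hX : angles hn I X) (hY : angles hn I Y) (a : X.obj 0 ⟶ Y.obj 0) (b : X.obj 1 ⟶ Y.obj 1)
    (hab : X.d 0 ≫ b = a ≫ Y.d 0) :
    ∃ f : SuspSeq.Hom X Y, f.app 0 = a ∧ f.app 1 = b ∧ angles hn I (SuspSeq.cone f) := by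
  obtain ⟨D, hD⟩ := hX
  obtain ⟨D', hD'⟩ := hY
  obtain ⟨V, θ, hV, hθ, h⟩ := D'.exists_isIsomorphic_angleOf hn h𝒳
  obtain ⟨a', b', hab', H⟩ := SuspSeq.exists_isIsomorphic_cone hD (h.symm.trans hD') a b hab
  obtain ⟨f, h0, h1, D'', hf⟩ := D.exists_hom_cone hn h𝒳 hM hV θ hθ a' b' hab'
  obtain ⟨φ, hφ0, hφ1, hφ⟩ := H f h0 h1
  exact ⟨φ, hφ0, hφ1, D'', hf.trans hφ⟩

end NExactStructure

end NExact

end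

theorem mainTheorem3 {M : Type u} [Category.{v} M] [Preadditive M] [HasZeroObject M]
    [HasBinaryBiproducts M] (n : ℕ) (hn : 0 < n) (hM : n = 1 ∨ IsIdempotentComplete M)
    (𝒳 : NExact.NExactStructure n M) (h𝒳 : 𝒳.IsFrobenius) (I : ∀ A : M, 𝒳.InjRes A) :
    NExact.IsAngulated n (NExact.NExactStructure.suspension hn I)
      (NExact.NExactStructure.angles hn I) where
  isEquivalence := NExact.NExactStructure.isEquivalence_suspension hn h𝒳 I
  sum _ _ hX hY := NExact.NExactStructure.angles_sum hn h𝒳 hM hX hY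
  summand _ _ _ hZ h := NExact.NExactStructure.angles_summand hn h𝒳 hM hZ h
  trivial A := NExact.NExactStructure.angles_trivial hn A
  exists_angle α := by
    obtain ⟨D, -, -, h, -⟩ := NExact.NExactStructure.exists_standardData_of_stable hn I α
    exact ⟨D.angle hn, ⟨D, NExact.SuspSeq.IsIsomorphic.refl _⟩, h⟩
  rotate X := NExact.NExactStructure.angles_rotate_iff hn h𝒳 hM X
  extend _ _ hX hY a b hab := NExact.NExactStructure.exists_hom_of_angles hn h𝒳 hX hY a b hab
  extend_cone _ _ hX hY a b hab :=
    NExact.NExactStructure.exists_hom_cone_of_angles hn h𝒳 hM hX hY a b hab
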